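/- **Conventions.** A monoid is a commutative cancellative semigroup with unit element. For a monoid $H$ and $a\in H$, let $\mathsf L_H(a)$ be the set of all $k\ge 0$ such that $a$ is, up to a unit, a product of $k$ atoms (irreducible elements) of $H$. For $L\subset \mathbb N_0$ let $\Delta(L)$ be the set of all $d\ge 1$ for which there is a $k$ with $k,k+d\in L$ and no element of $L$ strictly between $k$ and $k+d$, and let $\Delta(H)=\bigcup_{a\in H}\Delta(\mathsf L_H(a))$. We set $\max\emptyset=0$. A monoid $D$ is *finitely primary of rank* $s\ge 1$ if it is a submonoid of a factorial monoid $F_D=F_D^{\times}\times[q_1,\dots,q_s]$ with $s$ pairwise non-associated primes $q_1,\dots,q_s$ such that $D\setminus D^{\times}\subset q_1\cdots q_s F_D$ and $(q_1\cdots q_s)^{\alpha}F_D\subset D$ for some $\alpha\ge 1$. It is *seminormal* if every element $x$ of its quotient group with $x^m\in D$ for all sufficiently large $m$ lies in $D$, and *reduced* if $D^\times=\{1\}$. **Setting.** Let $G$ be a finite additive abelian group with $|G|>1$, let $n\ge 1$, let $D_1,\dots,D_n$ be reduced seminormal finitely primary monoids of ranks $s_1,\dots,s_n$, let $T=D_1\times\dots\times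 D_n$, and let $\iota\colon T\to G$ be a homomorphism. Let $\mathcal F(G)$ be the free abelian monoid with basis $G$, let $\sigma\colon\mathcal F(G)\to G$ be the homomorphism with $\sigma(g)=g$ for all $g\in G$, and let $$\mathcal B(G)=\{S\in\mathcal F(G): \sigma(S)=0\},\qquad B=\{S\,t\in\mathcal F(G)\times T: \sigma(S)+\iota(t)=0\}.$$ Write $\Delta(G)=\Delta(\mathcal B(G))$ and $\mathsf L(A)=\mathsf L_B(A)$ for $A\in B$. For $A=g_1\cdots g_k a_1\cdots a_n\in\mathcal F(G)\times T$ with $g_j\in G$ and $a_i\in D_i$, define the norm $$\|A\|=k+2\sum_{i=1}^n\max\mathsf L_{D_i}(a_i).$$ **Proposition 3.2.** Let $A\in B$ satisfy $\max\Delta(\mathsf L(A))\ge\max\Delta(G)+2$. Suppose that $|\{i\in\{1,\dots,n\}: s_i>1\}|\le 1$ or that $G$ is an elementary $2$-group (that is, $2g=0$ for all $g\in G$). Then there exists $A'\in B$ with $$\|A'\|<\|A\|\qquad\text{and}\qquad \max\Delta(\mathsf L(A'))\ge\max\Delta(\mathsf L(A))-1 .$$ -/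

import Mathlib

universe u v

namespace WeaklyKrull

/-! ### Sets of lengths and sets of distances -/

/-- The set of lengths `L_H(a)`: all `k` such that `a` is, up to a unit, a product of `k` atoms
of `H` (so `L_H(a) = {0}` for a unit `a`). -/
def lengthSet {H : Type*} [CommMonoid H] (a : H) : Set ℕ :=
  {k | ∃ z : Multiset H, (∀ w ∈ z, Irreducible w) ∧ Associated z.prod a ∧ z.card = k}

/-- The set of distances `Δ(L)` of a set `L` of nonnegative integers: the differences of
consecutive elements of `L`. -/
def distanceSet (L : Set ℕ) : Set ℕ :=
  {d | 0 < d ∧ ∃ k ∈ L, k + d ∈ L ∧ ∀ m ∈ L, ¬ (k < m ∧ m < k + d)}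

/-- The set of distances `Δ(H)` of a monoid `H`. -/
def monoidDistanceSet (H : Type*) [CommMonoid H] : Set ℕ :=
  ⋃ a : H, distanceSet (lengthSet a)

/-- The maximum of a set of nonnegative integers, with `max ∅ = 0`; it is taken in `ℕ∞`, so that
it is the supremum (that is, `⊤`) for an unbounded set. -/
noncomputable def setMax (L : Set ℕ) : ℕ∞ :=
  ⨆ k ∈ L, (k : ℕ∞)

/-! ### Reduced seminormal finitely primary monoids -/

/-- A monoid is reduced if `1` is its only unit. -/
def IsReducedMonoid (M : Type*) [CommMonoid M] : Prop :=
  ∀ x : M, IsUnit x → x = 1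

/-- A monoid `M` is seminormal if every element `x` of its quotient group with `x ^ n ∈ M` for all
sufficiently large `n` lies in `M`. -/
def IsSeminormal (M : Type*) [CancelCommMonoid M] : Prop :=
  ∀ x : Algebra.GrothendieckGroup M,
    (∃ N : ℕ, ∀ n ≥ N, x ^ n ∈ MonoidHom.mrange (Algebra.GrothendieckGroup.of (M := M))) →
      x ∈ MonoidHom.mrange (Algebra.GrothendieckGroup.of (M := M))

/-- The product `q₁ ⋯ q_s` of the `s` primes `q₁, …, q_s` of the factorial monoid
`E × [q₁, …, q_s]` with unit group `E`; the element `ε q₁ ^ k₁ ⋯ q_s ^ k_s` of this monoid is the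
pair `(ε, (k₁, …, k_s))`. -/
def primeProd (E : Type*) [CommGroup E] (s : ℕ) : E × Multiplicative (Fin s → ℕ) :=
  (1, Multiplicative.ofAdd fun _ => 1)

/-- `M` is finitely primary of rank `s`: up to an injective homomorphism `φ`, it is a submonoid of
a factorial monoid `F = E × [q₁, …, q_s]` (`s ≥ 1` pairwise non-associated primes, unit group `E`)
with `M ∖ Mˣ ⊆ q₁ ⋯ q_s F` and `(q₁ ⋯ q_s) ^ α F ⊆ M` for some `α ≥ 1`. -/
def IsFinitelyPrimaryOfRank (M : Type u) [CancelCommMonoid M] (s : ℕ) : Prop :=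
  1 ≤ s ∧ ∃ (E : Type u) (_ : CommGroup E) (φ : M →* E × Multiplicative (Fin s → ℕ)) (α : ℕ),
    Function.Injective φ ∧ 1 ≤ α ∧
      (∀ x : M, ¬ IsUnit x → ∃ y, φ x = primeProd E s * y) ∧
      (∀ y, ∃ x : M, φ x = primeProd E s ^ α * y)

/-! ### Zero-sum sequences and `T`-block monoids -/

/-- The free abelian monoid `𝓕(G)` with basis `G`, written multiplicatively: its elements are the
finite multisets of elements of `G` ("sequences over `G`"). -/
abbrev Seq (G : Type*) : Type _ := Multiplicative (Multiset G)

/-- The sum `σ(S)` of a sequence `S` over `G`. -/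
def seqSum {G : Type*} [AddCommGroup G] (S : Seq G) : G :=
  (Multiplicative.toAdd S).sum

/-- The monoid `𝓑(G)` of zero-sum sequences over `G`. -/
def zeroSumMonoid (G : Type*) [AddCommGroup G] : Submonoid (Seq G) where
  carrier := {S | seqSum S = 0}
  one_mem' := by simp [seqSum]
  mul_mem' := by
    intro a b ha hb
    simp only [Set.mem_ofPred_eq, seqSum, toAdd_mul, Multiset.sum_add] at *
    rw [ha, hb, add_zero]

/-- The `T`-block monoid `𝓑(G, T, ι) = {S t ∈ 𝓕(G) × T | σ(S) + ι(t) = 0}` over `G` defined by the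
homomorphism `ι : T → G`. -/
def blockMonoid {G : Type*} [AddCommGroup G] {T : Type*} [CommMonoid T]
    (ι : T →* Multiplicative G) : Submonoid (Seq G × T) where
  carrier := {x | seqSum x.1 + Multiplicative.toAdd (ι x.2) = 0}
  one_mem' := by simp [seqSum]
  mul_mem' := by
    intro a b ha hb
    simp only [Set.mem_ofPred_eq, seqSum, Prod.fst_mul, Prod.snd_mul, map_mul, toAdd_mul,
      Multiset.sum_add] at *
    rw [add_add_add_comm, ha, hb, add_zero]

/-- The norm `‖g₁ ⋯ g_k a₁ ⋯ a_n‖ = k + 2 ∑ᵢ max L_{Dᵢ}(aᵢ)` on `𝓕(G) × D₁ × ⋯ × D_n`. -/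
noncomputable def blockNorm {G : Type*} {n : ℕ} {D : Fin n → Type*} [∀ i, CancelCommMonoid (D i)]
    (A : Seq G × (∀ i, D i)) : ℕ∞ :=
  ((Multiplicative.toAdd A.1).card : ℕ∞) + 2 * ∑ i, setMax (lengthSet (A.2 i))

end WeaklyKrull

open WeaklyKrull

set_option linter.unusedSectionVars false

/-! A reduced seminormal finitely primary monoid of rank s is `0` together with all elements of `E ×
ℤ^s` with positive valuations (`exists_model`), and the largest length of an element is its smallest
valuation (`setMax_lengthSet_eq`). The homomorphism `ι` extends to homomorphisms `κ i` on these
ambient groups, so the block monoid becomes the explicit additive monoid `Blk κ`.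

Suppose the conclusion fails for `A`, let d be its largest distance and k, k + d adjacent lengths.
Then `A` is `Critical`: no element of smaller norm has a gap of size at least d - 1. The engine is
`Critical.reduce`: it suffices to find an element of smaller norm with a length at most k, a length
at least k + d - 1, and such that every length m strictly between these bounds lifts to a length m
or m + 1 of `A`, which would lie in the gap of `A`. Such an element arises by altering a piece of
`A` or replacing it by its class in `G`. Lifting works because an atom without the altered piece is
zero-sum free, so every factor that appears when the piece is restored must touch it; this usually
allows at most two factors.

Call an atom low if it occurs in a factorization of length at most k. Reductions show that low atoms
contain at most one element of `G` (`card_le_one`), that a nonzero component of `A` has all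
valuations at least 3 (`three_le`), and that a nonzero component of a low atom has both a valuation
1 and a valuation different from 1 (`exists_val_eq_one`, `exists_val_ne_one`). The last fact forces
rank greater than 1, so under the first hypothesis at most one component of `A` is nonzero.

An element of order N ≥ 3 gives the distance N - 2 in Δ(G), so all orders in `G` are at most d. With
at most one nonzero component this yields k = 2, and then one prime at a place of minimal valuation
can be removed or replaced by its class (`false_of_suppIn`). Over an elementary 2-group, classes
depend on the valuations only through their parities, and two nonzero components are impossible: d =
2 is excluded by a small explicit element, otherwise k ≤ 3, and k = 2 and k = 3 are excluded by
moving even amounts between atoms (`false_of_two_comp`). -/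

namespace WeaklyKrull

/-! ### Atoms and lengths in a submonoid of an additive monoid -/

section Length

variable {Z : Type*} [AddCancelCommMonoid Z]

/-- `W` is an atom of the submonoid `B` (whose only unit is `0`). -/
def IsAtomIn (B : AddSubmonoid Z) (W : Z) : Prop :=
  W ∈ B ∧ W ≠ 0 ∧ ∀ X ∈ B, ∀ Y ∈ B, X + Y = W → X = 0 ∨ Y = 0

/-- `X` is a sum of `m` atoms of `B`. -/
def LenIn (B : AddSubmonoid Z) (X : Z) (m : ℕ) : Prop :=
  ∃ f : Multiset Z, (∀ w ∈ f, IsAtomIn B w) ∧ f.sum = X ∧ f.card = m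

variable {B : AddSubmonoid Z} {X Y W : Z} {m n : ℕ}

theorem LenIn.mem (h : LenIn B X m) : X ∈ B := by
  obtain ⟨f, hf, rfl, -⟩ := h
  exact AddSubmonoid.multiset_sum_mem _ _ fun a ha => (hf a ha).1

theorem LenIn.zero : LenIn B 0 0 := ⟨0, by simp, by simp, by simp⟩

theorem LenIn.add (hX : LenIn B X m) (hY : LenIn B Y n) : LenIn B (X + Y) (m + n) := by
  obtain ⟨f, hf, rfl, rfl⟩ := hX
  obtain ⟨g, hg, rfl, rfl⟩ := hY
  refine ⟨f + g, ?_, by simp, by simp⟩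
  intro w hw
  rcases Multiset.mem_add.1 hw with h | h
  exacts [hf w h, hg w h]

theorem IsAtomIn.lenIn (h : IsAtomIn B W) : LenIn B W 1 :=
  ⟨{W}, by simpa using h, by simp, by simp⟩

theorem LenIn.atom_add (hW : IsAtomIn B W) (hY : LenIn B Y n) : LenIn B (W + Y) (n + 1) := by
  rw [add_comm n]; exact hW.lenIn.add hY

theorem LenIn.eq_zero_of_zero (h : LenIn B X 0) : X = 0 := by
  obtain ⟨f, -, rfl, hc⟩ := h
  simp [Multiset.card_eq_zero.1 hc]

theorem LenIn.exists_atom (h : LenIn B X (m + 1)) :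
    ∃ W Y, IsAtomIn B W ∧ X = W + Y ∧ LenIn B Y m := by
  obtain ⟨f, hf, rfl, hc⟩ := h
  obtain ⟨w, g, rfl⟩ : ∃ w g, f = w ::ₘ g := by
    obtain ⟨w, hw⟩ := Multiset.card_pos_iff_exists_mem.1 (by omega : 0 < f.card)
    exact ⟨w, _, (Multiset.exists_cons_of_mem hw).choose_spec⟩
  refine ⟨w, g.sum, hf w (by simp), by simp, g, fun x hx => hf x (by simp [hx]), rfl, ?_⟩
  simpa using hc

theorem LenIn.isAtomIn (h : LenIn B X 1) : IsAtomIn B X := by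
  obtain ⟨W, Y, hW, rfl, hY⟩ := LenIn.exists_atom (m := 0) h
  rw [hY.eq_zero_of_zero, add_zero]; exact hW

/-- An atom with a property that some summand of a factorization must have can be split off. -/
theorem LenIn.exists_atom_of {p : Z → Prop} (h0 : ¬ p 0)
    (hp : ∀ x y, p (x + y) → p x ∨ p y) (h : LenIn B X m) (hX : p X) :
    ∃ W Y n, m = n + 1 ∧ IsAtomIn B W ∧ p W ∧ X = W + Y ∧ LenIn B Y n := by
  obtain ⟨f, hf, rfl, hc⟩ := h
  have key : ∃ w ∈ f, p w := by
    by_contra! hcon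
    have : ∀ g : Multiset Z, (∀ w ∈ g, ¬ p w) → ¬ p g.sum := by
      intro g
      induction g using Multiset.induction_on with
      | empty => intro _; simpa using h0
      | cons a g ih =>
        intro hg hs
        rw [Multiset.sum_cons] at hs
        rcases hp _ _ hs with h | h
        · exact hg a (by simp) h
        · exact ih (fun w hw => hg w (by simp [hw])) h
    exact this f hcon hX
  obtain ⟨w, hw, hpw⟩ := key
  obtain ⟨g, rfl⟩ := Multiset.exists_cons_of_mem hw
  refine ⟨w, g.sum, g.card, ?_, hf w (by simp), hpw, by simp, g,
    fun x hx => hf x (by simp [hx]), rfl, rfl⟩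
  simpa using hc.symm

theorem IsAtomIn.lenIn_eq_one (h0 : ∀ x ∈ B, ∀ y ∈ B, x + y = 0 → x = 0)
    (hW : IsAtomIn B W) (h : LenIn B W m) : m = 1 := by
  match m, h with
  | 0, h => exact absurd h.eq_zero_of_zero hW.2.1
  | 1, _ => rfl
  | m + 2, h =>
    exfalso
    obtain ⟨X, Y, hX, rfl, hY⟩ := h.exists_atom
    rcases hW.2.2 X hX.1 Y hY.mem rfl with h | h
    · exact hX.2.1 h
    · subst h
      obtain ⟨X', Y', hX', h', hY'⟩ := hY.exists_atom
      exact hX'.2.1 (h0 X' hX'.1 Y' hY'.mem h'.symm)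

/-- Existence of factorizations from a weight function, with a bound on the lengths. -/
theorem exists_lenIn (wt : Z →+ ℤ) (hpos : ∀ x ∈ B, x ≠ 0 → 1 ≤ wt x) (hX : X ∈ B) :
    ∃ m, LenIn B X m := by
  have key : ∀ N : ℕ, ∀ X ∈ B, wt X ≤ N → ∃ m, LenIn B X m := by
    intro N
    induction N with
    | zero =>
      intro X hX hN
      by_cases h : X = 0
      · exact ⟨0, h ▸ LenIn.zero⟩
      · have := hpos X hX h
        simp at hN; omega
    | succ N ih =>
      intro X hX hN
      by_cases h : X = 0
      · exact ⟨0, h ▸ LenIn.zero⟩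
      by_cases ha : IsAtomIn B X
      · exact ⟨1, ha.lenIn⟩
      · simp only [IsAtomIn, not_and, not_forall, not_or] at ha
        obtain ⟨Y, hY, Y', hY', rfl, h1, h2⟩ := ha hX h
        have e1 := hpos Y hY h1
        have e2 := hpos Y' hY' h2
        rw [map_add] at hN
        push_cast at hN
        obtain ⟨m, hm⟩ := ih Y hY (by omega)
        obtain ⟨n, hn⟩ := ih Y' hY' (by omega)
        exact ⟨_, hm.add hn⟩
  exact key (wt X).toNat X hX (Int.self_le_toNat _)

theorem LenIn.le_weight (wt : Z →+ ℤ) (hpos : ∀ x ∈ B, x ≠ 0 → 1 ≤ wt x)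
    (h : LenIn B X m) : (m : ℤ) ≤ wt X := by
  induction m generalizing X with
  | zero => rw [h.eq_zero_of_zero]; simp
  | succ m ih =>
    obtain ⟨W, Y, hW, rfl, hY⟩ := h.exists_atom
    have := ih hY
    have := hpos W hW.1 hW.2.1
    rw [map_add]; push_cast; omega

end Length

/-- Comparison of lengths along an injective homomorphism whose image is divisor-closed. -/
theorem lenIn_map_iff {Z₁ Z₂ : Type*} [AddCancelCommMonoid Z₁] [AddCancelCommMonoid Z₂]
    {B₁ : AddSubmonoid Z₁} {B₂ : AddSubmonoid Z₂} (f : Z₁ →+ Z₂) (hf : Function.Injective f)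
    (hB : ∀ x, x ∈ B₁ ↔ f x ∈ B₂)
    (hdiv : ∀ x, ∀ Y ∈ B₂, ∀ Y' ∈ B₂, Y + Y' = f x → ∃ y, f y = Y) (x : Z₁) (m : ℕ) :
    LenIn B₁ x m ↔ LenIn B₂ (f x) m := by
  have hatom : ∀ x, IsAtomIn B₁ x ↔ IsAtomIn B₂ (f x) := by
    intro x
    refine and_congr (hB x) (and_congr (by rw [Ne, Ne, map_eq_zero_iff f hf]) ⟨?_, ?_⟩)
    · intro h Y hY Y' hY' hYY
      obtain ⟨y, rfl⟩ := hdiv x Y hY Y' hY' hYY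
      obtain ⟨y', rfl⟩ := hdiv x Y' hY' _ hY (by rw [add_comm]; exact hYY)
      rw [map_eq_zero_iff f hf, map_eq_zero_iff f hf]
      exact h y ((hB y).2 hY) y' ((hB y').2 hY') (hf (by simpa using hYY))
    · intro h Y hY Y' hY' hYY
      have := h (f Y) ((hB _).1 hY) (f Y') ((hB _).1 hY') (by rw [← map_add, hYY])
      rwa [map_eq_zero_iff f hf, map_eq_zero_iff f hf] at this
  constructor
  · rintro ⟨s, hs, rfl, rfl⟩
    refine ⟨s.map f, ?_, (map_multiset_sum f s).symm, by simp⟩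
    intro w hw
    obtain ⟨w', hw', rfl⟩ := Multiset.mem_map.1 hw
    exact (hatom w').1 (hs w' hw')
  · intro h
    induction m generalizing x with
    | zero =>
      have := h.eq_zero_of_zero
      rw [map_eq_zero_iff f hf] at this
      rw [this]; exact LenIn.zero
    | succ m ih =>
      obtain ⟨W, Y, hW, hx, hY⟩ := h.exists_atom
      obtain ⟨w, rfl⟩ := hdiv x W hW.1 Y hY.mem hx.symm
      obtain ⟨y, rfl⟩ := hdiv x Y hY.mem _ hW.1 (by rw [add_comm]; exact hx.symm)
      have : x = w + y := hf (by simpa using hx)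
      rw [this]
      exact LenIn.atom_add ((hatom w).2 hW) (ih y hY)

/-- Lengths in a monoid computed in the image of an injective homomorphism. -/
theorem mem_lengthSet_iff {H : Type*} [CommMonoid H] {Z : Type*} [AddCancelCommMonoid Z]
    {B : AddSubmonoid Z} (h0 : ∀ x ∈ B, ∀ y ∈ B, x + y = 0 → x = 0)
    (f : H → Z) (hf : Function.Injective f) (f1 : f 1 = 0) (fmul : ∀ a b, f (a * b) = f a + f b)
    (hr : ∀ x, x ∈ B ↔ ∃ a, f a = x) (a : H) (m : ℕ) :
    m ∈ lengthSet a ↔ LenIn B (f a) m := by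
  have hB : ∀ a, f a ∈ B := fun a => (hr _).2 ⟨a, rfl⟩
  have hz : ∀ a, f a = 0 ↔ a = 1 := fun a => by rw [← f1]; exact hf.eq_iff
  have hunit : ∀ a : H, IsUnit a ↔ a = 1 := by
    intro a
    refine ⟨?_, fun h => h ▸ isUnit_one⟩
    intro h
    obtain ⟨b, hb⟩ := h.exists_right_inv
    exact (hz a).1 (h0 _ (hB a) _ (hB b) (by rw [← fmul, hb, f1]))
  have hatom : ∀ a, Irreducible a ↔ IsAtomIn B (f a) := by
    intro a
    rw [irreducible_iff]
    constructor
    · rintro ⟨h1, h2⟩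
      refine ⟨hB a, fun h => h1 ((hunit a).2 ((hz a).1 h)), ?_⟩
      intro X hX Y hY hXY
      obtain ⟨x, rfl⟩ := (hr X).1 hX
      obtain ⟨y, rfl⟩ := (hr Y).1 hY
      rw [hz, hz, ← hunit, ← hunit]
      exact h2 (hf (by rw [fmul, hXY]))
    · rintro ⟨-, h1, h2⟩
      refine ⟨fun h => h1 ((hz a).2 ((hunit a).1 h)), ?_⟩
      intro x y hxy
      rw [hunit, hunit, ← hz, ← hz]
      exact h2 _ (hB x) _ (hB y) (by rw [hxy, fmul])
  have hprod : ∀ z : Multiset H, f z.prod = (z.map f).sum := by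
    intro z
    induction z using Multiset.induction_on with
    | empty => simpa using f1
    | cons a z ih => simp [fmul, ih]
  -- `B` is reduced, hence so is `H`, and "up to a unit" disappears.
  have hassoc : ∀ a b : H, Associated a b ↔ a = b := by
    intro a b
    refine ⟨?_, fun h => h ▸ Associated.refl _⟩
    rintro ⟨u, rfl⟩
    rw [(hunit u).1 u.isUnit, mul_one]
  constructor
  · rintro ⟨z, hz1, hz2, rfl⟩
    refine ⟨z.map f, ?_, ?_, by simp⟩
    · intro w hw
      obtain ⟨w', hw', rfl⟩ := Multiset.mem_map.1 hw
      exact (hatom w').1 (hz1 w' hw')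
    · rw [← hprod, (hassoc _ _).1 hz2]
  · rintro ⟨s, hs, hsum, rfl⟩
    obtain ⟨z, rfl⟩ : ∃ z : Multiset H, z.map f = s := by
      refine ⟨s.pmap (fun x hx => ((hr x).1 hx).choose) (fun x hx => (hs x hx).1), ?_⟩
      rw [Multiset.map_pmap]
      conv_rhs => rw [← Multiset.map_id s, ← Multiset.pmap_eq_map (p := fun x => x ∈ B) _ (H := fun x hx => (hs x hx).1)]
      refine Multiset.pmap_congr _ ?_
      intro a _ h1 h2
      exact ((hr a).1 h1).choose_spec
    refine ⟨z, fun w hw => (hatom w).2 (hs _ (Multiset.mem_map_of_mem f hw)), ?_, by simp⟩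
    rw [hassoc]
    exact hf (by rw [hprod, hsum])

/-! ### A concrete model of `T`-block monoids -/

/-- The ambient monoid `𝓕(G) × ∏ᵢ (Eᵢ × ℤ^{Jᵢ})`, written additively. -/
abbrev Amb (G : Type*) {I : Type*} (E J : I → Type*) := Multiset G × (∀ i, E i × (J i → ℤ))

/-- All valuations are positive. -/
def Valid {E J : Type*} (x : E × (J → ℤ)) : Prop := ∀ j, 1 ≤ x.2 j

/-- The minimal valuation. -/
noncomputable def minVal {E J : Type*} [Fintype J] [Nonempty J] (x : E × (J → ℤ)) : ℕ :=
  (Finset.univ.inf' Finset.univ_nonempty x.2).toNat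

theorem minVal_le {E J : Type*} [Fintype J] [Nonempty J] {x : E × (J → ℤ)} {j : J} {b : ℕ}
    (h : x.2 j ≤ b) : minVal x ≤ b := by
  have : Finset.univ.inf' Finset.univ_nonempty x.2 ≤ x.2 j := Finset.inf'_le _ (Finset.mem_univ j)
  unfold minVal; omega

theorem le_minVal {E J : Type*} [Fintype J] [Nonempty J] {x : E × (J → ℤ)} {b : ℕ}
    (h : ∀ j, (b : ℤ) ≤ x.2 j) : b ≤ minVal x := by
  have : (b : ℤ) ≤ Finset.univ.inf' Finset.univ_nonempty x.2 :=
    Finset.le_inf' _ _ fun j _ => h j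
  unfold minVal; omega

theorem exists_eq_minVal {E J : Type*} [Fintype J] [Nonempty J] {x : E × (J → ℤ)}
    (h : ∀ j, 0 ≤ x.2 j) : ∃ j, x.2 j = minVal x := by
  obtain ⟨j, -, hj⟩ := Finset.exists_mem_eq_inf' (Finset.univ_nonempty (α := J)) x.2
  refine ⟨j, ?_⟩
  have := h j
  unfold minVal; omega

theorem minVal_le_val {E J : Type*} [Fintype J] [Nonempty J] {x : E × (J → ℤ)}
    (h : ∀ j, 0 ≤ x.2 j) (j : J) : (minVal x : ℤ) ≤ x.2 j := by
  have h1 : Finset.univ.inf' Finset.univ_nonempty x.2 ≤ x.2 j :=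
    Finset.inf'_le _ (Finset.mem_univ j)
  have := h j
  unfold minVal; omega

section Model

variable {G : Type*} [AddCommGroup G] {I : Type*} [Fintype I] [DecidableEq I]
  {E : I → Type*} [∀ i, AddCommGroup (E i)] {J : I → Type*} [∀ i, Fintype (J i)]
  [∀ i, DecidableEq (J i)] [∀ i, Nonempty (J i)]

/-- Every component is `0` or has positive valuations. -/
def Ok (X : Amb G E J) : Prop := ∀ i, X.2 i = 0 ∨ Valid (X.2 i)

/-- A sequence over `G` as an element of the ambient monoid. -/
def gs (S : Multiset G) : Amb G E J := (S, 0)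

/-- An element of the `i`-th component as an element of the ambient monoid. -/
def sg (i : I) (x : E i × (J i → ℤ)) : Amb G E J := (0, Pi.single i x)

/-- Deleting the `i`-th component. -/
def rest (i : I) (X : Amb G E J) : Amb G E J := (X.1, Function.update X.2 i 0)

@[simp] theorem gs_fst (S : Multiset G) : (gs S : Amb G E J).1 = S := rfl
@[simp] theorem gs_snd (S : Multiset G) (i : I) : (gs S : Amb G E J).2 i = 0 := rfl
@[simp] theorem sg_fst (i : I) (x : E i × (J i → ℤ)) : (sg i x : Amb G E J).1 = 0 := rfl
@[simp] theorem sg_snd_self (i : I) (x : E i × (J i → ℤ)) : (sg i x : Amb G E J).2 i = x := by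
  simp [sg]
theorem sg_snd_of_ne {i i' : I} (h : i' ≠ i) (x : E i × (J i → ℤ)) :
    (sg i x : Amb G E J).2 i' = 0 := by
  simp [sg, h]
@[simp] theorem rest_fst (i : I) (X : Amb G E J) : (rest i X).1 = X.1 := rfl
@[simp] theorem rest_snd_self (i : I) (X : Amb G E J) : (rest i X).2 i = 0 := by
  simp [rest]
theorem rest_snd_of_ne {i i' : I} (h : i' ≠ i) (X : Amb G E J) : (rest i X).2 i' = X.2 i' := by
  simp [rest, h]

theorem gs_add (S T : Multiset G) : (gs (S + T) : Amb G E J) = gs S + gs T := by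
  ext1 <;> simp [gs]
@[simp] theorem gs_zero : (gs 0 : Amb G E J) = 0 := rfl
@[simp] theorem sg_zero (i : I) : (sg i 0 : Amb G E J) = 0 := by
  simp [sg]
theorem sg_add (i : I) (x y : E i × (J i → ℤ)) :
    (sg i (x + y) : Amb G E J) = sg i x + sg i y := by
  simp [sg, Pi.single_add]
theorem sg_sub_add (i : I) (x y : E i × (J i → ℤ)) :
    (sg i (x - y) : Amb G E J) + sg i y = sg i x := by
  rw [← sg_add, sub_add_cancel]

theorem rest_add_sg (i : I) (X : Amb G E J) : rest i X + sg i (X.2 i) = X := by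
  refine Prod.ext (by simp) (funext fun i' => ?_)
  by_cases h : i' = i
  · subst h; simp
  · simp [rest_snd_of_ne h, sg_snd_of_ne h]

theorem rest_add (i : I) (X Y : Amb G E J) : rest i (X + Y) = rest i X + rest i Y := by
  refine Prod.ext (by simp) (funext fun i' => ?_)
  by_cases h : i' = i
  · subst h; simp
  · simp [rest_snd_of_ne h]

theorem rest_eq_self {i : I} {X : Amb G E J} (h : X.2 i = 0) : rest i X = X := by
  have := rest_add_sg i X
  rwa [h, sg_zero, add_zero] at this

theorem rest_sg (i : I) (x : E i × (J i → ℤ)) : rest i (sg i x : Amb G E J) = 0 := by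
  refine Prod.ext (by simp) (funext fun i' => ?_)
  by_cases h : i' = i
  · subst h; simp
  · simp [rest_snd_of_ne h, sg_snd_of_ne h]

theorem Valid.add {E J : Type*} [AddCommGroup E] {x y : E × (J → ℤ)} (hx : Valid x)
    (hy : Valid y) : Valid (x + y) := fun j => by
  have := hx j; have := hy j
  simp only [Prod.snd_add, Pi.add_apply]; omega

theorem Valid.ne_zero {i : I} {x : E i × (J i → ℤ)} (hx : Valid x) : x ≠ 0 := by
  rintro rfl
  have := hx (Classical.arbitrary _)
  simp at this

theorem ok_zero : Ok (0 : Amb G E J) := fun _ => Or.inl rfl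

theorem Ok.add {X Y : Amb G E J} (hX : Ok X) (hY : Ok Y) : Ok (X + Y) := by
  intro i
  rcases hX i with h | h <;> rcases hY i with h' | h' <;>
    simp only [Prod.snd_add, Pi.add_apply]
  · left; rw [h, h', add_zero]
  · right; rwa [h, zero_add]
  · right; rwa [h', add_zero]
  · exact Or.inr (h.add h')

theorem Ok.valid {X : Amb G E J} (hX : Ok X) {i : I} (h : X.2 i ≠ 0) : Valid (X.2 i) :=
  (hX i).resolve_left h

theorem Ok.nonneg {X : Amb G E J} (hX : Ok X) (i : I) (j : J i) : 0 ≤ (X.2 i).2 j := by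
  rcases hX i with h | h
  · simp [h]
  · have := h j; omega

theorem Ok.eq_zero {X : Amb G E J} (hX : Ok X) {i : I} {j : J i} (h : (X.2 i).2 j ≤ 0) :
    X.2 i = 0 := by
  rcases hX i with h' | h'
  · exact h'
  · have := h' j; omega

theorem ok_gs (S : Multiset G) : Ok (gs S : Amb G E J) := fun _ => Or.inl rfl

theorem ok_sg {i : I} {x : E i × (J i → ℤ)} (hx : Valid x) : Ok (sg i x : Amb G E J) := by
  intro i'
  by_cases h : i' = i
  · subst h; simp [hx]
  · simp [sg_snd_of_ne h]

theorem Ok.rest {X : Amb G E J} (hX : Ok X) (i : I) : Ok (rest i X) := by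
  intro i'
  by_cases h : i' = i
  · subst h; simp
  · rw [rest_snd_of_ne h]; exact hX i'

theorem Ok.eq_zero_of_add {X Y : Amb G E J} (hX : Ok X) (hY : Ok Y) (h : X + Y = 0) : X = 0 := by
  have h1 : X.1 + Y.1 = 0 := congrArg Prod.fst h
  refine Prod.ext ?_ (funext fun i => ?_)
  · exact (add_eq_zero.1 h1).1
  · have h2 : X.2 i + Y.2 i = 0 := congrFun (congrArg Prod.snd h) i
    have h3 := congrFun (congrArg Prod.snd h2) (Classical.arbitrary (J i))
    have := hX.nonneg i (Classical.arbitrary (J i))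
    have := hY.nonneg i (Classical.arbitrary (J i))
    simp only [Prod.snd_add, Pi.add_apply, Prod.snd_zero, Pi.zero_apply] at h3
    exact hX.eq_zero (j := Classical.arbitrary (J i)) (by omega)

variable (κ : ∀ i, (E i × (J i → ℤ)) →+ G)

/-- The class in `G` of an element of the ambient monoid. -/
def cls : Amb G E J →+ G where
  toFun X := X.1.sum + ∑ i, κ i (X.2 i)
  map_zero' := by simp
  map_add' X Y := by
    simp only [Prod.fst_add, Multiset.sum_add, Prod.snd_add, Pi.add_apply, map_add,
      Finset.sum_add_distrib]
    abel

@[simp] theorem cls_gs (S : Multiset G) : cls κ (gs S : Amb G E J) = S.sum := by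
  simp [cls]

@[simp] theorem cls_sg (i : I) (x : E i × (J i → ℤ)) : cls κ (sg i x : Amb G E J) = κ i x := by
  simp only [cls, AddMonoidHom.coe_mk, ZeroHom.coe_mk, sg_fst, Multiset.sum_zero, zero_add]
  rw [Finset.sum_eq_single i]
  · simp
  · intro i' _ h; simp [sg_snd_of_ne h]
  · simp

/-- The block monoid inside the ambient monoid. -/
def Blk : AddSubmonoid (Amb G E J) where
  carrier := {X | Ok X ∧ cls κ X = 0}
  zero_mem' := ⟨ok_zero, by simp⟩
  add_mem' := fun hX hY => ⟨hX.1.add hY.1, by rw [map_add, hX.2, hY.2, add_zero]⟩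

variable {κ}

theorem blk_reduced : ∀ x ∈ Blk κ, ∀ y ∈ Blk κ, x + y = 0 → x = 0 :=
  fun _ hx _ hy h => hx.1.eq_zero_of_add hy.1 h

/-- A weight that is positive on nonzero elements of the block monoid. -/
noncomputable def weight : Amb G E J →+ ℤ where
  toFun X := (Multiset.card X.1 : ℤ) + ∑ i, (X.2 i).2 (Classical.arbitrary (J i))
  map_zero' := by simp
  map_add' X Y := by
    simp only [Prod.fst_add, Multiset.card_add, Prod.snd_add, Pi.add_apply, Nat.cast_add,
      Finset.sum_add_distrib]
    abel

theorem one_le_weight {X : Amb G E J} (hX : Ok X) (h : X ≠ 0) : 1 ≤ weight X := by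
  have hs : 0 ≤ ∑ i, (X.2 i).2 (Classical.arbitrary (J i)) :=
    Finset.sum_nonneg fun i _ => hX.nonneg i _
  by_contra hcon
  simp only [weight, AddMonoidHom.coe_mk, ZeroHom.coe_mk] at hcon
  apply h
  refine Prod.ext ?_ (funext fun i => ?_)
  · exact Multiset.card_eq_zero.1 (by omega)
  · have : (X.2 i).2 (Classical.arbitrary (J i)) ≤
        ∑ i, (X.2 i).2 (Classical.arbitrary (J i)) :=
      Finset.single_le_sum (f := fun i => (X.2 i).2 (Classical.arbitrary (J i)))
        (fun i _ => hX.nonneg i _) (Finset.mem_univ i)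
    exact hX.eq_zero (j := Classical.arbitrary (J i)) (by omega)

theorem blk_exists_lenIn {X : Amb G E J} (hX : X ∈ Blk κ) : ∃ m, LenIn (Blk κ) X m :=
  exists_lenIn weight (fun _ hx h => one_le_weight hx.1 h) hX

theorem blk_exists_lenIn_pos {X : Amb G E J} (hX : X ∈ Blk κ) (h0 : X ≠ 0) :
    ∃ m, LenIn (Blk κ) X (m + 1) := by
  obtain ⟨m, hm⟩ := blk_exists_lenIn hX
  cases m with
  | zero => exact absurd hm.eq_zero_of_zero h0
  | succ m => exact ⟨m, hm⟩

theorem exists_atom_dvd {X : Amb G E J} (hX : X ∈ Blk κ) (h0 : X ≠ 0) :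
    ∃ W Y, IsAtomIn (Blk κ) W ∧ X = W + Y ∧ Y ∈ Blk κ := by
  obtain ⟨m, hm⟩ := blk_exists_lenIn_pos hX h0
  obtain ⟨W, Y, h1, h2, h3⟩ := hm.exists_atom
  exact ⟨W, Y, h1, h2, h3.mem⟩

/-- Splitting off an atom with nonzero `i`-th component. -/
theorem LenIn.exists_atom_comp {X : Amb G E J} {m : ℕ} (h : LenIn (Blk κ) X m) {i : I}
    (hi : X.2 i ≠ 0) : ∃ W Y n, m = n + 1 ∧ IsAtomIn (Blk κ) W ∧ W.2 i ≠ 0 ∧ X = W + Y ∧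
      LenIn (Blk κ) Y n := by
  refine h.exists_atom_of (p := fun X => X.2 i ≠ 0) (by simp) ?_ hi
  intro x y hxy
  by_contra! hcon
  exact hxy (by simp [hcon.1, hcon.2])

/-- Splitting off an atom containing a given group element. -/
theorem LenIn.exists_atom_mem {X : Amb G E J} {m : ℕ} (h : LenIn (Blk κ) X m) {g : G}
    (hg : g ∈ X.1) : ∃ W Y n, m = n + 1 ∧ IsAtomIn (Blk κ) W ∧ g ∈ W.1 ∧ X = W + Y ∧
      LenIn (Blk κ) Y n :=
  h.exists_atom_of (p := fun X => g ∈ X.1) (by simp) (fun x y hxy => by simpa using hxy) hg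

theorem exists_eq_add_gs {X : Amb G E J} (hX : Ok X) {g : G} (hg : g ∈ X.1) :
    ∃ R : Amb G E J, Ok R ∧ X = R + gs {g} := by
  obtain ⟨S, hS⟩ := Multiset.exists_cons_of_mem hg
  refine ⟨(S, X.2), hX, Prod.ext ?_ (funext fun i => ?_)⟩
  · simp [hS, ← Multiset.singleton_add, add_comm]
  · simp

/-! ### Norm -/

/-- The norm on the ambient monoid. -/
noncomputable def norm (X : Amb G E J) : ℕ := X.1.card + 2 * ∑ i, minVal (X.2 i)

theorem norm_lt_of {X Y : Amb G E J} (i : I) (h : ∀ i', i' ≠ i → X.2 i' = Y.2 i')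
    (hlt : X.1.card + 2 * minVal (X.2 i) < Y.1.card + 2 * minVal (Y.2 i)) : norm X < norm Y := by
  unfold norm
  rw [← Finset.add_sum_erase _ _ (Finset.mem_univ i), ← Finset.add_sum_erase _ (fun i => minVal (Y.2 i)) (Finset.mem_univ i)]
  have : ∑ x ∈ Finset.univ.erase i, minVal (X.2 x) = ∑ x ∈ Finset.univ.erase i, minVal (Y.2 x) :=
    Finset.sum_congr rfl fun i' hi' => by rw [h i' (Finset.ne_of_mem_erase hi')]
  omega

theorem norm_lt_of_fst {X Y : Amb G E J} (h : X.2 = Y.2)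
    (hlt : X.1.card < Y.1.card) : norm X < norm Y := by
  unfold norm; rw [h]; omega

theorem norm_lt_add {W C : Amb G E J} (hW : Ok W) (hC : Ok C) (h0 : W ≠ 0) :
    norm C < norm (W + C) := by
  have hle : ∀ i, minVal (C.2 i) + minVal (W.2 i) ≤ minVal ((W + C).2 i) := by
    intro i
    apply le_minVal
    intro j
    have := minVal_le_val (hW.nonneg i) j
    have := minVal_le_val (hC.nonneg i) j
    simp only [Prod.snd_add, Pi.add_apply]; push_cast; omega
  have hsum := Finset.sum_le_sum fun i (_ : i ∈ Finset.univ) => hle i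
  rw [Finset.sum_add_distrib] at hsum
  unfold norm
  simp only [Prod.fst_add, Multiset.card_add]
  by_cases h1 : W.1 = 0
  · have h2 : ∃ i, W.2 i ≠ 0 := by
      by_contra! hcon
      exact h0 (Prod.ext h1 (funext hcon))
    obtain ⟨i, hi⟩ := h2
    have h3 : 1 ≤ minVal (W.2 i) := le_minVal fun j => by simpa using hW.valid hi j
    have h4 := Finset.single_le_sum (f := fun i => minVal (W.2 i)) (fun i _ => Nat.zero_le _)
      (Finset.mem_univ i)
    beta_reduce at h4
    omega
  · have := Multiset.card_pos.2 h1
    omega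

/-! ### Elements without divisors in the block monoid -/

variable (κ) in
/-- `R` has no nonzero divisor in the block monoid. -/
def ZeroSumFree (R : Amb G E J) : Prop := ∀ X Y : Amb G E J, X ∈ Blk κ → Ok Y → X + Y = R → X = 0

/-- A block dividing `R` leaves a cofactor in the atom that is again a block and contains `T ≠ 0`,
so the divisor is trivial. This is the source of all zero-sum free elements below. -/
theorem IsAtomIn.zeroSumFree {R T : Amb G E J} (h : IsAtomIn (Blk κ) (R + T)) (hT : Ok T)
    (hT0 : T ≠ 0) : ZeroSumFree κ R := by
  rintro X Y hX hY rfl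
  have hYT : Y + T ∈ Blk κ := by
    refine ⟨hY.add hT, ?_⟩
    have h1 := h.1.2
    rw [add_assoc, map_add, hX.2, zero_add] at h1
    exact h1
  rcases h.2.2 X hX _ hYT (by abel) with h | h
  · exact h
  · rw [add_comm] at h
    exact absurd (hT.eq_zero_of_add hY h) hT0

theorem sg_ne_zero {i : I} {x : E i × (J i → ℤ)} (hx : Valid x) : (sg i x : Amb G E J) ≠ 0 := by
  intro h
  have : (sg i x : Amb G E J).2 i = 0 := by rw [h]; rfl
  rw [sg_snd_self] at this
  exact hx.ne_zero this

theorem gs_singleton_ne_zero (g : G) : (gs {g} : Amb G E J) ≠ 0 := by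
  intro h
  simpa using congrArg Prod.fst h

theorem IsAtomIn.zeroSumFree_rest {W : Amb G E J} (h : IsAtomIn (Blk κ) W) {i : I}
    (hi : W.2 i ≠ 0) : ZeroSumFree κ (rest i W) := by
  rw [← rest_add_sg i W] at h
  exact h.zeroSumFree (ok_sg (by have := h.1.1; rw [rest_add_sg] at this; exact this.valid hi))
    (sg_ne_zero (by have := h.1.1; rw [rest_add_sg] at this; exact this.valid hi))

theorem ZeroSumFree.of_add {R T : Amb G E J} (h : ZeroSumFree κ (R + T)) (hT : Ok T) :
    ZeroSumFree κ R := by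
  rintro X Y hX hY rfl
  exact h X (Y + T) hX (hY.add hT) (by abel)

/-- Adding an irreducible component to a zero-sum free element yields an atom. -/
theorem ZeroSumFree.isAtomIn_sg {R : Amb G E J} (h : ZeroSumFree κ R) (hR : Ok R) {i : I}
    (hi : R.2 i = 0) {x : E i × (J i → ℤ)} (hx : Valid x) {j : J i} (hj : x.2 j ≤ 1)
    (hc : cls κ (R + sg i x) = 0) : IsAtomIn (Blk κ) (R + sg i x) := by
  refine ⟨⟨hR.add (ok_sg hx), hc⟩, ?_, ?_⟩
  · intro h0
    rw [add_comm] at h0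
    exact sg_ne_zero hx ((ok_sg hx).eq_zero_of_add hR h0)
  have key : ∀ X ∈ Blk κ, ∀ Y ∈ Blk κ, X + Y = R + sg i x → X.2 i = 0 → X = 0 := by
    intro X hX Y hY hXY hXi
    refine h X (rest i Y) hX (hY.1.rest i) ?_
    have hYi : Y.2 i = x := by
      have := congrFun (congrArg Prod.snd hXY) i
      simpa [hXi, hi] using this
    have e := rest_add_sg i Y
    rw [hYi] at e
    grind
  intro X hX Y hY hXY
  by_cases h1 : X.2 i = 0
  · exact Or.inl (key X hX Y hY hXY h1)
  by_cases h2 : Y.2 i = 0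
  · exact Or.inr (key Y hY X hX (by rw [add_comm]; exact hXY) h2)
  -- Two summands touching component `i` would make the valuation at `j` at least 2.
  · exfalso
    have e := congrFun (congrArg Prod.snd (congrFun (congrArg Prod.snd hXY) i)) j
    have a1 := hX.1.valid h1 j
    have a2 := hY.1.valid h2 j
    simp [hi] at e
    omega

/-- Adding a group element to a zero-sum free element yields an atom. -/
theorem ZeroSumFree.isAtomIn_gs {R : Amb G E J} (h : ZeroSumFree κ R) (hR : Ok R) {g : G}
    (hc : cls κ (R + gs {g}) = 0) : IsAtomIn (Blk κ) (R + gs {g}) := by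
  refine ⟨⟨hR.add (ok_gs _), hc⟩, ?_, ?_⟩
  · intro h0
    rw [add_comm] at h0
    exact gs_singleton_ne_zero g ((ok_gs _).eq_zero_of_add hR h0)
  have key : ∀ X ∈ Blk κ, ∀ Y ∈ Blk κ, X + Y = R + gs {g} → g ∈ Y.1 → X = 0 := by
    intro X hX Y hY hXY hg
    obtain ⟨Y', hY', rfl⟩ := exists_eq_add_gs hY.1 hg
    exact h X Y' hX hY' (by grind)
  intro X hX Y hY hXY
  have : g ∈ X.1 + Y.1 := by
    have := congrArg Prod.fst hXY
    simp at this
    rw [this]; simp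
  rcases Multiset.mem_add.1 this with h1 | h1
  · exact Or.inr (key Y hY X hX (by rw [add_comm]; exact hXY) h1)
  · exact Or.inl (key X hX Y hY hXY h1)

/-- Every summand of a zero-sum free element plus a component has a nonzero component. -/
theorem ZeroSumFree.comp_ne_zero {R : Amb G E J} (h : ZeroSumFree κ R) {i : I}
    {x : E i × (J i → ℤ)} {X Y : Amb G E J} (hX : X ∈ Blk κ) (hX0 : X ≠ 0) (hY : Ok Y)
    (hi : R.2 i = 0) (he : R + sg i x = X + Y) : X.2 i ≠ 0 := by
  intro hXi
  refine hX0 (h X (rest i Y) hX (hY.rest i) ?_)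
  have hYi : Y.2 i = x := by
    have := congrFun (congrArg Prod.snd he) i
    simpa [hXi, hi] using this.symm
  have e := rest_add_sg i Y
  rw [hYi] at e
  grind

/-- The number of atoms in a factorization of a zero-sum free element plus a component is bounded
by the valuations of the component. -/
theorem ZeroSumFree.lenIn_le {R : Amb G E J} (h : ZeroSumFree κ R) {i : I} (hi : R.2 i = 0)
    {x : E i × (J i → ℤ)} {m : ℕ} (hm : LenIn (Blk κ) (R + sg i x) m) (j : J i) :
    (m : ℤ) ≤ x.2 j := by
  have key : ∀ m : ℕ, ∀ X Y : Amb G E J, Ok Y → R + sg i x = X + Y → LenIn (Blk κ) X m →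
      (m : ℤ) ≤ (X.2 i).2 j := by
    intro m
    induction m with
    | zero =>
      intro X Y _ _ hX
      simpa using hX.mem.1.nonneg i j
    | succ m ih =>
      intro X Y hY he hX
      obtain ⟨W, X', hW, rfl, hX'⟩ := hX.exists_atom
      have h1 := ih X' (W + Y) (hW.1.1.add hY) (by rw [he]; abel) hX'
      have h2 := h.comp_ne_zero hW.1 hW.2.1 (hX'.mem.1.add hY) hi (by rw [he]; abel)
      have := hW.1.1.valid h2 j
      simp only [Prod.snd_add, Pi.add_apply]
      push_cast; omega
  simpa [hi] using key m _ 0 ok_zero (by simp) hm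

/-- Three summands of a factorization. -/
theorem ZeroSumFree.exists_three {R : Amb G E J} (h : ZeroSumFree κ R) {i : I} (hi : R.2 i = 0)
    {x : E i × (J i → ℤ)} {m : ℕ} (hm : LenIn (Blk κ) (R + sg i x) (m + 3)) :
    ∃ X₁ X₂ Z, R + sg i x = X₁ + X₂ + Z ∧ X₁ ∈ Blk κ ∧ X₂ ∈ Blk κ ∧ Z ∈ Blk κ ∧
      X₁.2 i ≠ 0 ∧ X₂.2 i ≠ 0 ∧ Z.2 i ≠ 0 := by
  obtain ⟨X₁, Y₁, hX₁, e₁, hY₁⟩ := hm.exists_atom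
  obtain ⟨X₂, Y₂, hX₂, rfl, hY₂⟩ := hY₁.exists_atom
  have hY0 : Y₂ ≠ 0 := by
    rintro rfl
    obtain ⟨X, Y, hX, hXY, hY⟩ := hY₂.exists_atom
    exact hX.2.1 (blk_reduced X hX.1 Y hY.mem hXY.symm)
  refine ⟨X₁, X₂, Y₂, by rw [e₁]; abel, hX₁.1, hX₂.1, hY₂.mem, ?_, ?_, ?_⟩
  · exact h.comp_ne_zero hX₁.1 hX₁.2.1 hY₁.mem.1 hi e₁
  · exact h.comp_ne_zero hX₂.1 hX₂.2.1 (hX₁.1.1.add hY₂.mem.1) hi (by rw [e₁]; abel)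
  · exact h.comp_ne_zero hY₂.mem hY0 (hX₁.1.1.add hX₂.1.1) hi (by rw [e₁]; abel)

theorem zeroSumFree_gs_zero : ZeroSumFree κ (0 : Amb G E J) :=
  fun _ _ hX hY h => hX.1.eq_zero_of_add hY h

theorem ok_eq_gs_of_add_eq {X Y : Amb G E J} {S : Multiset G} (hX : Ok X) (hY : Ok Y)
    (h : X + Y = gs S) : X = gs X.1 := by
  refine Prod.ext rfl (funext fun i => ?_)
  have e := congrFun (congrArg Prod.snd (congrFun (congrArg Prod.snd h) i)) (Classical.arbitrary _)
  simp at e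
  have := hX.nonneg i (Classical.arbitrary _)
  have := hY.nonneg i (Classical.arbitrary _)
  exact hX.eq_zero (j := Classical.arbitrary _) (by omega)

theorem zeroSumFree_gs {S : Multiset G} (h : ∀ T ≤ S, T.sum = 0 → T = 0) :
    ZeroSumFree κ (gs S : Amb G E J) := by
  intro X Y hX hY he
  have h1 := ok_eq_gs_of_add_eq hX.1 hY he
  have h2 : X.1 + Y.1 = S := congrArg Prod.fst he
  have h3 := hX.2
  rw [h1, cls_gs] at h3
  rw [h1, h X.1 (by rw [← h2]; exact Multiset.le_add_right _ _) h3, gs_zero]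

end Model

/-- `X` has two lengths at distance at least `d - 1` with no length strictly between them. -/
def HasGap {Z : Type*} [AddCancelCommMonoid Z] (B : AddSubmonoid Z) (d : ℕ) (X : Z) : Prop :=
  ∃ k, (∃ m, m ≤ k ∧ LenIn B X m) ∧ (∃ m, k + d ≤ m + 1 ∧ LenIn B X m) ∧
    ∀ m, LenIn B X m → m ≤ k ∨ k + d ≤ m + 1

/-! ### Minimal counterexamples and the reduction principle -/

section Critical

variable {G : Type*} [AddCommGroup G] {I : Type*} [Fintype I] [DecidableEq I]
  {E : I → Type*} [∀ i, AddCommGroup (E i)] {J : I → Type*} [∀ i, Fintype (J i)]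
  [∀ i, DecidableEq (J i)] [∀ i, Nonempty (J i)]
  {κ : ∀ i, (E i × (J i → ℤ)) →+ G}

/-- Prepares the long factorization of a reduced element. `V` collects one or two atoms, so turning
it into any nonzero block loses at most one atom, which is the loss `Critical.reduce` tolerates. In
the second alternative one can subtract 1 at every place of `V`. -/
theorem exists_cover {X : Amb G E J} {N : ℕ} (h : LenIn (Blk κ) X N) {i : I} (hi : X.2 i ≠ 0) :
    ∃ V Y n, X = V + Y ∧ V ∈ Blk κ ∧ V.2 i ≠ 0 ∧ LenIn (Blk κ) Y n ∧ N ≤ n + 2 ∧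
      (Y.2 i = 0 ∨ ∀ j, 2 ≤ (V.2 i).2 j) := by
  obtain ⟨V₁, Y₁, n, rfl, hV₁, hi₁, rfl, hY₁⟩ := h.exists_atom_comp hi
  by_cases hY : Y₁.2 i = 0
  · exact ⟨V₁, Y₁, n, rfl, hV₁.1, hi₁, hY₁, by omega, Or.inl hY⟩
  · obtain ⟨V₂, Y₂, n', rfl, hV₂, hi₂, rfl, hY₂⟩ := hY₁.exists_atom_comp hY
    have h2 : ∀ j, 2 ≤ ((V₁ + V₂).2 i).2 j := fun j => by
      have := hV₁.1.1.valid hi₁ j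
      have := hV₂.1.1.valid hi₂ j
      simp only [Prod.snd_add, Pi.add_apply]; omega
    refine ⟨V₁ + V₂, Y₂, n', by abel, (Blk κ).add_mem hV₁.1 hV₂.1, ?_, hY₂, by omega, Or.inr h2⟩
    intro h0
    have := h2 (Classical.arbitrary _)
    rw [h0] at this
    simp at this

theorem exists_lenIn_ge {V Y : Amb G E J} {n : ℕ} (hV : V ∈ Blk κ) (h0 : V ≠ 0)
    (hY : LenIn (Blk κ) Y n) : ∃ m, n + 1 ≤ m ∧ LenIn (Blk κ) (V + Y) m := by
  obtain ⟨m, hm⟩ := blk_exists_lenIn_pos hV h0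
  exact ⟨_, by omega, hm.add hY⟩

theorem comp_eq {X Y : Amb G E J} (h : X = Y) (i : I) : X.2 i = Y.2 i := by rw [h]

theorem val_eq {X Y : Amb G E J} (h : X = Y) (i : I) (j : J i) : (X.2 i).2 j = (Y.2 i).2 j := by
  rw [h]

theorem norm_lt_of_swap {A A' : Amb G E J} {i : I} {c c' : E i × (J i → ℤ)} {S T : Multiset G}
    (h : A' + sg i c + gs S = A + sg i c' + gs T)
    (hlt : A'.1.card + 2 * minVal (A'.2 i) < A.1.card + 2 * minVal (A.2 i)) :
    norm A' < norm A := by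
  refine norm_lt_of i (fun i' hi' => ?_) hlt
  have := comp_eq h i'
  simpa [sg_snd_of_ne hi'] using this

variable (κ) in
/-- `A` is a norm-minimal element with a gap of size `d` above the length `k`: no element of smaller
norm has a gap of size at least `d - 1`. -/
structure Critical (A : Amb G E J) (k d : ℕ) : Prop where
  two_le : 2 ≤ d
  low : LenIn (Blk κ) A k
  high : LenIn (Blk κ) A (k + d)
  gap : ∀ m, LenIn (Blk κ) A m → m ≤ k ∨ k + d ≤ m
  min : ∀ A' ∈ Blk κ, norm A' < norm A → ¬ HasGap (Blk κ) d A'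

variable (κ) in
/-- `W` occurs in a factorization of `A` of length at most `k`. -/
def IsLow (A : Amb G E J) (k : ℕ) (W : Amb G E J) : Prop :=
  ∃ C m, A = W + C ∧ LenIn (Blk κ) C m ∧ m + 1 ≤ k

variable {A : Amb G E J} {k d : ℕ}

namespace Critical

theorem mem (h : Critical κ A k d) : A ∈ Blk κ := h.low.mem

theorem no_gap (h : Critical κ A k d) {m : ℕ} (hm : LenIn (Blk κ) A m) (h1 : k < m)
    (h2 : m < k + d) : False := by
  rcases h.gap m hm with h | h <;> omega

/-- The reduction principle. -/
theorem reduce (h : Critical κ A k d) (A' : Amb G E J) (hn : norm A' < norm A)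
    (hlow : ∃ m, m ≤ k ∧ LenIn (Blk κ) A' m) (hhigh : ∃ m, k + d ≤ m + 1 ∧ LenIn (Blk κ) A' m)
    (hlift : ∀ m, k < m → m + 1 < k + d → LenIn (Blk κ) A' m →
      LenIn (Blk κ) A m ∨ LenIn (Blk κ) A (m + 1)) : False := by
  have hA' : A' ∈ Blk κ := by obtain ⟨m, -, hm⟩ := hlow; exact hm.mem
  refine h.min A' hA' hn ⟨k, hlow, hhigh, fun m hm => ?_⟩
  by_contra hcon
  rcases hlift m (by omega) (by omega) hm with h' | h'
  · exact h.no_gap h' (by omega) (by omega)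
  · exact h.no_gap h' (by omega) (by omega)

/-- Otherwise the cofactor `C`, which has smaller norm, would have the gap of `A` shifted down by
one. So all factorizations of `A` through a low atom are short. -/
theorem len_le (h : Critical κ A k d) {W C : Amb G E J} (hW : IsAtomIn (Blk κ) W)
    (hl : IsLow κ A k W) (hA : A = W + C) {m : ℕ} (hm : LenIn (Blk κ) C m) : m + 1 ≤ k := by
  obtain ⟨C', m', hA', hC', hm'⟩ := hl
  obtain rfl : C = C' := add_left_cancel (hA.symm.trans hA')
  by_contra hcon
  have hgap : ∀ m, LenIn (Blk κ) C m → m + 1 ≤ k ∨ k + d ≤ m + 1 := fun m hm => by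
    have := hW.lenIn.add hm
    rw [← hA, add_comm] at this
    exact h.gap _ this
  refine h.min C hm.mem ?_ ⟨k - 1, ⟨m', by omega, hC'⟩, ⟨m, ?_, hm⟩, fun m hm => ?_⟩
  · rw [hA]; exact norm_lt_add hW.1.1 hm.mem.1 hW.2.1
  · have := hgap m hm; omega
  · have := hgap m hm; omega

/-- Being low spreads: a factorization through both atoms is short because it contains `W`. -/
theorem isLow_of (h : Critical κ A k d) {W W' C : Amb G E J} (hW : IsAtomIn (Blk κ) W)
    (hl : IsLow κ A k W) (hW' : IsAtomIn (Blk κ) W') (hC : C ∈ Blk κ) (hA : A = W + W' + C) :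
    IsLow κ A k W' := by
  obtain ⟨m, hm⟩ := blk_exists_lenIn hC
  have := h.len_le hW hl (C := W' + C) (by rw [hA]; abel) (LenIn.atom_add hW' hm)
  exact ⟨W + C, m + 1, by rw [hA]; abel, LenIn.atom_add hW hm, this⟩

/-- The sequence consisting of `0` is a prime atom, so it would occur in both the short and the long
factorization, against `len_le`. -/
theorem zero_notMem (h : Critical κ A k d) : (0 : G) ∉ A.1 := by
  intro h0
  have hat : ∀ W : Amb G E J, IsAtomIn (Blk κ) W → (0 : G) ∈ W.1 → W = gs {0} := by
    intro W hW h0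
    obtain ⟨R, hR, rfl⟩ := exists_eq_add_gs hW.1.1 h0
    have h1 : (gs {0} : Amb G E J) ∈ Blk κ := ⟨ok_gs _, by simp⟩
    have h2 : R ∈ Blk κ := ⟨hR, by have := hW.1.2; simpa using this⟩
    rcases hW.2.2 R h2 _ h1 rfl with h | h
    · rw [h, zero_add]
    · exact absurd h (gs_singleton_ne_zero 0)
  obtain ⟨W, C, n, hn, hW, h1, hA, hC⟩ := h.low.exists_atom_mem h0
  obtain ⟨W', C', n', hn', hW', h1', hA', hC'⟩ := h.high.exists_atom_mem h0
  have e := hat W hW h1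
  have e' := hat W' hW' h1'
  rw [e'] at hA'; rw [e] at hA
  have := h.len_le (e ▸ hW) ⟨C, n, hA, hC, by omega⟩ hA' hC'
  have := h.two_le
  omega

/-- Two group elements of a low atom can be replaced by their sum, which lowers the norm by one. -/
theorem card_le_one (h : Critical κ A k d) {W : Amb G E J} (hW : IsAtomIn (Blk κ) W)
    (hl : IsLow κ A k W) : W.1.card ≤ 1 := by
  by_contra hcon
  obtain ⟨g₁, S, hS⟩ : ∃ g S, W.1 = g ::ₘ S := by
    obtain ⟨g, hg⟩ := Multiset.card_pos_iff_exists_mem.1 (by omega : 0 < W.1.card)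
    exact ⟨g, _, (Multiset.exists_cons_of_mem hg).choose_spec⟩
  obtain ⟨R₁, hR₁, hWR⟩ := exists_eq_add_gs hW.1.1 (g := g₁) (by simp [hS])
  have hc1 : R₁.1.card + 1 = W.1.card := by rw [hWR]; simp
  obtain ⟨g₂, hg₂⟩ := Multiset.card_pos_iff_exists_mem.1 (by omega : 0 < R₁.1.card)
  obtain ⟨R, hR, rfl⟩ := exists_eq_add_gs hR₁ hg₂
  clear hS
  obtain ⟨C, m, hA, hC, hm⟩ := hl
  have hfree : ZeroSumFree κ R := by
    have : IsAtomIn (Blk κ) (R + gs {g₂, g₁}) := by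
      rw [show ({g₂, g₁} : Multiset G) = {g₂} + {g₁} from rfl, gs_add, ← add_assoc, ← hWR]
      exact hW
    refine this.zeroSumFree (ok_gs _) ?_
    intro h; simpa using congrArg Prod.fst h
  have hcl : cls κ (R + gs {g₁ + g₂}) = 0 := by
    have := hW.1.2
    rw [hWR] at this
    simp only [map_add, cls_gs, Multiset.sum_singleton] at this ⊢
    rw [← this]; abel
  have hat := hfree.isAtomIn_gs hR hcl
  have hA2 : A = R + gs {g₁} + gs {g₂} + C := by rw [hA, hWR]; abel
  refine h.reduce (R + gs {g₁ + g₂} + C) ?_ ⟨m + 1, hm, LenIn.atom_add hat hC⟩ ?_ ?_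
  · apply norm_lt_of_fst
    · rw [hA2]; funext i; simp
    · rw [hA2]; simp
  · obtain ⟨V₁, Y₁, n, hn, hV₁, hg, hAV, hY₁⟩ := h.high.exists_atom_mem (g := g₁)
      (by rw [hA2]; simp)
    obtain ⟨V₁', hV₁', rfl⟩ := exists_eq_add_gs hV₁.1.1 hg
    -- Merging the atoms that contain `g₁` and `g₂` costs at most one atom.
    have key : ∃ V Y n', Ok V ∧ cls κ V + g₁ + g₂ = 0 ∧ A = V + gs {g₁} + gs {g₂} + Y ∧
        LenIn (Blk κ) Y n' ∧ k + d ≤ n' + 2 := by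
      by_cases hgV : g₂ ∈ V₁'.1
      · obtain ⟨V, hV, rfl⟩ := exists_eq_add_gs hV₁' hgV
        refine ⟨V, Y₁, n, hV, ?_, ?_, hY₁, by omega⟩
        · have := hV₁.1.2
          simp only [map_add, cls_gs, Multiset.sum_singleton] at this
          rw [← this]; abel
        · rw [hAV]; abel
      · have hgY : g₂ ∈ Y₁.1 := by
          have := congrArg Prod.fst (hAV.symm.trans hA2)
          simp only [Prod.fst_add, gs_fst] at this
          have h3 : V₁'.1 + Y₁.1 = R.1 + {g₂} + C.1 := by
            apply add_right_cancel (b := ({g₁} : Multiset G)); rw [add_right_comm, this]; abel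
          have h4 : g₂ ∈ V₁'.1 + Y₁.1 := by rw [h3]; simp
          exact (Multiset.mem_add.1 h4).resolve_left hgV
        obtain ⟨V₂, Y₂, n', hn', hV₂, hg', rfl, hY₂⟩ := hY₁.exists_atom_mem hgY
        obtain ⟨V₂', hV₂', rfl⟩ := exists_eq_add_gs hV₂.1.1 hg'
        refine ⟨V₁' + V₂', Y₂, n', hV₁'.add hV₂', ?_, ?_, hY₂, by omega⟩
        · have e1 := hV₁.1.2
          have e2 := hV₂.1.2
          simp only [map_add, cls_gs, Multiset.sum_singleton] at e1 e2 ⊢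
          have : cls κ V₁' + cls κ V₂' + g₁ + g₂ = (cls κ V₁' + g₁) + (cls κ V₂' + g₂) := by abel
          rw [this, e1, e2, add_zero]
        · rw [hAV]; abel
    obtain ⟨V, Y, n', hV, hVc, hAV', hY, hn'⟩ := key
    have hV' : V + gs {g₁ + g₂} ∈ Blk κ := by
      refine ⟨hV.add (ok_gs _), ?_⟩
      simp only [map_add, cls_gs, Multiset.sum_singleton]
      rw [← hVc]; abel
    have hne : V + gs {g₁ + g₂} ≠ 0 := by
      intro h; simpa using congrArg Prod.fst h
    obtain ⟨m', hm', hl'⟩ := exists_lenIn_ge hV' hne hY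
    refine ⟨m', by omega, ?_⟩
    have : R + gs {g₁ + g₂} + C = V + gs {g₁ + g₂} + Y := by
      rw [hAV'] at hA2; grind
    rw [this]; exact hl'
  · intro m hm1 hm2 hlen
    obtain ⟨W₁, Y, n, rfl, hW₁, hg, hAW, hY⟩ := hlen.exists_atom_mem (g := g₁ + g₂) (by simp)
    obtain ⟨R', hR', rfl⟩ := exists_eq_add_gs hW₁.1.1 hg
    have hfree' := hW₁.zeroSumFree (ok_gs _) (gs_singleton_ne_zero _)
    have hA3 : A = R' + gs {g₁} + gs {g₂} + Y := by grind
    have hT : R' + gs {g₁} + gs {g₂} ∈ Blk κ := by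
      refine ⟨(hR'.add (ok_gs _)).add (ok_gs _), ?_⟩
      have := hW₁.1.2
      simp only [map_add, cls_gs, Multiset.sum_singleton] at this ⊢
      rw [← this]; abel
    obtain ⟨t, ht⟩ := blk_exists_lenIn_pos hT (by
      intro h; simpa using congrArg Prod.fst h)
    -- `R'` is zero-sum free, so each factor contains one of the two occurrences `g₁`, `g₂`.
    have ht2 : t + 1 ≤ 2 := by
      obtain ⟨X₁, Z₁, s, hs, hX₁, hgX, hTX, hZ₁⟩ := ht.exists_atom_mem (g := g₁) (by simp)
      obtain ⟨X₁', hX₁', rfl⟩ := exists_eq_add_gs hX₁.1.1 hgX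
      by_cases hgX2 : g₂ ∈ X₁'.1
      · obtain ⟨X, hX, rfl⟩ := exists_eq_add_gs hX₁' hgX2
        have : Z₁ = 0 := hfree' Z₁ X hZ₁.mem hX (by grind)
        subst this
        rcases Nat.eq_zero_or_pos s with h0 | h0
        · omega
        · obtain ⟨s, rfl⟩ : ∃ s', s = s' + 1 := ⟨s - 1, by omega⟩
          obtain ⟨P, P', hP, hPP, hP'⟩ := hZ₁.exists_atom
          exact absurd (blk_reduced P hP.1 P' hP'.mem hPP.symm) hP.2.1
      · have hgZ : g₂ ∈ Z₁.1 := by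
          have := congrArg Prod.fst hTX
          simp only [Prod.fst_add, gs_fst] at this
          have h3 : X₁'.1 + Z₁.1 = R'.1 + {g₂} := by
            apply add_right_cancel (b := ({g₁} : Multiset G)); rw [add_right_comm, ← this]; abel
          have h4 : g₂ ∈ X₁'.1 + Z₁.1 := by rw [h3]; simp
          exact (Multiset.mem_add.1 h4).resolve_left hgX2
        obtain ⟨X₂, Z₂, s', hs', hX₂, hgX', rfl, hZ₂⟩ := hZ₁.exists_atom_mem hgZ
        obtain ⟨X₂', hX₂', rfl⟩ := exists_eq_add_gs hX₂.1.1 hgX'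
        have : Z₂ = 0 := hfree' Z₂ (X₁' + X₂') hZ₂.mem (hX₁'.add hX₂') (by grind)
        subst this
        rcases Nat.eq_zero_or_pos s' with h0 | h0
        · omega
        · obtain ⟨s', rfl⟩ : ∃ s'', s' = s'' + 1 := ⟨s' - 1, by omega⟩
          obtain ⟨P, P', hP, hPP, hP'⟩ := hZ₂.exists_atom
          exact absurd (blk_reduced P hP.1 P' hP'.mem hPP.symm) hP.2.1
    have hlenA := ht.add hY
    rw [← hA3] at hlenA
    rcases Nat.eq_zero_or_pos t with h0 | h0
    · left; rw [h0] at hlenA; rwa [show n + 1 = 0 + 1 + n by omega]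
    · right; rwa [show n + 1 + 1 = t + 1 + n by omega]

end Critical
end Critical

/-! ### Replacing a component by its class; valuations in low atoms -/

section Replace

variable {G : Type*} [AddCommGroup G] {I : Type*} [Fintype I] [DecidableEq I]
  {E : I → Type*} [∀ i, AddCommGroup (E i)] {J : I → Type*} [∀ i, Fintype (J i)]
  [∀ i, DecidableEq (J i)] [∀ i, Nonempty (J i)]
  {κ : ∀ i, (E i × (J i → ℤ)) →+ G}

theorem LenIn.eq_zero_of_eq_zero {X : Amb G E J} {m : ℕ} (h : LenIn (Blk κ) X m) (h0 : X = 0) :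
    m = 0 := by
  cases m with
  | zero => rfl
  | succ m =>
    obtain ⟨P, P', hP, hPP, hP'⟩ := h.exists_atom
    exact absurd (blk_reduced P hP.1 P' hP'.mem (hPP.symm.trans h0)) hP.2.1

theorem minVal_zero {E J : Type*} [AddCommGroup E] [Fintype J] [Nonempty J] :
    minVal (0 : E × (J → ℤ)) = 0 :=
  Nat.le_zero.1 (minVal_le (j := Classical.arbitrary J) (by simp))

theorem cls_rest (i : I) (X : Amb G E J) : cls κ (rest i X) + κ i (X.2 i) = cls κ X := by
  conv_rhs => rw [← rest_add_sg i X, map_add, cls_sg]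

theorem cls_rest_of_mem {X : Amb G E J} (hX : X ∈ Blk κ) (i : I) :
    cls κ (rest i X) = - κ i (X.2 i) := by
  have := cls_rest (κ := κ) i X
  rw [hX.2] at this
  exact eq_neg_of_add_eq_zero_left this

/-- Replacing a component of an atom by its class yields an atom. -/
theorem IsAtomIn.replace {W : Amb G E J} (hW : IsAtomIn (Blk κ) W) {i : I} (hi : W.2 i ≠ 0) :
    IsAtomIn (Blk κ) (rest i W + gs {κ i (W.2 i)}) :=
  (hW.zeroSumFree_rest hi).isAtomIn_gs (hW.1.1.rest i) (by
    rw [map_add, cls_gs, Multiset.sum_singleton, cls_rest, hW.1.2])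

theorem rest_comp_of_add {X R Y : Amb G E J} {i : I} (h : rest i X = R + Y) (hR : Ok R)
    (hY : Ok Y) : R.2 i = 0 := by
  have e := val_eq h i (Classical.arbitrary _)
  simp only [rest_snd_self, Prod.snd_add, Pi.add_apply, Prod.snd_zero, Pi.zero_apply] at e
  have := hR.nonneg i (Classical.arbitrary _)
  have := hY.nonneg i (Classical.arbitrary _)
  exact hR.eq_zero (j := Classical.arbitrary _) (by omega)

theorem exists_lenIn_replace {A V Y : Amb G E J} {n : ℕ} {i : I} {T : Multiset G}
    (hT : T.sum = κ i (A.2 i)) (hT0 : T ≠ 0) (hA : A = V + Y) (hV : V ∈ Blk κ) (hYi : Y.2 i = 0)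
    (hY : LenIn (Blk κ) Y n) : ∃ m, n + 1 ≤ m ∧ LenIn (Blk κ) (rest i A + gs T) m := by
  have hVA : V.2 i = A.2 i := by rw [hA]; simp [hYi]
  have hV' : rest i V + gs T ∈ Blk κ := by
    refine ⟨(hV.1.rest i).add (ok_gs T), ?_⟩
    rw [map_add, cls_gs, hT, ← hVA, cls_rest, hV.2]
  have hne : rest i V + gs T ≠ 0 := by
    intro h
    have := congrArg Prod.fst h
    simp [hT0] at this
  obtain ⟨m, hm, hl⟩ := exists_lenIn_ge hV' hne hY
  refine ⟨m, hm, ?_⟩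
  have : rest i A + gs T = rest i V + gs T + Y := by
    rw [hA, rest_add, rest_eq_self hYi]; abel
  rwa [this]

/-- Lifting a factorization along the replacement of a component by its class. -/
theorem exists_of_lenIn_replace_one {A : Amb G E J} (hA : A ∈ Blk κ) {i : I} {m : ℕ}
    (h : LenIn (Blk κ) (rest i A + gs {κ i (A.2 i)}) m) (hi : A.2 i ≠ 0) :
    ∃ R Y n, ZeroSumFree κ R ∧ Ok R ∧ R.2 i = 0 ∧ A = R + sg i (A.2 i) + Y ∧
      LenIn (Blk κ) Y n ∧ m = n + 1 ∧ R + sg i (A.2 i) ∈ Blk κ := by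
  obtain ⟨W, Y, n, rfl, hW, hg, hAW, hY⟩ := h.exists_atom_mem (g := κ i (A.2 i)) (by simp)
  obtain ⟨R, hR, rfl⟩ := exists_eq_add_gs hW.1.1 hg
  have e : rest i A = R + Y := by grind
  refine ⟨R, Y, n, hW.zeroSumFree (ok_gs _) (gs_singleton_ne_zero _), hR,
    rest_comp_of_add e hR hY.mem.1, ?_, hY, rfl, hR.add (ok_sg (hA.1.valid hi)), ?_⟩
  · conv_lhs => rw [← rest_add_sg i A, e]
    abel
  · have := hW.1.2
    simpa using this

/-- Lifting a factorization along the replacement of a component by the classes of two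
irreducible parts. -/
theorem exists_of_lenIn_replace_two {A : Amb G E J} {i : I} {m : ℕ}
    {u₁ u₂ : E i × (J i → ℤ)} (hu₁ : Valid u₁) (hu₂ : Valid u₂) {j₁ j₂ : J i}
    (hj₁ : u₁.2 j₁ ≤ 1) (hj₂ : u₂.2 j₂ ≤ 1) (hu : A.2 i = u₁ + u₂)
    (h : LenIn (Blk κ) (rest i A + gs {κ i u₁, κ i u₂}) m) :
    LenIn (Blk κ) A m ∨
    ∃ R Y n, ZeroSumFree κ R ∧ Ok R ∧ R.2 i = 0 ∧ A = R + sg i (A.2 i) + Y ∧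
      LenIn (Blk κ) Y n ∧ m = n + 1 ∧ R + sg i (A.2 i) ∈ Blk κ := by
  have hgs : (gs {κ i u₁, κ i u₂} : Amb G E J) = gs {κ i u₁} + gs {κ i u₂} := by
    rw [← gs_add]; rfl
  rw [hgs] at h
  have hAr := rest_add_sg i A
  obtain ⟨W, Y, n, rfl, hW, hg, hAW, hY⟩ := h.exists_atom_mem (g := κ i u₁) (by simp)
  obtain ⟨R₁, hR₁, rfl⟩ := exists_eq_add_gs hW.1.1 hg
  have hfree := hW.zeroSumFree (ok_gs _) (gs_singleton_ne_zero _)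
  by_cases hg2 : κ i u₂ ∈ R₁.1
  · obtain ⟨R, hR, rfl⟩ := exists_eq_add_gs hR₁ hg2
    have e : rest i A = R + Y := by grind
    right
    refine ⟨R, Y, n, hfree.of_add (ok_gs _), hR, rest_comp_of_add e hR hY.mem.1, ?_, hY, rfl,
      hR.add (ok_sg ?_), ?_⟩
    · conv_lhs => rw [← rest_add_sg i A, e]
      abel
    · rw [hu]; exact hu₁.add hu₂
    · have := hW.1.2
      simp only [map_add, cls_gs, Multiset.sum_singleton, cls_sg, hu] at this ⊢
      rw [← this]; abel
  -- The two classes lie in different atoms, and each part `u₁`, `u₂` has a valuation at most 1, so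
  -- putting the parts back gives two atoms.
  · left
    have hgY : κ i u₂ ∈ Y.1 := by
      have h1 : (rest i A).1 + {κ i u₂} = R₁.1 + Y.1 := by
        have : rest i A + gs {κ i u₂} = R₁ + Y := by grind
        exact congrArg Prod.fst this
      have h2 : κ i u₂ ∈ R₁.1 + Y.1 := by rw [← h1]; simp
      exact (Multiset.mem_add.1 h2).resolve_left hg2
    obtain ⟨W₂, Y₂, n', rfl, hW₂, hg', rfl, hY₂⟩ := hY.exists_atom_mem hgY
    obtain ⟨R₂, hR₂, rfl⟩ := exists_eq_add_gs hW₂.1.1 hg'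
    have hfree₂ := hW₂.zeroSumFree (ok_gs _) (gs_singleton_ne_zero _)
    have e : rest i A = R₁ + R₂ + Y₂ := by grind
    have z₁ := rest_comp_of_add (R := R₁) (Y := R₂ + Y₂) (by rw [e]; abel) hR₁
      (hR₂.add hY₂.mem.1)
    have z₂ := rest_comp_of_add (R := R₂) (Y := R₁ + Y₂) (by rw [e]; abel) hR₂
      (hR₁.add hY₂.mem.1)
    have a₁ := hfree.isAtomIn_sg hR₁ z₁ hu₁ hj₁ (by simpa using hW.1.2)
    have a₂ := hfree₂.isAtomIn_sg hR₂ z₂ hu₂ hj₂ (by simpa using hW₂.1.2)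
    have := a₁.lenIn.add (a₂.lenIn.add hY₂)
    rw [hu, sg_add, e] at hAr
    have e2 : A = R₁ + sg i u₁ + (R₂ + sg i u₂ + Y₂) := by rw [← hAr]; abel
    rw [e2]
    rwa [show n' + 1 + 1 = 1 + (1 + n') by omega]

/-- Enlarging a zero-sum free element by a component with valuations at most `1`. -/
theorem ZeroSumFree.len_le_two {R : Amb G E J} (hR : ZeroSumFree κ R) (hRO : Ok R) {i : I}
    {c : E i × (J i → ℤ)} (hc : ∀ j, c.2 j ≤ 1) {t : ℕ}
    (ht : LenIn (Blk κ) (R + sg i c) t) : t ≤ 2 := by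
  by_contra hcon
  obtain ⟨t, rfl⟩ : ∃ t', t = t' + 3 := ⟨t - 3, by omega⟩
  have e : R + sg i c = rest i R + sg i (R.2 i + c) := by
    conv_lhs => rw [← rest_add_sg i R]
    rw [sg_add]; abel
  rw [e] at ht
  have hfr : ZeroSumFree κ (rest i R) := by
    by_cases hRi : R.2 i = 0
    · rwa [rest_eq_self hRi]
    · rw [← rest_add_sg i R] at hR
      exact hR.of_add (ok_sg (hRO.valid hRi))
  obtain ⟨X₁, X₂, Z, hXZ, hX₁, hX₂, hZ, i₁, i₂, i₃⟩ := hfr.exists_three (by simp) ht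
  -- With three factors, `c` can be taken out of two of them, so the third divides `R`.
  have hval : Valid ((X₁ + X₂).2 i - c) := fun j => by
    have := hX₁.1.valid i₁ j; have := hX₂.1.valid i₂ j; have := hc j
    simp only [Prod.snd_sub, Prod.snd_add, Pi.sub_apply, Pi.add_apply]; omega
  have e2 := rest_add_sg i (X₁ + X₂)
  rw [← sg_sub_add i _ c] at e2
  have := hR Z (rest i (X₁ + X₂) + sg i ((X₁ + X₂).2 i - c)) hZ
    (((hX₁.1.add hX₂.1).rest i).add (ok_sg hval)) (by rw [← e] at hXZ; grind)
  exact i₃ (by rw [this]; rfl)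

namespace Critical

variable {A : Amb G E J} {k d : ℕ}

/-- The usual form of the lifting condition in `reduce`: an atom of the reduced element becomes the
block `R` of `A`, and `R` has at most two factors. -/
theorem lift_of_le_two {R Y : Amb G E J} {n : ℕ} (hT : R ∈ Blk κ) (hT0 : R ≠ 0)
    (hY : LenIn (Blk κ) Y n) (hle : ∀ m, LenIn (Blk κ) R m → m ≤ 2) (hA : A = R + Y) :
    LenIn (Blk κ) A (n + 1) ∨ LenIn (Blk κ) A (n + 1 + 1) := by
  obtain ⟨t, ht⟩ := blk_exists_lenIn_pos hT hT0
  have := hle _ ht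
  have hl := ht.add hY
  rw [← hA] at hl
  rcases Nat.eq_zero_or_pos t with h0 | h0
  · left; rwa [show n + 1 = t + 1 + n by omega]
  · right; rwa [show n + 1 + 1 = t + 1 + n by omega]

/-- With a valuation at most 2, no factorization has more than two atoms touching component `i`.
Replacing the component by its class, or by the classes of its two parts in a short factorization,
is then a reduction. -/
theorem three_le (h : Critical κ A k d) {i : I} (hi : A.2 i ≠ 0) (j : J i) :
    3 ≤ (A.2 i).2 j := by
  by_contra hcon
  have ha := h.mem.1.valid hi
  have hhigh : ∃ V Y n, A = V + Y ∧ V ∈ Blk κ ∧ LenIn (Blk κ) Y n ∧ k + d ≤ n + 2 ∧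
      Y.2 i = 0 := by
    obtain ⟨V, Y, n, hAV, hV, hVi, hY, hn, hor⟩ := exists_cover h.high hi
    refine ⟨V, Y, n, hAV, hV, hY, hn, ?_⟩
    rcases hor with h0 | h2
    · exact h0
    · apply hY.mem.1.eq_zero (j := j)
      have := h2 j
      have e := val_eq hAV i j
      simp only [Prod.snd_add, Pi.add_apply] at e
      omega
  have hlift2 : ∀ m R Y n, ZeroSumFree κ R → R.2 i = 0 → A = R + sg i (A.2 i) + Y →
      LenIn (Blk κ) Y n → m = n + 1 → R + sg i (A.2 i) ∈ Blk κ →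
      LenIn (Blk κ) A m ∨ LenIn (Blk κ) A (m + 1) := by
    rintro m R Y n hR hRi hAR hY rfl hmem
    refine lift_of_le_two hmem ?_ hY ?_ hAR
    · intro h0
      have := comp_eq h0 i
      simp [hRi] at this
      exact hi this
    · intro t ht
      have := hR.lenIn_le hRi ht j
      omega
  obtain ⟨V, Y, n, hAV, hV, hY, hn, hYi⟩ := hhigh
  obtain ⟨U₁, C₁, m₁, hm₁, hU₁, hi₁, hA₁, hC₁⟩ := h.low.exists_atom_comp hi
  -- Using two classes when two low atoms share the component keeps the short factorization; all
  -- valuations are then at least 2, so the norm drops by at least 4 - 2.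
  by_cases hC : C₁.2 i = 0
  · have hUA : U₁.2 i = A.2 i := by rw [hA₁]; simp [hC]
    have hmin : 1 ≤ minVal (A.2 i) := le_minVal fun j => by simpa using ha j
    refine h.reduce (rest i A + gs {κ i (A.2 i)}) ?_ ⟨m₁ + 1, by omega, ?_⟩ ?_ ?_
    · refine norm_lt_of i (fun i' hi' => by simp [rest_snd_of_ne hi']) ?_
      simp [minVal_zero]; omega
    · have := LenIn.atom_add (hU₁.replace hi₁) hC₁
      rw [hUA] at this
      convert this using 1
      conv_lhs => rw [hA₁, rest_add, rest_eq_self hC, ← hA₁]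
      abel
    · obtain ⟨m, hm, hl⟩ := exists_lenIn_replace (T := {κ i (A.2 i)}) (by simp) (by simp) hAV hV
        hYi hY
      exact ⟨m, by omega, hl⟩
    · intro m _ _ hm
      obtain ⟨R, Y, n, hR, -, hRi, hAR, hY, hmn, hmem⟩ :=
        exists_of_lenIn_replace_one h.mem hm hi
      exact hlift2 m R Y n hR hRi hAR hY hmn hmem
  · obtain ⟨U₂, C₂, m₂, hm₂, hU₂, hi₂, rfl, hC₂⟩ := hC₁.exists_atom_comp hC
    have v₁ := hU₁.1.1.valid hi₁
    have v₂ := hU₂.1.1.valid hi₂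
    have e := val_eq hA₁ i j
    simp only [Prod.snd_add, Pi.add_apply] at e
    have := v₁ j
    have := v₂ j
    have hC2 : C₂.2 i = 0 := hC₂.mem.1.eq_zero (j := j) (by omega)
    have hu : A.2 i = U₁.2 i + U₂.2 i := by rw [hA₁]; simp [hC2]
    have hmin : 2 ≤ minVal (A.2 i) := le_minVal fun j => by
      have := v₁ j; have := v₂ j
      rw [hu]; simp only [Prod.snd_add, Pi.add_apply]; push_cast; omega
    have hgs : (gs {κ i (U₁.2 i), κ i (U₂.2 i)} : Amb G E J) =
        gs {κ i (U₁.2 i)} + gs {κ i (U₂.2 i)} := by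
      rw [← gs_add]; rfl
    have hc0 := hC₂.mem.1.nonneg i j
    refine h.reduce (rest i A + gs {κ i (U₁.2 i), κ i (U₂.2 i)}) ?_ ⟨m₂ + 1 + 1, by omega, ?_⟩
      ?_ ?_
    · refine norm_lt_of i (fun i' hi' => by simp [rest_snd_of_ne hi']) ?_
      simp [minVal_zero]; omega
    · have := LenIn.atom_add (hU₁.replace hi₁) (LenIn.atom_add (hU₂.replace hi₂) hC₂)
      convert this using 1
      rw [hA₁, rest_add, rest_add, rest_eq_self hC2, hgs]
      abel
    · obtain ⟨m, hm, hl⟩ := exists_lenIn_replace (T := {κ i (U₁.2 i), κ i (U₂.2 i)})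
        (by rw [hu]; simp) (by simp) hAV hV hYi hY
      exact ⟨m, by omega, hl⟩
    · intro m _ _ hm
      rcases exists_of_lenIn_replace_two v₁ v₂ (j₁ := j) (j₂ := j) (by omega) (by omega)
        hu hm with h1 | ⟨R, Y, n, hR, -, hRi, hAR, hY, hmn, hmem⟩
      · exact Or.inl h1
      · exact hlift2 m R Y n hR hRi hAR hY hmn hmem

/-- Reduction by a component `c` all of whose valuations are `1`. -/
theorem false_of_sub_one (h : Critical κ A k d) {W : Amb G E J} (hW : IsAtomIn (Blk κ) W)
    (hl : IsLow κ A k W) {i : I} {c : E i × (J i → ℤ)} (hc : ∀ j, c.2 j = 1) {R : Amb G E J}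
    (hR : Ok R) (hWR : W = R + sg i c) : False := by
  have hcv : Valid c := fun j => (hc j).ge
  have hWi : W.2 i = R.2 i + c := by rw [hWR]; simp
  have hi' : ∀ j, 1 ≤ (W.2 i).2 j := fun j => by
    rw [hWi]; have := hR.nonneg i j; have := hc j
    simp only [Prod.snd_add, Pi.add_apply]; omega
  obtain ⟨C, m₀, hA, hC, hm₀⟩ := hl
  have hi : A.2 i ≠ 0 := by
    intro h0
    have e := val_eq hA i (Classical.arbitrary _)
    have := hi' (Classical.arbitrary _)
    have := hC.mem.1.nonneg i (Classical.arbitrary _)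
    rw [h0] at e
    simp only [Prod.snd_add, Pi.add_apply, Prod.snd_zero, Pi.zero_apply] at e
    omega
  have h3 := h.three_le hi
  have hfree : ZeroSumFree κ R := by
    rw [hWR] at hW; exact hW.zeroSumFree (ok_sg hcv) (sg_ne_zero hcv)
  have hswap : ∀ A' : Amb G E J, A' + sg i c = A + gs {κ i c} → A'.2 i = A.2 i - c ∧
      A'.1 = A.1 + {κ i c} := by
    intro A' e
    have e1 := comp_eq e i
    have e2 := congrArg Prod.fst e
    simp at e1 e2
    exact ⟨by rw [← e1]; abel, e2⟩
  have hA'e : (R + gs {κ i c} + C) + sg i c = A + gs {κ i c} := by rw [hA, hWR]; abel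
  have hclR : cls κ R + κ i c = 0 := by
    have := hW.1.2; rw [hWR] at this; simpa using this
  refine h.reduce (R + gs {κ i c} + C) ?_ ⟨m₀ + 1, hm₀, ?_⟩ ?_ ?_
  · obtain ⟨e1, e2⟩ := hswap _ hA'e
    refine norm_lt_of_swap (i := i) (c := c) (c' := 0) (S := 0) (T := {κ i c})
      (by simpa using hA'e) ?_
    -- Removing `c` lowers the minimal valuation by 1, hence the norm by 2, and the new group
    -- element adds 1.
    obtain ⟨j, hj⟩ := exists_eq_minVal (h.mem.1.nonneg i)
    have h5 := h3 j
    have : minVal ((R + gs {κ i c} + C).2 i) ≤ minVal (A.2 i) - 1 := by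
      apply minVal_le (j := j)
      rw [e1]
      have := hc j
      simp only [Prod.snd_sub, Pi.sub_apply]; omega
    rw [e2, Multiset.card_add, Multiset.card_singleton]
    omega
  · exact LenIn.atom_add (hfree.isAtomIn_gs hR (by simpa using hclR)) hC
  · obtain ⟨V, Y, n, hAV, hV, hVi, hY, hn, hor⟩ := exists_cover h.high hi
    have hV2 : ∀ j, 2 ≤ (V.2 i).2 j := by
      rcases hor with h0 | h2
      · intro j
        have e := val_eq hAV i j
        simp only [Prod.snd_add, Pi.add_apply, h0, Prod.snd_zero, Pi.zero_apply] at e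
        have := h3 j; omega
      · exact h2
    have hval : Valid (V.2 i - c) := fun j => by
      have := hV2 j; have := hc j
      simp only [Prod.snd_sub, Pi.sub_apply]; omega
    have e1 := rest_add_sg i V
    rw [← sg_sub_add i (V.2 i) c] at e1
    have hV' : rest i V + sg i (V.2 i - c) + gs {κ i c} ∈ Blk κ := by
      refine ⟨((hV.1.rest i).add (ok_sg hval)).add (ok_gs _), ?_⟩
      simp only [map_add, cls_sg, map_sub, cls_gs, Multiset.sum_singleton, cls_rest_of_mem hV]
      abel
    obtain ⟨m, hm, hl⟩ := exists_lenIn_ge hV' (by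
      intro h0; simpa using congrArg Prod.fst h0) hY
    refine ⟨m, by omega, ?_⟩
    have : R + gs {κ i c} + C = rest i V + sg i (V.2 i - c) + gs {κ i c} + Y := by
      rw [hAV] at hA'e; grind
    rwa [this]
  · intro m _ _ hm
    obtain ⟨W', Y, n, rfl, hW', hg, hAW, hY⟩ := hm.exists_atom_mem (g := κ i c) (by simp)
    obtain ⟨R', hR', rfl⟩ := exists_eq_add_gs hW'.1.1 hg
    have hfree' := hW'.zeroSumFree (ok_gs _) (gs_singleton_ne_zero _)
    have hA2 : A = R' + sg i c + Y := by grind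
    have hcl' : cls κ R' + κ i c = 0 := by simpa using hW'.1.2
    have hmem : R' + sg i c ∈ Blk κ := ⟨hR'.add (ok_sg hcv), by simpa using hcl'⟩
    refine lift_of_le_two hmem ?_ hY ?_ hA2
    · intro h0
      exact sg_ne_zero (G := G) (E := E) hcv ((ok_sg hcv).eq_zero_of_add hR' (by rw [add_comm]; exact h0))
    · intro t ht
      exact hfree'.len_le_two hR' (fun j => (hc j).le) ht

/-- Otherwise the product of all primes could be split off inside the ambient monoid and replaced by
its class. -/
theorem exists_val_eq_one (h : Critical κ A k d) {W : Amb G E J} (hW : IsAtomIn (Blk κ) W)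
    (hl : IsLow κ A k W) {i : I} (hi : W.2 i ≠ 0) : ∃ j, (W.2 i).2 j = 1 := by
  by_contra! hcon
  have hv := hW.1.1.valid hi
  let p : E i × (J i → ℤ) := (0, fun _ => 1)
  have hval : Valid (W.2 i - p) := fun j => by
    have := hv j; have := hcon j
    simp only [Prod.snd_sub, Pi.sub_apply, p]; omega
  refine h.false_of_sub_one hW hl (c := p) (fun _ => rfl)
    (R := rest i W + sg i (W.2 i - p)) ((hW.1.1.rest i).add (ok_sg hval)) ?_
  rw [add_assoc, sg_sub_add, rest_add_sg]

/-- Otherwise the whole component could be replaced by its class. Together with `exists_val_eq_one`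
this gives at least two primes in any nonzero component of a low atom. -/
theorem exists_val_ne_one (h : Critical κ A k d) {W : Amb G E J} (hW : IsAtomIn (Blk κ) W)
    (hl : IsLow κ A k W) (i : I) : ∃ j, (W.2 i).2 j ≠ 1 := by
  by_contra! hcon
  exact h.false_of_sub_one hW hl hcon (hW.1.1.rest i) (rest_add_sg i W).symm

end Critical
end Replace

/-! ### Parity arguments over elementary 2-groups -/

section Parity

/-- In an elementary `2`-group, the class depends only on the parities of the valuations. -/
theorem map_eq_of_even {G E J : Type*} [AddCommGroup G] [AddCommGroup E]
    (h2 : ∀ g : G, 2 • g = 0) (f : (E × (J → ℤ)) →+ G) {x y : E × (J → ℤ)} (h1 : x.1 = y.1)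
    (h : ∀ j, Even (x.2 j - y.2 j)) : f x = f y := by
  choose r hr using h
  have e : x = y + 2 • ((0, r) : E × (J → ℤ)) := by
    refine Prod.ext (by simp [h1]) (funext fun j => ?_)
    have := hr j
    simp only [Prod.snd_add, Pi.add_apply, Prod.smul_mk, two_nsmul]
    omega
  rw [e, map_add, map_nsmul, h2, add_zero]

/-- The reduction of the valuations to `{1, 2}` that keeps the parities. -/
def red {E J : Type*} (x : E × (J → ℤ)) : E × (J → ℤ) := (x.1, fun j => 2 - x.2 j % 2)

theorem map_red {G E J : Type*} [AddCommGroup G] [AddCommGroup E]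
    (h2 : ∀ g : G, 2 • g = 0) (f : (E × (J → ℤ)) →+ G) (x : E × (J → ℤ)) : f (red x) = f x :=
  map_eq_of_even h2 f rfl fun j => by
    rw [Int.even_iff]; simp only [red]; omega

theorem red_valid {E J : Type*} (x : E × (J → ℤ)) : Valid (red x) := fun j => by
  simp only [red]; omega

theorem red_le {E J : Type*} (x : E × (J → ℤ)) (j : J) : (red x).2 j ≤ 2 := by
  simp only [red]; omega

theorem red_eq_one {E J : Type*} {x : E × (J → ℤ)} {j : J} (h : x.2 j = 1) :
    (red x).2 j = 1 := by
  simp only [red]; omega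

variable {G : Type*} [AddCommGroup G] {I : Type*} [Fintype I] [DecidableEq I]
  {E : I → Type*} [∀ i, AddCommGroup (E i)] {J : I → Type*} [∀ i, Fintype (J i)]
  [∀ i, DecidableEq (J i)] [∀ i, Nonempty (J i)]
  {κ : ∀ i, (E i × (J i → ℤ)) →+ G}

theorem eq_sg_of_add_eq {X Y : Amb G E J} {i : I} {x : E i × (J i → ℤ)} (hX : Ok X) (hY : Ok Y)
    (h : X + Y = sg i x) : X = sg i (X.2 i) := by
  have e : rest i X + rest i Y = 0 := by rw [← rest_add, h, rest_sg]
  have e' := (hX.rest i).eq_zero_of_add (hY.rest i) e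
  conv_lhs => rw [← rest_add_sg i X, e', zero_add]

theorem isAtomIn_sg {i : I} {x : E i × (J i → ℤ)} (hx : Valid x) {j : J i} (hj : x.2 j ≤ 1)
    (hc : κ i x = 0) : IsAtomIn (Blk κ) (sg i x : Amb G E J) := by
  have := zeroSumFree_gs_zero.isAtomIn_sg (κ := κ) ok_zero (i := i) rfl hx hj (by simpa using hc)
  rwa [zero_add] at this

/-- If the square of the product of all primes is not an atom, then there is an element of class
zero all of whose valuations are `1`. -/
theorem exists_ones (h2 : ∀ g : G, 2 • g = 0) {i : I}
    (h : ¬ IsAtomIn (Blk κ) (sg i (0, fun _ => 2) : Amb G E J)) :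
    ∃ y : E i × (J i → ℤ), (∀ j, y.2 j = 1) ∧ κ i y = 0 := by
  have hv : Valid ((0, fun _ => 2) : E i × (J i → ℤ)) := fun j => by simp
  have hκ : κ i (0, fun _ => 2) = 0 := by
    exact (map_eq_of_even h2 (κ i) (x := (0, fun _ => 2)) (y := 0) rfl
      fun j => by simp).trans (map_zero _)
  have hm : (sg i (0, fun _ => 2) : Amb G E J) ∈ Blk κ := ⟨ok_sg hv, by simpa using hκ⟩
  unfold IsAtomIn at h
  push Not at h
  obtain ⟨X, hX, Y, hY, hXY, hX0, hY0⟩ := h hm (sg_ne_zero hv)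
  -- Both factors live in component `i` with positive valuations adding up to 2 everywhere.
  have eX := eq_sg_of_add_eq hX.1 hY.1 hXY
  have eY := eq_sg_of_add_eq hY.1 hX.1 (by rw [add_comm]; exact hXY)
  have nX : X.2 i ≠ 0 := fun h0 => hX0 (by rw [eX, h0, sg_zero])
  have nY : Y.2 i ≠ 0 := fun h0 => hY0 (by rw [eY, h0, sg_zero])
  refine ⟨X.2 i, fun j => ?_, ?_⟩
  · have := hX.1.valid nX j
    have := hY.1.valid nY j
    have e := val_eq hXY i j
    simp only [Prod.snd_add, Pi.add_apply, sg_snd_self] at e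
    omega
  · have := hX.2
    rwa [eX, cls_sg] at this

namespace Critical

variable {A : Amb G E J} {d : ℕ}

/-- The component is replaced by the classes of its parts in `U₁` and `U₂`. The valuation 3 at `z`
allows at most three atoms at component `i`; splitting off the class-zero atom `x` leaves `b`, which
only one atom can contain. -/
theorem false_of_split (h : Critical κ A 2 d) {U₁ U₂ : Amb G E J}
    (hA : A = U₁ + U₂) (hU₁ : IsAtomIn (Blk κ) U₁) (hU₂ : IsAtomIn (Blk κ) U₂) {i : I}
    (hi₁ : U₁.2 i ≠ 0) (hi₂ : U₂.2 i ≠ 0) {z : J i} (hz : (A.2 i).2 z = 3)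
    {x b : E i × (J i → ℤ)} (hx : Valid x) (hb : Valid b) (hxb : x + b = A.2 i)
    (hat : IsAtomIn (Blk κ) (sg i x : Amb G E J)) {j : J i} (hj : b.2 j = 1) : False := by
  have hi : A.2 i ≠ 0 := by rw [← hxb]; exact (hx.add hb).ne_zero
  have h3 := h.three_le hi
  have hd := h.two_le
  have l₁ : IsLow κ A 2 U₁ := ⟨U₂, 1, hA, hU₂.lenIn, by omega⟩
  have l₂ : IsLow κ A 2 U₂ := ⟨U₁, 1, by rw [hA, add_comm], hU₁.lenIn, by omega⟩
  obtain ⟨j₁, hj₁⟩ := h.exists_val_eq_one hU₁ l₁ hi₁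
  obtain ⟨j₂, hj₂⟩ := h.exists_val_eq_one hU₂ l₂ hi₂
  have hu : A.2 i = U₁.2 i + U₂.2 i := by rw [hA]; rfl
  have hκx : κ i x = 0 := by simpa using hat.1.2
  have hκa : κ i (A.2 i) = κ i b := by rw [← hxb, map_add, hκx, zero_add]
  have hgs : (gs {κ i (U₁.2 i), κ i (U₂.2 i)} : Amb G E J) =
      gs {κ i (U₁.2 i)} + gs {κ i (U₂.2 i)} := by
    rw [← gs_add]; rfl
  have hsum : ({κ i (U₁.2 i), κ i (U₂.2 i)} : Multiset G).sum = κ i (A.2 i) := by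
    rw [hu]; simp
  have hsgA : (sg i x : Amb G E J) + sg i b = sg i (A.2 i) := by rw [← sg_add, hxb]
  have hAr := rest_add_sg i A
  refine h.reduce (rest i A + gs {κ i (U₁.2 i), κ i (U₂.2 i)}) ?_ ⟨2, le_rfl, ?_⟩ ?_ ?_
  · have hmin : 3 ≤ minVal (A.2 i) := le_minVal h3
    refine norm_lt_of i (fun i' hi' => by simp [rest_snd_of_ne hi']) ?_
    simp [minVal_zero]; omega
  · have := (hU₁.replace hi₁).lenIn.add (hU₂.replace hi₂).lenIn
    convert this using 1
    rw [hgs]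
    rw [hA, rest_add]; abel
  · obtain ⟨V₁, Y₁, n₁, hn₁, hV₁, vi₁, hA₁, hY₁⟩ := h.high.exists_atom_comp hi
    by_cases h1 : Y₁.2 i = 0
    · obtain ⟨m, hm, hl⟩ := exists_lenIn_replace hsum (by simp) hA₁ hV₁.1 h1 hY₁
      exact ⟨m, by omega, hl⟩
    obtain ⟨V₂, Y₂, n₂, rfl, hV₂, vi₂, rfl, hY₂⟩ := hY₁.exists_atom_comp h1
    by_cases h1 : Y₂.2 i = 0
    · obtain ⟨m, hm, hl⟩ := exists_lenIn_replace hsum (by simp) (V := V₁ + V₂)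
        (by rw [hA₁]; abel) ((Blk κ).add_mem hV₁.1 hV₂.1) h1 hY₂
      exact ⟨m, by omega, hl⟩
    obtain ⟨V₃, Y₃, n₃, rfl, hV₃, vi₃, rfl, hY₃⟩ := hY₂.exists_atom_comp h1
    have hYi : Y₃.2 i = 0 := by
      apply hY₃.mem.1.eq_zero (j := z)
      have := val_eq hA₁ i z
      simp only [Prod.snd_add, Pi.add_apply] at this
      have := hV₁.1.1.valid vi₁ z
      have := hV₂.1.1.valid vi₂ z
      have := hV₃.1.1.valid vi₃ z
      omega
    have hA₂ : A = (V₁ + V₂ + V₃) + Y₃ := by rw [hA₁]; abel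
    have hVB := (Blk κ).add_mem ((Blk κ).add_mem hV₁.1 hV₂.1) hV₃.1
    generalize V₁ + V₂ + V₃ = V at hA₂ hVB
    have hVi : V.2 i = A.2 i := by rw [hA₂]; simp [hYi]
    have hPb : rest i V + sg i b ∈ Blk κ := by
      refine ⟨(hVB.1.rest i).add (ok_sg hb), ?_⟩
      rw [map_add, cls_sg, cls_rest_of_mem hVB, hVi, hκa]; abel
    have hPbi : (rest i V + sg i b).2 i = b := by simp
    have hA₃ : A = sg i x + (rest i V + sg i b) + Y₃ := by
      have := rest_add_sg i V
      rw [hVi] at this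
      rw [hA₂]
      conv_lhs => rw [← this, ← hsgA]
      abel
    obtain ⟨n, hn⟩ := blk_exists_lenIn_pos hPb (fun h0 => by
      rw [h0] at hPbi; exact hb.ne_zero hPbi.symm)
    -- Three atoms of the long factorization were regrouped as `x` and a remainder. If the remainder
    -- were an atom, `A` would have length k + d - 1, inside the gap.
    rcases Nat.eq_zero_or_pos n with hn0 | hn0
    · exfalso
      subst hn0
      have := (hat.lenIn.add hn).add hY₃
      rw [← hA₃] at this
      exact h.no_gap this (by omega) (by omega)
    · obtain ⟨X, Y', n', hn', hX, hXi, hXY, hY'⟩ := hn.exists_atom_comp (i := i)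
        (by rw [hPbi]; exact hb.ne_zero)
      have hYi' : Y'.2 i = 0 := by
        apply hY'.mem.1.eq_zero (j := j)
        have := val_eq hXY i j
        rw [hPbi] at this
        simp only [Prod.snd_add, Pi.add_apply] at this
        have := hX.1.1.valid hXi j
        omega
      have hXb : X.2 i = b := by
        have := comp_eq hXY i
        rw [hPbi] at this
        rw [this]; simp [hYi']
      have hX' : rest i X + gs {κ i (U₁.2 i), κ i (U₂.2 i)} ∈ Blk κ := by
        refine ⟨(hX.1.1.rest i).add (ok_gs _), ?_⟩
        rw [map_add, cls_gs, hsum, hκa, cls_rest_of_mem hX.1, hXb]; abel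
      obtain ⟨m, hm, hl⟩ := exists_lenIn_ge hX' (by
        intro h0; simpa using congrArg Prod.fst h0) (hY'.add hY₃)
      refine ⟨m, by omega, ?_⟩
      convert hl using 1
      have e1 : rest i A = rest i V + Y₃ := by rw [hA₂, rest_add, rest_eq_self hYi]
      have e2 := rest_add_sg i X
      rw [hXb] at e2
      rw [e1]
      grind
  · intro m _ _ hm
    rcases exists_of_lenIn_replace_two (hU₁.1.1.valid hi₁) (hU₂.1.1.valid hi₂) hj₁.le
      hj₂.le hu hm with h1 | ⟨R, Y, n, hR, hRO, hRi, hAR, hY, rfl, hmem⟩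
    · exact Or.inl h1
    · right
      have hRb := hR.isAtomIn_sg hRO hRi hb hj.le (by
        have := hmem.2
        rw [map_add, cls_sg, hκa] at this
        rwa [map_add, cls_sg])
      have := hat.lenIn.add (hRb.lenIn.add hY)
      rw [show 1 + (1 + n) = n + 1 + 1 by omega] at this
      convert this using 1
      rw [hAR, ← hsgA]; abel

/-- Two low atoms of a critical element over an elementary `2`-group do not share a component with
smallest valuation `3`. -/
theorem false_of_val_eq_one (h2 : ∀ g : G, 2 • g = 0) (h : Critical κ A 2 d)
    {U₁ U₂ : Amb G E J} (hA : A = U₁ + U₂) (hU₁ : IsAtomIn (Blk κ) U₁)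
    (hU₂ : IsAtomIn (Blk κ) U₂) {i : I} (hi₁ : U₁.2 i ≠ 0) (hi₂ : U₂.2 i ≠ 0) {z : J i}
    (hz₁ : (U₁.2 i).2 z = 1) (hz₂ : (U₂.2 i).2 z = 2) : False := by
  have hi : A.2 i ≠ 0 := by
    rw [hA]; exact ((hU₁.1.1.valid hi₁).add (hU₂.1.1.valid hi₂)).ne_zero
  have h3 := h.three_le hi
  have hd := h.two_le
  have hz : (A.2 i).2 z = 3 := by
    rw [hA]; simp only [Prod.snd_add, Pi.add_apply]; omega
  -- If the constant valuation 2 were an atom, it could be split off from `A.2 i`, leaving valuation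
  -- 1 at `z`, against `false_of_split`.
  obtain ⟨y, hy, hκy⟩ : ∃ y : E i × (J i → ℤ), (∀ j, y.2 j = 1) ∧ κ i y = 0 := by
    refine exists_ones h2 fun hat => ?_
    refine h.false_of_split hA hU₁ hU₂ hi₁ hi₂ hz (x := (0, fun _ => 2))
      (b := A.2 i - (0, fun _ => 2)) (fun j => by simp) (fun j => ?_) (by abel) hat (j := z) ?_
    · have := h3 j
      simp only [Prod.snd_sub, Pi.sub_apply]; omega
    · simp only [Prod.snd_sub, Pi.sub_apply]; omega
  -- Adding `f` changes no class, but lowers the valuation at `z` from 3 to 2 and raises the others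
  -- by 1. The reduced element is `A` with `f` added.
  let f : E i × (J i → ℤ) := y - (0, Pi.single z 2)
  have hκf : κ i f = 0 := by
    rw [← hκy]
    refine map_eq_of_even h2 (κ i) (by simp [f]) fun j => ?_
    by_cases hj : j = z
    · subst hj; simp [f]
    · simp [f, hj]
  have hfz : f.2 z = -1 := by simp [f, hy]
  have hfj : ∀ j, j ≠ z → f.2 j = 1 := fun j hj => by simp [f, hy, hj]
  have hf1 : ∀ j, -1 ≤ f.2 j := fun j => by
    by_cases hj : j = z
    · rw [hj, hfz]
    · rw [hfj j hj]; omega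
  have v₁ := hU₁.1.1.valid hi₁
  have v₂ := hU₂.1.1.valid hi₂
  have hval₂ : Valid (U₂.2 i + f) := fun j => by
    have := v₂ j
    simp only [Prod.snd_add, Pi.add_apply]
    by_cases hj : j = z
    · subst hj; omega
    · have := hfj j hj; omega
  have hvala : ∀ v : E i × (J i → ℤ), (∀ j, 2 ≤ v.2 j) → Valid (v + f) := fun v hv j => by
    have := hv j; have := hf1 j
    simp only [Prod.snd_add, Pi.add_apply]; omega
  have hA' : U₁ + (rest i U₂ + sg i (U₂.2 i + f)) = A + sg i f := by
    rw [sg_add, hA]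
    conv_rhs => rw [← rest_add_sg i U₂]
    abel
  have hbi : (A + sg i f).2 i = A.2 i + f := by simp
  have hb : Valid (A.2 i + f) := hvala _ fun j => by have := h3 j; omega
  have hbz : (A.2 i + f).2 z = 2 := by simp only [Prod.snd_add, Pi.add_apply]; omega
  refine h.reduce (A + sg i f) ?_ ⟨2, le_rfl, ?_⟩ ?_ ?_
  · have hmin : 3 ≤ minVal (A.2 i) := le_minVal h3
    have hmin' : minVal (A.2 i + f) ≤ 2 := minVal_le (j := z) (by omega)
    refine norm_lt_of i (fun i' hi' => by simp [sg_snd_of_ne hi']) ?_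
    rw [hbi]; simp; omega
  · rw [← hA']
    refine hU₁.lenIn.add (IsAtomIn.lenIn ?_)
    refine (hU₂.zeroSumFree_rest hi₂).isAtomIn_sg (hU₂.1.1.rest i) (by simp) hval₂ (j := z) ?_ ?_
    · simp only [Prod.snd_add, Pi.add_apply]; omega
    · rw [map_add, cls_sg, map_add, hκf, add_zero, cls_rest, hU₂.1.2]
  · obtain ⟨V, Y, n, hAV, hV, hVi, hY, hn, hor⟩ := exists_cover h.high hi
    have hV2 : ∀ j, 2 ≤ (V.2 i).2 j := by
      rcases hor with h0 | h2
      · intro j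
        have e := val_eq hAV i j
        simp only [Prod.snd_add, Pi.add_apply, h0, Prod.snd_zero, Pi.zero_apply] at e
        have := h3 j; omega
      · exact h2
    have hV' : rest i V + sg i (V.2 i + f) ∈ Blk κ := by
      refine ⟨(hV.1.rest i).add (ok_sg (hvala _ hV2)), ?_⟩
      rw [map_add, cls_sg, map_add, hκf, add_zero, cls_rest, hV.2]
    obtain ⟨m, hm, hl⟩ := exists_lenIn_ge hV' (fun h0 => by
      have := comp_eq h0 i
      simp only [Prod.snd_add, Pi.add_apply, rest_snd_self, sg_snd_self, zero_add,
        Prod.snd_zero, Pi.zero_apply] at this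
      exact (hvala _ hV2).ne_zero this) hY
    refine ⟨m, by omega, ?_⟩
    convert hl using 1
    rw [sg_add, hAV]
    conv_lhs => rw [← rest_add_sg i V]
    abel
  · intro m _ _ hm
    obtain ⟨W₁, Y₁, n₁, rfl, hW₁, wi₁, hAW, hY₁⟩ := hm.exists_atom_comp (i := i)
      (by rw [hbi]; exact hb.ne_zero)
    have hfree := hW₁.zeroSumFree_rest wi₁
    by_cases h1 : Y₁.2 i = 0
    · have hw : W₁.2 i = A.2 i + f := by
        rw [← hbi, hAW]; simp [h1]
      have hAW' : A = rest i W₁ + sg i (A.2 i) + Y₁ := by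
        have := rest_add_sg i W₁
        rw [hw, sg_add] at this
        grind
      have hmem : rest i W₁ + sg i (A.2 i) ∈ Blk κ := by
        refine ⟨(hW₁.1.1.rest i).add (ok_sg (h.mem.1.valid hi)), ?_⟩
        rw [map_add, cls_sg, cls_rest_of_mem hW₁.1, hw, map_add, hκf]; abel
      refine lift_of_le_two hmem (fun h0 => hi ?_) hY₁ ?_ hAW'
      · simpa using comp_eq h0 i
      · intro t ht
        by_contra hcon
        obtain ⟨t, rfl⟩ : ∃ t', t = t' + 3 := ⟨t - 3, by omega⟩
        -- Moving `f` into the sum of two of three factors would split the atom `W₁`.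
        obtain ⟨X₁, X₂, Z, hXZ, hX₁, hX₂, hZ, i₁, i₂, i₃⟩ := hfree.exists_three (by simp) ht
        have hX2 : ∀ j, 2 ≤ ((X₁ + X₂).2 i).2 j := fun j => by
          have := hX₁.1.valid i₁ j; have := hX₂.1.valid i₂ j
          simp only [Prod.snd_add, Pi.add_apply]; omega
        have hX := (Blk κ).add_mem hX₁ hX₂
        generalize X₁ + X₂ = X at hX hX2 hXZ
        have hX' : rest i X + sg i (X.2 i + f) ∈ Blk κ := by
          refine ⟨(hX.1.rest i).add (ok_sg (hvala _ hX2)), ?_⟩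
          rw [map_add, cls_sg, map_add, hκf, add_zero, cls_rest, hX.2]
        have e : rest i X + sg i (X.2 i + f) + Z = W₁ := by
          have e1 := rest_add_sg i W₁
          have e2 := rest_add_sg i X
          rw [hw, sg_add] at e1
          rw [sg_add]
          grind
        rcases hW₁.2.2 _ hX' Z hZ e with h0 | h0
        · have := comp_eq h0 i
          simp only [Prod.snd_add, Pi.add_apply, rest_snd_self, sg_snd_self, zero_add,
            Prod.snd_zero, Pi.zero_apply] at this
          exact (hvala _ hX2).ne_zero this
        · exact i₃ (by rw [h0]; rfl)
    · obtain ⟨W₂, Y, n, rfl, hW₂, wi₂, rfl, hY⟩ := hY₁.exists_atom_comp h1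
      have w₁ := hW₁.1.1.valid wi₁ z
      have w₂ := hW₂.1.1.valid wi₂ z
      have e := val_eq hAW i z
      rw [hbi] at e
      simp only [Prod.snd_add, Pi.add_apply] at e
      have hYi : Y.2 i = 0 := hY.mem.1.eq_zero (j := z) (by omega)
      have hy0 := hY.mem.1.nonneg i z
      have hw : W₁.2 i + W₂.2 i = A.2 i + f := by
        rw [← hbi, hAW]; simp [hYi]
      -- Both atoms have valuation 1 at `z`. Shrinking the second component to valuations 1 and 2
      -- keeps its atom and leaves room for the remainder, whose valuation at `z` is 2.
      set x' := red (W₂.2 i) with hx'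
      have hx'z : x'.2 z = 1 := red_eq_one (by omega)
      have hx : Valid (A.2 i - x') := fun j => by
        have := h3 j
        have : x'.2 j ≤ 2 := red_le _ j
        simp only [Prod.snd_sub, Pi.sub_apply]; omega
      have hκx' : κ i x' = κ i (W₂.2 i) := map_red h2 _ _
      have hat := (hW₂.zeroSumFree_rest wi₂).isAtomIn_sg (hW₂.1.1.rest i) (by simp)
        (red_valid (W₂.2 i)) (j := z) hx'z.le (by
          rw [map_add, cls_sg, ← hx', hκx', cls_rest, hW₂.1.2])
      have hmem : rest i W₁ + sg i (A.2 i - x') ∈ Blk κ := by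
        refine ⟨(hW₁.1.1.rest i).add (ok_sg hx), ?_⟩
        have e1 := congrArg (κ i) hw
        rw [map_add, map_add, hκf, add_zero] at e1
        rw [map_add, cls_sg, map_sub, hκx', ← e1, add_sub_cancel_right, cls_rest, hW₁.1.2]
      refine lift_of_le_two hmem (fun h0 => hx.ne_zero (by simpa using comp_eq h0 i))
        (LenIn.atom_add hat hY) ?_ ?_
      · intro t ht
        have := hfree.lenIn_le (by simp) ht z
        simp only [Prod.snd_sub, Pi.sub_apply] at this
        omega
      · have e1 := rest_add_sg i W₁
        have e2 := rest_add_sg i W₂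
        have e3 : (sg i (W₁.2 i) : Amb G E J) + sg i (W₂.2 i) = sg i (A.2 i) + sg i f := by
          rw [← sg_add, ← sg_add, hw]
        have e4 := sg_sub_add (G := G) i (A.2 i) x'
        rw [← hx']
        grind

theorem false_of_val_eq_three (h2 : ∀ g : G, 2 • g = 0) (h : Critical κ A 2 d)
    {U₁ U₂ : Amb G E J} (hA : A = U₁ + U₂) (hU₁ : IsAtomIn (Blk κ) U₁)
    (hU₂ : IsAtomIn (Blk κ) U₂) {i : I} (hi₁ : U₁.2 i ≠ 0) (hi₂ : U₂.2 i ≠ 0) {z : J i}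
    (hz : (A.2 i).2 z = 3) : False := by
  have v₁ := hU₁.1.1.valid hi₁ z
  have v₂ := hU₂.1.1.valid hi₂ z
  have e := val_eq hA i z
  simp only [Prod.snd_add, Pi.add_apply] at e
  by_cases h1 : (U₁.2 i).2 z = 1
  · exact h.false_of_val_eq_one h2 hA hU₁ hU₂ hi₁ hi₂ h1 (by omega)
  · exact h.false_of_val_eq_one h2 (hA.trans (add_comm _ _)) hU₂ hU₁ hi₂ hi₁ (z := z)
      (by omega) (by omega)

end Critical
end Parity

/-! ### At most one nonzero component: short factorizations have length at most 2 -/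

section SingleComponent

/-- The element with valuation `1` at `x` and `0` elsewhere. -/
def unitVec {E J : Type*} [AddCommGroup E] [DecidableEq J] (x : J) : E × (J → ℤ) :=
  (0, Pi.single x 1)

section UnitVec

variable {E J : Type*} [AddCommGroup E] [DecidableEq J]

theorem unitVec_self (x : J) : (unitVec x : E × (J → ℤ)).2 x = 1 := by simp [unitVec]

theorem unitVec_of_ne {x j : J} (h : j ≠ x) : (unitVec x : E × (J → ℤ)).2 j = 0 := by
  simp [unitVec, h]

theorem unitVec_le_one (x j : J) : (unitVec x : E × (J → ℤ)).2 j ≤ 1 := by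
  by_cases h : j = x
  · rw [h, unitVec_self]
  · rw [unitVec_of_ne h]; omega

theorem valid_sub_unitVec {v : E × (J → ℤ)} (hv : Valid v) {x : J} (h : 2 ≤ v.2 x) :
    Valid (v - unitVec x) := fun j => by
  simp only [Prod.snd_sub, Pi.sub_apply]
  by_cases hj : j = x
  · subst hj; rw [unitVec_self]; omega
  · rw [unitVec_of_ne hj]; have := hv j; omega

theorem map_zero_snd [Fintype J] {G : Type*} [AddCommGroup G] (f : (E × (J → ℤ)) →+ G)
    (t : J → ℤ) : f (0, t) = ∑ x, t x • f (unitVec x) := by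
  have : ((0, t) : E × (J → ℤ)) = ∑ x, t x • unitVec x := by
    refine Prod.ext ?_ (funext fun j => ?_)
    · simp [unitVec, Prod.fst_sum]
    · simp [unitVec, Prod.snd_sum, Finset.sum_apply, Pi.single_apply]
  rw [this, map_sum]
  simp

end UnitVec

variable {G : Type*} [AddCommGroup G] {I : Type*} [Fintype I] [DecidableEq I]
  {E : I → Type*} [∀ i, AddCommGroup (E i)] {J : I → Type*} [∀ i, Fintype (J i)]
  [∀ i, DecidableEq (J i)] [∀ i, Nonempty (J i)]
  {κ : ∀ i, (E i × (J i → ℤ)) →+ G}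

/-- All components except possibly the `i`-th one vanish. -/
def SuppIn (i : I) (X : Amb G E J) : Prop := ∀ i', i' ≠ i → X.2 i' = 0

theorem SuppIn.eq {i : I} {X : Amb G E J} (h : SuppIn i X) : gs X.1 + sg i (X.2 i) = X := by
  refine Prod.ext (by simp) (funext fun i' => ?_)
  by_cases hi : i' = i
  · subst hi; simp
  · simp [sg_snd_of_ne hi, h i' hi]

theorem SuppIn.rest {i : I} {X : Amb G E J} (h : SuppIn i X) : rest i X = gs X.1 := by
  conv_lhs => rw [← h.eq, rest_add, rest_sg, add_zero, rest_eq_self (gs_snd _ _)]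

theorem SuppIn.add {i : I} {X Y : Amb G E J} (hX : SuppIn i X) (hY : SuppIn i Y) :
    SuppIn i (X + Y) := fun i' hi => by simp [hX i' hi, hY i' hi]

theorem suppIn_gs (i : I) (S : Multiset G) : SuppIn i (gs S : Amb G E J) := fun _ _ => rfl

theorem suppIn_sg (i : I) (x : E i × (J i → ℤ)) : SuppIn i (sg i x : Amb G E J) :=
  fun _ h => sg_snd_of_ne h x

theorem comp_eq_zero_of_add {X Y : Amb G E J} (hX : Ok X) (hY : Ok Y) {i : I}
    (h : (X + Y).2 i = 0) : X.2 i = 0 := by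
  have e : (X.2 i).2 (Classical.arbitrary _) + (Y.2 i).2 (Classical.arbitrary _) = 0 := by
    have := congrFun (congrArg Prod.snd h) (Classical.arbitrary (J i))
    simpa using this
  have := hX.nonneg i (Classical.arbitrary _)
  have := hY.nonneg i (Classical.arbitrary _)
  exact hX.eq_zero (j := Classical.arbitrary _) (by omega)

theorem SuppIn.of_add {i : I} {X Y : Amb G E J} (h : SuppIn i (X + Y)) (hX : Ok X) (hY : Ok Y) :
    SuppIn i X := fun i' hi => comp_eq_zero_of_add hX hY (h i' hi)

theorem SuppIn.of_add_right {i : I} {X Y : Amb G E J} (h : SuppIn i (X + Y)) (hX : Ok X)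
    (hY : Ok Y) : SuppIn i Y := by
  rw [add_comm] at h
  exact h.of_add hY hX

theorem SuppIn.two_le_card {i : I} {X : Amb G E J} (h : SuppIn i X) (hX : X ∈ Blk κ)
    (h0 : X ≠ 0) (hi : X.2 i = 0) (hz : (0 : G) ∉ X.1) : 2 ≤ X.1.card := by
  have e := h.eq
  rw [hi, sg_zero, add_zero] at e
  by_contra hcon
  rcases Nat.lt_or_ge 0 X.1.card with h1 | h1
  · obtain ⟨g, hg⟩ := Multiset.card_eq_one.1 (by omega : X.1.card = 1)
    have hc := hX.2
    rw [← e, cls_gs, hg, Multiset.sum_singleton] at hc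
    apply hz
    rw [hg, hc]; simp
  · exact h0 (by rw [← e, Multiset.card_eq_zero.1 (by omega : X.1.card = 0), gs_zero])

theorem SuppIn.comp_ne_zero {i : I} {X : Amb G E J} (h : SuppIn i X)
    (h0 : X ≠ 0) (hX : X.1 = 0) : X.2 i ≠ 0 := by
  intro hi
  apply h0
  rw [← h.eq, hi, hX, gs_zero, sg_zero, add_zero]

/-- Each atom either adds at least 1 to every valuation of component `i`, or consists of at least
two nonzero group elements. -/
theorem SuppIn.two_mul_len_le {i : I} {X : Amb G E J} {n : ℕ} (h : SuppIn i X)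
    (hn : LenIn (Blk κ) X n) (hz : (0 : G) ∉ X.1) (j : J i) :
    (2 * n : ℤ) ≤ 2 * (X.2 i).2 j + X.1.card := by
  induction n generalizing X with
  | zero =>
    have := hn.mem.1.nonneg i j
    push_cast; omega
  | succ n ih =>
    obtain ⟨W, Y, hW, rfl, hY⟩ := hn.exists_atom
    have hsW := h.of_add hW.1.1 hY.mem.1
    have h1 := ih (h.of_add_right hW.1.1 hY.mem.1) hY (fun h' => hz (by simp [h']))
    have h2 : (2 : ℤ) ≤ 2 * (W.2 i).2 j + W.1.card := by
      by_cases hi : W.2 i = 0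
      · have := hsW.two_le_card hW.1 hW.2.1 hi (fun h' => hz (by simp [h']))
        rw [hi]; simp; omega
      · have := hW.1.1.valid hi j
        omega
    simp only [Prod.snd_add, Pi.add_apply, Prod.fst_add, Multiset.card_add]
    push_cast; omega

theorem LenIn.exists_atom_fst_zero {X : Amb G E J} {n : ℕ} (h : LenIn (Blk κ) X n)
    (hc : X.1.card < n) : ∃ V Y m, n = m + 1 ∧ IsAtomIn (Blk κ) V ∧ V.1 = 0 ∧ X = V + Y ∧
      LenIn (Blk κ) Y m := by
  induction n generalizing X with
  | zero => omega
  | succ n ih =>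
    obtain ⟨W, Y, hW, rfl, hY⟩ := h.exists_atom
    by_cases h0 : W.1 = 0
    · exact ⟨W, Y, n, rfl, hW, h0, rfl, hY⟩
    · have := Multiset.card_pos.2 h0
      simp only [Prod.fst_add, Multiset.card_add] at hc
      obtain ⟨V, Y', m, rfl, hV, hV0, rfl, hY'⟩ := ih hY (by omega)
      exact ⟨V, W + Y', m + 1, rfl, hV, hV0, by abel, LenIn.atom_add hW hY'⟩

theorem zeroSumFree_gs_singleton {g : G} (hg : g ≠ 0) :
    ZeroSumFree κ (gs {g} : Amb G E J) := by
  refine zeroSumFree_gs fun T hT h0 => ?_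
  rcases Multiset.le_singleton.1 hT with h | h
  · exact h
  · rw [h, Multiset.sum_singleton] at h0
    exact absurd h0 hg

theorem zeroSumFree_gs_pair {g h : G} (hg : g ≠ 0) (hh : h ≠ 0) (hgh : g + h ≠ 0) :
    ZeroSumFree κ (gs {g, h} : Amb G E J) := by
  refine zeroSumFree_gs fun T hT h0 => ?_
  rw [← Multiset.mem_powerset] at hT
  simp only [Multiset.insert_eq_cons, Multiset.powerset_cons, Multiset.mem_add,
    Multiset.mem_powerset, Multiset.le_singleton, Multiset.mem_map] at hT
  rcases hT with (h | h) | ⟨a, (h | h), rfl⟩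
  · exact h
  · rw [h] at h0; simp at h0; exact absurd h0 hh
  · rw [h] at h0; simp at h0; exact absurd h0 hg
  · rw [h] at h0; simp at h0; exact absurd h0 hgh

/-- Enlarging the component of an atom by an element of class zero. -/
theorem IsAtomIn.len_le_two {W : Amb G E J} (hW : IsAtomIn (Blk κ) W) {i : I} (hi : W.2 i ≠ 0)
    {f : E i × (J i → ℤ)} (hκ : κ i f = 0) (hf : ∀ j, f.2 j ≤ 1) {t : ℕ}
    (ht : LenIn (Blk κ) (W + sg i f) t) : t ≤ 2 := by
  by_contra hcon
  obtain ⟨t, rfl⟩ : ∃ t', t = t' + 3 := ⟨t - 3, by omega⟩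
  have e : W + sg i f = rest i W + sg i (W.2 i + f) := by
    conv_lhs => rw [← rest_add_sg i W]
    rw [sg_add]; abel
  rw [e] at ht
  obtain ⟨X₁, X₂, Z, hXZ, hX₁, hX₂, hZ, i₁, i₂, i₃⟩ :=
    (hW.zeroSumFree_rest hi).exists_three (by simp) ht
  -- Taking `f` out of two of three factors would split the atom `W`.
  have hv : Valid ((X₁ + X₂).2 i - f) := fun j => by
    have := hX₁.1.valid i₁ j; have := hX₂.1.valid i₂ j; have := hf j
    simp only [Prod.snd_sub, Prod.snd_add, Pi.sub_apply, Pi.add_apply]; omega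
  have hX := (Blk κ).add_mem hX₁ hX₂
  have e2 := rest_add_sg i (X₁ + X₂)
  rw [← sg_sub_add i _ f] at e2
  have hX' : rest i (X₁ + X₂) + sg i ((X₁ + X₂).2 i - f) ∈ Blk κ := by
    refine ⟨(hX.1.rest i).add (ok_sg hv), ?_⟩
    rw [map_add, cls_sg, map_sub, hκ, sub_zero, cls_rest, hX.2]
  rw [← e] at hXZ
  rcases hW.2.2 _ hX' Z hZ (by grind) with h0 | h0
  · have := comp_eq h0 i
    simp only [Prod.snd_add, Pi.add_apply, rest_snd_self, sg_snd_self, zero_add,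
      Prod.snd_zero, Pi.zero_apply] at this
    exact hv.ne_zero (by simpa using this)
  · exact i₃ (by rw [h0]; rfl)

namespace Critical

variable {A : Amb G E J} {k d : ℕ}

theorem exists_cover_two (h : Critical κ A k d) {i : I} (hi : A.2 i ≠ 0) :
    ∃ V Y n, A = V + Y ∧ V ∈ Blk κ ∧ (∀ j, 2 ≤ (V.2 i).2 j) ∧ LenIn (Blk κ) Y n ∧
      k + d ≤ n + 2 := by
  obtain ⟨V, Y, n, hAV, hV, hVi, hY, hn, hor⟩ := exists_cover h.high hi
  refine ⟨V, Y, n, hAV, hV, ?_, hY, hn⟩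
  rcases hor with h0 | h2
  · intro j
    have e := val_eq hAV i j
    simp only [Prod.snd_add, Pi.add_apply, h0, Prod.snd_zero, Pi.zero_apply] at e
    have := h.three_le hi j; omega
  · exact h2

/-- All atoms of a factorization of length k are low, so each contains at most one group element. -/
theorem card_le (h : Critical κ A k d) : A.1.card ≤ k := by
  have key : ∀ m (Y C : Amb G E J) c, A = C + Y → LenIn (Blk κ) C c → LenIn (Blk κ) Y m →
      c + m = k → Y.1.card ≤ m := by
    intro m
    induction m with
    | zero =>
      intro Y C c _ _ hY _
      rw [hY.eq_zero_of_zero]; simp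
    | succ m ih =>
      intro Y C c hA hC hY hk
      obtain ⟨W, Y', hW, rfl, hY'⟩ := hY.exists_atom
      have h1 := ih Y' (W + C) (c + 1) (by rw [hA]; abel) (LenIn.atom_add hW hC) hY' (by omega)
      have h2 := h.card_le_one hW ⟨C + Y', c + m, by rw [hA]; abel, hC.add hY', by omega⟩
      simp only [Prod.fst_add, Multiset.card_add]; omega
  exact key k A 0 0 (by simp) LenIn.zero h.low (by simp)

theorem comp_ne_zero_of_isLow (h : Critical κ A k d) {i : I} (hs : SuppIn i A)
    {W : Amb G E J} (hW : IsAtomIn (Blk κ) W) (hl : IsLow κ A k W) : W.2 i ≠ 0 := by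
  intro hi
  have h1 := h.card_le_one hW hl
  obtain ⟨C, m, hA, hC, -⟩ := hl
  have := (SuppIn.of_add (by rwa [← hA]) hW.1.1 hC.mem.1 : SuppIn i W).two_le_card hW.1 hW.2.1 hi
    (fun h0 => h.zero_notMem (by rw [hA]; simp [h0]))
  omega

/-- With three low atoms, `U₁` can be shrunk modulo the orders of the prime classes while remaining
a low atom. It then fits beside an atom `V` of the long factorization, which makes `V` low, against
`len_le`. -/
theorem len_le_two (h : Critical κ A k d) (hord : ∀ g : G, 0 < addOrderOf g ∧ addOrderOf g ≤ d)
    {i : I} (hs : SuppIn i A) : k ≤ 2 := by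
  by_contra hcon
  obtain ⟨k, rfl⟩ : ∃ k', k = k' + 3 := ⟨k - 3, by omega⟩
  have hd := h.two_le
  have hlow := h.low
  obtain ⟨U₁, C₁, hU₁, hA₁, hC₁⟩ := hlow.exists_atom
  obtain ⟨U₂, C₂, hU₂, rfl, hC₂⟩ := hC₁.exists_atom
  obtain ⟨U₃, C, hU₃, rfl, hC⟩ := hC₂.exists_atom
  have l₁ : IsLow κ A (k + 3) U₁ := ⟨_, _, hA₁, hC₁, by omega⟩
  have l₂ : IsLow κ A (k + 3) U₂ := ⟨U₁ + (U₃ + C), k + 2, by rw [hA₁]; abel,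
    LenIn.atom_add hU₁ hC₂, by omega⟩
  have l₃ : IsLow κ A (k + 3) U₃ := ⟨U₁ + (U₂ + C), k + 2, by rw [hA₁]; abel,
    LenIn.atom_add hU₁ (LenIn.atom_add hU₂ hC), by omega⟩
  have i₁ := h.comp_ne_zero_of_isLow hs hU₁ l₁
  have i₂ := h.comp_ne_zero_of_isLow hs hU₂ l₂
  have hcard := h.card_le
  obtain ⟨V, Y, n, hn, hV, hV0, hAV, hY⟩ := h.high.exists_atom_fst_zero (by omega)
  have hsV : SuppIn i V := SuppIn.of_add (by rwa [← hAV]) hV.1.1 hY.mem.1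
  have hsY : SuppIn i Y := SuppIn.of_add_right (by rwa [← hAV]) hV.1.1 hY.mem.1
  have hsU : SuppIn i U₁ := SuppIn.of_add (by rwa [← hA₁]) hU₁.1.1 hC₁.mem.1
  have hY1 : Y.1 = A.1 := by rw [hAV]; simp [hV0]
  -- `Y` has d - 1 more atoms than the short factorization but no more than k group elements, so
  -- component `i` must be large.
  have hYd : ∀ j, (d : ℤ) + 1 ≤ (Y.2 i).2 j := fun j => by
    have := hsY.two_mul_len_le hY (by rw [hY1]; exact h.zero_notMem) j
    rw [hY1] at this
    omega
  have v₁ := hU₁.1.1.valid i₁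
  let N : J i → ℤ := fun j => addOrderOf (κ i (unitVec j))
  have hN : ∀ j, 0 < N j ∧ N j ≤ d := fun j => by
    have := hord (κ i (unitVec j))
    simp only [N]; omega
  -- Subtracting `δ` brings each valuation into the range from 1 to the order of the prime class. It
  -- fixes valuations equal to 1 and has class zero; `δ` is passed on to `U₂`.
  let δ : E i × (J i → ℤ) := (0, fun j => N j * (((U₁.2 i).2 j - 1) / N j))
  have hκδ : κ i δ = 0 := by
    rw [map_zero_snd]
    refine Finset.sum_eq_zero fun j _ => ?_
    rw [mul_comm, mul_zsmul, natCast_zsmul, addOrderOf_nsmul_eq_zero, smul_zero]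
  have hδ0 : ∀ j, 0 ≤ δ.2 j := fun j =>
    mul_nonneg (hN j).1.le (Int.ediv_nonneg (by have := v₁ j; omega) (hN j).1.le)
  have hmod : ∀ j, (U₁.2 i - δ).2 j = 1 + ((U₁.2 i).2 j - 1) % N j := fun j => by
    have := Int.mul_ediv_add_emod ((U₁.2 i).2 j - 1) (N j)
    simp only [Prod.snd_sub, Pi.sub_apply, δ]; omega
  have hv₁ : Valid (U₁.2 i - δ) := fun j => by
    have := Int.emod_nonneg ((U₁.2 i).2 j - 1) (hN j).1.ne'
    rw [hmod]; omega
  have hle₁ : ∀ j, (U₁.2 i - δ).2 j ≤ d := fun j => by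
    have := Int.emod_lt_of_pos ((U₁.2 i).2 j - 1) (hN j).1
    have := (hN j).2
    rw [hmod]; omega
  obtain ⟨j₁, hj₁⟩ := h.exists_val_eq_one hU₁ l₁ i₁
  have hat := (hU₁.zeroSumFree_rest i₁).isAtomIn_sg (hU₁.1.1.rest i) (by simp) hv₁ (j := j₁)
    (by rw [hmod, hj₁]; simp) (by rw [map_add, cls_sg, map_sub, hκδ, sub_zero, cls_rest, hU₁.1.2])
  have hv₂ : Valid (U₂.2 i + δ) := fun j => by
    have := hU₂.1.1.valid i₂ j; have := hδ0 j
    simp only [Prod.snd_add, Pi.add_apply]; omega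
  have hU₂' : rest i U₂ + sg i (U₂.2 i + δ) ∈ Blk κ := by
    refine ⟨(hU₂.1.1.rest i).add (ok_sg hv₂), ?_⟩
    rw [map_add, cls_sg, map_add, hκδ, add_zero, cls_rest, hU₂.1.2]
  have e₁ := rest_add_sg i U₁
  rw [← sg_sub_add i _ δ] at e₁
  have hl₁ : IsLow κ A (k + 3) (rest i U₁ + sg i (U₁.2 i - δ)) := by
    refine h.isLow_of hU₃ l₃ hat ((Blk κ).add_mem hU₂' hC.mem) ?_
    have e₂ := rest_add_sg i U₂
    rw [sg_add]
    grind
  have hvD : Valid (Y.2 i - (U₁.2 i - δ)) := fun j => by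
    have := hYd j; have := hle₁ j
    rw [Prod.snd_sub, Pi.sub_apply]; omega
  have hYD : Y = rest i U₁ + sg i (U₁.2 i - δ) +
      (gs (U₂ + (U₃ + C)).1 + sg i (Y.2 i - (U₁.2 i - δ))) := by
    have e3 := hsY.eq
    rw [← sg_sub_add i _ (U₁.2 i - δ), hY1, hA₁, Prod.fst_add, gs_add] at e3
    rw [hsU.rest]
    grind
  have hD : gs (U₂ + (U₃ + C)).1 + sg i (Y.2 i - (U₁.2 i - δ)) ∈ Blk κ := by
    refine ⟨(ok_gs _).add (ok_sg hvD), ?_⟩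
    have := congrArg (cls κ) hYD
    rw [hY.mem.2, map_add _ (_ + _), hat.1.2, zero_add] at this
    exact this.symm
  have hlV : IsLow κ A (k + 3) V := h.isLow_of hat hl₁ hV hD (by
    rw [hAV]
    conv_lhs => rw [hYD]
    abel)
  have := h.len_le hV hlV hAV hY
  omega

end Critical
end SingleComponent

/-! ### At most one nonzero component, k = 2: restrictions on a prime of minimal valuation -/

section LengthTwo

theorem minVal_sub_unitVec_lt {E J : Type*} [AddCommGroup E] [DecidableEq J] [Fintype J]
    [Nonempty J] {a : E × (J → ℤ)} {x : J} (hx : a.2 x = minVal a) (h : 1 ≤ a.2 x) :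
    minVal (a - unitVec x) < minVal a := by
  have : minVal (a - unitVec x) ≤ minVal a - 1 := minVal_le (j := x) (by
    simp only [Prod.snd_sub, Pi.sub_apply, unitVec_self]; omega)
  omega

variable {G : Type*} [AddCommGroup G] {I : Type*} [Fintype I] [DecidableEq I]
  {E : I → Type*} [∀ i, AddCommGroup (E i)] {J : I → Type*} [∀ i, Fintype (J i)]
  [∀ i, DecidableEq (J i)] [∀ i, Nonempty (J i)]
  {κ : ∀ i, (E i × (J i → ℤ)) →+ G}

theorem rest_sub_unitVec_mem {V : Amb G E J} (hV : V ∈ Blk κ) {i : I} (hi : V.2 i ≠ 0) {x : J i}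
    (hx : 2 ≤ (V.2 i).2 x) {S : Multiset G} (hS : S.sum = κ i (unitVec x)) :
    rest i V + sg i (V.2 i - unitVec x) + gs S ∈ Blk κ := by
  refine ⟨((hV.1.rest i).add (ok_sg (valid_sub_unitVec (hV.1.valid hi) hx))).add (ok_gs _), ?_⟩
  simp only [map_add, cls_sg, map_sub, cls_gs, hS, cls_rest_of_mem hV]
  abel

/-- The prime at `x` and `g` have opposite classes, so removing both together preserves the total
class. -/
theorem exists_sub_unitVec {i : I} {x : J i} {g : G} (hg : κ i (unitVec x) + g = 0)
    {X : Amb G E J} (hX : X ∈ Blk κ) (hgX : g ∈ X.1) (hi : X.2 i ≠ 0) (hx : 2 ≤ (X.2 i).2 x) :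
    ∃ X' ∈ Blk κ, X' ≠ 0 ∧ X' + sg i (unitVec x) + gs {g} = X := by
  obtain ⟨R, hR, rfl⟩ := exists_eq_add_gs hX.1 hgX
  have hRi : (R + gs {g}).2 i = R.2 i := by simp
  rw [hRi] at hi hx
  have hv := valid_sub_unitVec (hR.valid hi) hx
  refine ⟨rest i R + sg i (R.2 i - unitVec x), ⟨(hR.rest i).add (ok_sg hv), ?_⟩, ?_, ?_⟩
  · have e1 := hX.2
    have e2 := cls_rest (κ := κ) i R
    simp only [map_add, cls_gs, Multiset.sum_singleton] at e1
    simp only [map_add, cls_sg, map_sub]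
    rw [← add_sub_assoc, e2, sub_eq_zero, eq_neg_of_add_eq_zero_left hg]
    exact eq_neg_of_add_eq_zero_left e1
  · intro h0
    exact hv.ne_zero (by simpa using comp_eq h0 i)
  · have := rest_add_sg i R
    rw [← sg_sub_add i _ (unitVec x)] at this
    grind

namespace Critical

variable {A : Amb G E J} {d : ℕ}

theorem exists_pair (h : Critical κ A 2 d) {i : I} (hs : SuppIn i A) (x : J i) :
    ∃ U₁ U₂, A = U₁ + U₂ ∧ IsAtomIn (Blk κ) U₁ ∧ IsAtomIn (Blk κ) U₂ ∧ 2 ≤ (U₁.2 i).2 x := by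
  have hlow := h.low
  obtain ⟨U₁, C₁, hU₁, hA, hC₁⟩ := hlow.exists_atom
  have hU₂ := hC₁.isAtomIn
  have hi := h.comp_ne_zero_of_isLow hs hU₁ ⟨C₁, 1, hA, hC₁, by omega⟩
  have hi' : A.2 i ≠ 0 := fun h0 => hi (comp_eq_zero_of_add hU₁.1.1 hU₂.1.1 (by rwa [← hA]))
  have h3 := h.three_le hi' x
  have e := val_eq hA i x
  simp only [Prod.snd_add, Pi.add_apply] at e
  by_cases h1 : 2 ≤ (U₁.2 i).2 x
  · exact ⟨U₁, C₁, hA, hU₁, hU₂, h1⟩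
  · exact ⟨C₁, U₁, by rw [hA, add_comm], hU₂, hU₁, by omega⟩

theorem pair_facts (h : Critical κ A 2 d) {i : I} (hs : SuppIn i A) {U₁ U₂ : Amb G E J}
    (hA : A = U₁ + U₂) (hU₁ : IsAtomIn (Blk κ) U₁) (hU₂ : IsAtomIn (Blk κ) U₂) :
    A.2 i ≠ 0 ∧ U₁.2 i ≠ 0 ∧ U₂.2 i ≠ 0 ∧ U₁.1.card ≤ 1 ∧ U₂.1.card ≤ 1 ∧
      ∃ j, (U₁.2 i).2 j = 1 := by
  have l₁ : IsLow κ A 2 U₁ := ⟨U₂, 1, hA, hU₂.lenIn, by omega⟩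
  have l₂ : IsLow κ A 2 U₂ := ⟨U₁, 1, by rw [hA, add_comm], hU₁.lenIn, by omega⟩
  have i₁ := h.comp_ne_zero_of_isLow hs hU₁ l₁
  refine ⟨fun h0 => i₁ (comp_eq_zero_of_add hU₁.1.1 hU₂.1.1 (by rwa [← hA])), i₁,
    h.comp_ne_zero_of_isLow hs hU₂ l₂, h.card_le_one hU₁ l₁, h.card_le_one hU₂ l₂,
    h.exists_val_eq_one hU₁ l₁ i₁⟩

/-- A prime of class zero could simply be removed, lowering the minimal valuation and hence the
norm. -/
theorem class_unitVec_ne_zero (h : Critical κ A 2 d) {i : I} (hs : SuppIn i A) {x : J i}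
    (hx : (A.2 i).2 x = minVal (A.2 i)) : κ i (unitVec x) ≠ 0 := by
  intro h0
  obtain ⟨U₁, U₂, hA, hU₁, hU₂, hx₁⟩ := h.exists_pair hs x
  obtain ⟨hi, i₁, i₂, -, -, j, hj⟩ := h.pair_facts hs hA hU₁ hU₂
  have h3 := h.three_le hi x
  have eA := rest_add_sg i A
  rw [← sg_sub_add i _ (unitVec x)] at eA
  have ha := valid_sub_unitVec (h.mem.1.valid hi) (x := x) (by omega)
  refine h.reduce (rest i A + sg i (A.2 i - unitVec x)) ?_ ⟨2, le_rfl, ?_⟩ ?_ ?_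
  · refine norm_lt_of i (fun i' hi' => by simp [rest_snd_of_ne hi', sg_snd_of_ne hi']) ?_
    have := minVal_sub_unitVec_lt hx (by omega)
    simp; omega
  · have hat := (hU₁.zeroSumFree_rest i₁).isAtomIn_sg (hU₁.1.1.rest i) (by simp)
      (valid_sub_unitVec (hU₁.1.1.valid i₁) hx₁) (j := j) (by
        rw [Prod.snd_sub, Pi.sub_apply, unitVec_of_ne (by rintro rfl; omega)]; omega) (by
        rw [map_add, cls_sg, map_sub, h0, sub_zero, cls_rest, hU₁.1.2])
    have := hat.lenIn.add hU₂.lenIn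
    convert this using 1
    have e1 := rest_add_sg i U₁
    rw [← sg_sub_add i _ (unitVec x)] at e1
    grind
  · obtain ⟨V, Y, n, hAV, hV, hV2, hY, hn⟩ := h.exists_cover_two hi
    have hVi : V.2 i ≠ 0 := fun h0 => by have := hV2 x; rw [h0] at this; simp at this
    have hV' := rest_sub_unitVec_mem hV hVi (hV2 x) (S := 0) (by simp [h0])
    rw [gs_zero, add_zero] at hV'
    obtain ⟨m, hm, hl⟩ := exists_lenIn_ge hV' (fun h0 => by
      have := comp_eq h0 i
      exact (valid_sub_unitVec (hV.1.valid hVi) (hV2 x)).ne_zero (by simpa using this)) hY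
    refine ⟨m, by omega, ?_⟩
    convert hl using 1
    have e1 := rest_add_sg i V
    rw [← sg_sub_add i _ (unitVec x)] at e1
    grind
  · intro m _ _ hm
    obtain ⟨W, Y, n, rfl, hW, hWi, hAW, hY⟩ := hm.exists_atom_comp (i := i) (by
      simpa using ha.ne_zero)
    have hv : Valid (W.2 i + unitVec x) := fun j => by
      have := hW.1.1.valid hWi j
      simp only [Prod.snd_add, Pi.add_apply]
      by_cases hj : j = x
      · subst hj; rw [unitVec_self]; omega
      · rw [unitVec_of_ne hj]; omega
    have e1 := rest_add_sg i W
    have eT : W + sg i (unitVec x) = rest i W + sg i (W.2 i + unitVec x) := by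
      rw [sg_add]
      grind
    refine lift_of_le_two (R := W + sg i (unitVec x)) ?_ ?_ hY (fun t ht =>
      hW.len_le_two hWi h0 (unitVec_le_one x) ht) (by grind)
    · refine ⟨by rw [eT]; exact (hW.1.1.rest i).add (ok_sg hv), ?_⟩
      rw [map_add, cls_sg, h0, add_zero, hW.1.2]
    · rw [eT]; intro h0
      exact hv.ne_zero (by simpa using comp_eq h0 i)

/-- Otherwise the prime at `x` could be removed together with the group element cancelling its
class. -/
theorem neg_class_notMem (h : Critical κ A 2 d)
    (hord : ∀ g : G, 0 < addOrderOf g ∧ addOrderOf g ≤ d) {i : I} (hs : SuppIn i A) {x : J i}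
    (hx : (A.2 i).2 x = minVal (A.2 i)) {U₁ U₂ : Amb G E J} (hA : A = U₁ + U₂)
    (hU₁ : IsAtomIn (Blk κ) U₁) (hU₂ : IsAtomIn (Blk κ) U₂) (hx₁ : 2 ≤ (U₁.2 i).2 x) :
    -κ i (unitVec x) ∉ U₁.1 := by
  intro hg₁
  obtain ⟨hi, i₁, i₂, c₁, c₂, j, hj⟩ := h.pair_facts hs hA hU₁ hU₂
  have h3 := h.three_le hi x
  have hd := h.two_le
  obtain ⟨g, hg⟩ : ∃ g, g = -κ i (unitVec x) := ⟨_, rfl⟩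
  rw [← hg] at hg₁
  have hκ : κ i (unitVec x) + g = 0 := by rw [hg, add_neg_cancel]
  have hU1g : U₁.1 = {g} := by
    obtain ⟨S, hS⟩ := Multiset.exists_cons_of_mem hg₁
    rw [hS, Multiset.card_cons] at c₁
    rw [hS, Multiset.card_eq_zero.1 (by omega : S.card = 0)]; rfl
  have hz := h.zero_notMem
  have hg0 : g ≠ 0 := fun h0 => hz (by rw [hA, ← h0]; simp [hU1g])
  have hfree : ZeroSumFree κ (gs {g} : Amb G E J) := zeroSumFree_gs_singleton hg0
  have hs₁ : SuppIn i U₁ := SuppIn.of_add (by rwa [← hA]) hU₁.1.1 hU₂.1.1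
  have hs₂ : SuppIn i U₂ := SuppIn.of_add_right (by rwa [← hA]) hU₁.1.1 hU₂.1.1
  have e₁ := hs₁.eq
  rw [hU1g] at e₁
  have hv₁ := valid_sub_unitVec (hU₁.1.1.valid i₁) hx₁
  have hA' : (sg i (U₁.2 i - unitVec x) + U₂) + sg i (unitVec x) + gs {g} = A := by
    rw [← sg_sub_add i _ (unitVec x)] at e₁
    grind
  have hκu : κ i (U₁.2 i) + g = 0 := by
    have := hU₁.1.2
    rw [← e₁, map_add, cls_gs, cls_sg, Multiset.sum_singleton] at this
    rw [← this, add_comm]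
  have hat : IsAtomIn (Blk κ) (sg i (U₁.2 i - unitVec x) : Amb G E J) :=
    isAtomIn_sg hv₁ (j := j) (by
      rw [Prod.snd_sub, Pi.sub_apply, unitVec_of_ne (by rintro rfl; omega)]; omega) (by
      rw [map_sub, eq_neg_of_add_eq_zero_left hκu, eq_neg_of_add_eq_zero_left hκ, sub_self])
  have hfst : (sg i (U₁.2 i - unitVec x) + U₂).1 = U₂.1 := by simp
  have hAfst : A.1 = {g} + U₂.1 := by rw [hA, Prod.fst_add, hU1g]
  refine h.reduce (sg i (U₁.2 i - unitVec x) + U₂) ?_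
    ⟨2, le_rfl, hat.lenIn.add hU₂.lenIn⟩ ?_ ?_
  · refine norm_lt_of i (fun i' hi' => ?_) ?_
    · rw [← hA']; simp [sg_snd_of_ne hi']
    · have e : (sg i (U₁.2 i - unitVec x) + U₂).2 i = A.2 i - unitVec x := by
        have := comp_eq hA' i
        rw [← this]; simp
      rw [e, hfst, hAfst]
      have := minVal_sub_unitVec_lt hx (by omega)
      simp; omega
  · have key : ∀ V Y n, A = V + Y → V ∈ Blk κ → g ∈ V.1 → V.2 i ≠ 0 → 2 ≤ (V.2 i).2 x →
        LenIn (Blk κ) Y n → d ≤ n → ∃ m, 2 + d ≤ m + 1 ∧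
        LenIn (Blk κ) (sg i (U₁.2 i - unitVec x) + U₂) m := by
      intro V Y n hAV hV hgV hVi hVx hY hn
      obtain ⟨V', hV', h0, hVV⟩ := exists_sub_unitVec hκ hV hgV hVi hVx
      obtain ⟨m, hm, hl⟩ := exists_lenIn_ge hV' h0 hY
      refine ⟨m, by omega, ?_⟩
      convert hl using 1
      rw [hAV] at hA'
      grind
    obtain ⟨V₁, Y₁, n₁, hn₁, hV₁, hgV, hA₁, hY₁⟩ := h.high.exists_atom_mem (g := g)
      (by rw [hAfst]; simp)
    have eA₁ := val_eq hA₁ i x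
    simp only [Prod.snd_add, Pi.add_apply] at eA₁
    -- If the atom with `g` avoids component `i`, it uses up both group elements of `A` and equals
    -- `g g'`. All other atoms lie in component `i`, and the only difficulty is that all have
    -- valuation 1 at `x`.
    by_cases v₁ : V₁.2 i = 0
    · have hsV : SuppIn i V₁ := SuppIn.of_add (by rwa [← hA₁]) hV₁.1.1 hY₁.mem.1
      have hsY : SuppIn i Y₁ := SuppIn.of_add_right (by rwa [← hA₁]) hV₁.1.1 hY₁.mem.1
      have hc2 := hsV.two_le_card hV₁.1 hV₁.2.1 v₁ (fun h' => hz (by rw [hA₁]; simp [h']))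
      have hcA := h.card_le
      have hfA : A.1 = V₁.1 + Y₁.1 := by rw [hA₁]; rfl
      have hY₁0 : Y₁.1 = 0 := by
        rw [hfA, Multiset.card_add] at hcA
        exact Multiset.card_eq_zero.1 (by omega)
      rw [hY₁0, add_zero] at hfA
      have eV := hsV.eq
      rw [v₁, sg_zero, add_zero] at eV
      obtain ⟨g', hg'⟩ : ∃ g', V₁.1 = {g} + {g'} := by
        have hcU : U₂.1.card = 1 := by
          have := congrArg Multiset.card (hfA.symm.trans hAfst)
          simp at this; omega
        obtain ⟨g', hg'⟩ := Multiset.card_eq_one.1 hcU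
        exact ⟨g', by rw [← hfA, hAfst, hg']⟩
      have hgg : g + g' = 0 := by
        have := hV₁.1.2
        rw [← eV, cls_gs, hg'] at this
        simpa using this
      have pure : ∀ V Y, Y₁ = V + Y → IsAtomIn (Blk κ) V → Ok Y →
          (∀ n, LenIn (Blk κ) Y n → n + 1 = d + 1 → 2 ≤ (V.2 i).2 x → ∃ m, 2 + d ≤ m + 1 ∧
            LenIn (Blk κ) (sg i (U₁.2 i - unitVec x) + U₂) m) ∧ V.2 i ≠ 0 ∧
            V = sg i (V.2 i) ∧ SuppIn i Y ∧ Y.1 = 0 := by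
        intro V Y hVY hV hY
        have f0 : V.1 + Y.1 = 0 := by rw [← hY₁0, hVY]; rfl
        have s1 : SuppIn i V := SuppIn.of_add (by rwa [← hVY]) hV.1.1 hY
        have hVi := s1.comp_ne_zero hV.2.1 (add_eq_zero.1 f0).1
        refine ⟨fun n hn hnd h2 => ?_, hVi, ?_, SuppIn.of_add_right (by rwa [← hVY]) hV.1.1 hY,
          (add_eq_zero.1 f0).2⟩
        · refine key (V₁ + V) Y n (by rw [hA₁, hVY]; abel) ((Blk κ).add_mem hV₁.1 hV.1)
            (by simp [hgV]) ?_ ?_ hn (by omega)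
          · simpa [v₁] using hVi
          · simpa [v₁] using h2
        · have := s1.eq
          rw [(add_eq_zero.1 f0).1, gs_zero, zero_add] at this
          exact this.symm
      obtain rfl : n₁ = d + 1 := by omega
      obtain ⟨d, rfl⟩ : ∃ d', d = d' + 2 := ⟨d - 2, by omega⟩
      obtain ⟨V₂, Y₂, hV₂, hYY₂, hY₂⟩ := hY₁.exists_atom
      obtain ⟨V₃, Y₃, hV₃, hYY₃, hY₃⟩ := hY₂.exists_atom
      obtain ⟨V₄, Y₄, hV₄, hYY₄, hY₄⟩ := hY₃.exists_atom
      obtain ⟨p₂, q₂, r₂, -, -⟩ := pure V₂ Y₂ hYY₂ hV₂ hY₂.mem.1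
      obtain ⟨p₃, q₃, r₃, -, -⟩ := pure V₃ (V₂ + Y₃) (by rw [hYY₂, hYY₃]; abel) hV₃
        (hV₂.1.1.add hY₃.mem.1)
      obtain ⟨p₄, q₄, r₄, -, -⟩ := pure V₄ (V₂ + V₃ + Y₄) (by rw [hYY₂, hYY₃, hYY₄]; abel) hV₄
        ((hV₂.1.1.add hV₃.1.1).add hY₄.mem.1)
      by_cases t₂ : 2 ≤ (V₂.2 i).2 x
      · exact p₂ _ hY₂ (by omega) t₂
      by_cases t₃ : 2 ≤ (V₃.2 i).2 x
      · exact p₃ _ (LenIn.atom_add hV₂ hY₃) (by omega) t₃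
      by_cases t₄ : 2 ≤ (V₄.2 i).2 x
      · exact p₄ _ ((hV₂.lenIn.add hV₃.lenIn).add hY₄) (by omega) t₄
      exfalso
      have w₂ := hV₂.1.1.valid q₂
      have w₃ := hV₃.1.1.valid q₃
      have w₄ := hV₄.1.1.valid q₄
      have w₂x := w₂ x
      have w₃x := w₃ x
      have w₄x := w₄ x
      have hA₄ : A = gs {g} + gs {g'} + (sg i (V₂.2 i) + (sg i (V₃.2 i) + (sg i (V₄.2 i) + Y₄))) := by
        rw [hA₁, ← eV, hg', gs_add, hYY₂, hYY₃, hYY₄, ← r₂, ← r₃, ← r₄]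
      -- The variable `d` now denotes the former gap size minus 2. If it is 0, all orders are at
      -- most 2 and `A` has valuation 3 at `x`, the case excluded by parity.
      rcases Nat.eq_zero_or_pos d with hd0 | hd0
      · subst hd0
        have h2 : ∀ g : G, 2 • g = 0 := fun g => by
          have h1 := hord g
          rw [show (2 : ℕ) = 0 + 2 from rfl] at h1
          have : addOrderOf g ∣ 2 := by
            obtain ⟨h1, h2⟩ := h1
            have : addOrderOf g = 1 ∨ addOrderOf g = 2 := by omega
            rcases this with h | h <;> rw [h]; exact one_dvd 2
          exact addOrderOf_dvd_iff_nsmul_eq_zero.1 this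
        refine h.false_of_val_eq_three h2 hA hU₁ hU₂ i₁ i₂ (z := x) ?_
        rw [hA₄, hY₄.eq_zero_of_zero]
        simp only [Prod.snd_add, Pi.add_apply, gs_snd, Prod.snd_zero, Pi.zero_apply, sg_snd_self]
        omega
      · have hk₂ : κ i (V₂.2 i) = 0 := by have := hV₂.1.2; rwa [r₂, cls_sg] at this
        have hk₃ : κ i (V₃.2 i) = 0 := by have := hV₃.1.2; rwa [r₃, cls_sg] at this
        have hk₄ : κ i (V₄.2 i) = 0 := by have := hV₄.1.2; rwa [r₄, cls_sg] at this
        have hv₂ : Valid (V₂.2 i + unitVec x) := fun j => by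
          have := w₂ j
          simp only [Prod.snd_add, Pi.add_apply]
          by_cases hj : j = x
          · subst hj; rw [unitVec_self]; omega
          · rw [unitVec_of_ne hj]; omega
        have hv₃ : Valid (V₃.2 i + V₄.2 i - unitVec x) := valid_sub_unitVec (w₃.add w₄) (by
          simp only [Prod.snd_add, Pi.add_apply]; omega)
        have hg'0 : g' ≠ 0 := fun h0 => hz (by rw [hfA, hg', h0]; simp)
        -- Regrouping `g g'` and three atoms by moving one prime at `x` from `V₃ + V₄` to `V₂`: the
        -- part with `g'` is an atom, the part with `g` has at most two factors, so `A` gets a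
        -- length in its gap.
        have hat₂ := (zeroSumFree_gs_singleton (κ := κ) (E := E) (J := J) hg'0).isAtomIn_sg
          (ok_gs _) (i := i) (by simp) hv₃ (j := x) (by
            simp only [Prod.snd_sub, Prod.snd_add, Pi.sub_apply, Pi.add_apply, unitVec_self]
            omega) (by
            rw [map_add, cls_gs, cls_sg, map_sub, map_add, hk₃, hk₄, Multiset.sum_singleton,
              eq_neg_of_add_eq_zero_left hκ, ← eq_neg_of_add_eq_zero_right hgg]
            abel)
        have hmem : gs {g} + sg i (V₂.2 i + unitVec x) ∈ Blk κ := by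
          refine ⟨(ok_gs _).add (ok_sg hv₂), ?_⟩
          rw [map_add, cls_gs, cls_sg, map_add, hk₂, Multiset.sum_singleton, zero_add, add_comm,
            hκ]
        have hlift := lift_of_le_two (A := A) hmem (fun h0 => hv₂.ne_zero (by
            simpa using comp_eq h0 i)) (LenIn.atom_add hat₂ hY₄) (fun t ht => by
            have := hfree.lenIn_le (by simp) ht x
            simp only [Prod.snd_add, Pi.add_apply, unitVec_self] at this
            omega) (by
            have := sg_sub_add (G := G) i (V₃.2 i + V₄.2 i) (unitVec x)
            rw [sg_add i (V₃.2 i)] at this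
            rw [hA₄, sg_add]
            grind)
        rcases hlift with hl | hl
        · exact h.no_gap hl (by omega) (by omega)
        · exact h.no_gap hl (by omega) (by omega)
    · by_cases hV₁x : 2 ≤ (V₁.2 i).2 x
      · exact key V₁ Y₁ n₁ hA₁ hV₁.1 hgV v₁ hV₁x hY₁ (by omega)
      · have hYi : Y₁.2 i ≠ 0 := fun h0 => by rw [h0] at eA₁; simp at eA₁; omega
        obtain ⟨V₂, Y₂, n₂, rfl, hV₂, v₂, rfl, hY₂⟩ := hY₁.exists_atom_comp hYi
        have := hV₁.1.1.valid v₁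
        have h2 := hV₂.1.1.valid v₂
        refine key (V₁ + V₂) Y₂ n₂ (by rw [hA₁]; abel) ((Blk κ).add_mem hV₁.1 hV₂.1)
          (by simp [hgV]) (this.add h2).ne_zero ?_ hY₂ (by omega)
        have := this x
        have := h2 x
        simp only [Prod.snd_add, Pi.add_apply]; omega
  · intro m hm2 _ hm
    obtain ⟨W, Y, n, rfl, hW, hW0, hAW, hY⟩ := hm.exists_atom_fst_zero (by rw [hfst]; omega)
    have hsW : SuppIn i W := SuppIn.of_add (by rw [← hAW]; exact (suppIn_sg i _).add hs₂)
      hW.1.1 hY.mem.1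
    have hWi := hsW.comp_ne_zero hW.2.1 hW0
    have eW := hsW.eq
    rw [hW0, gs_zero, zero_add] at eW
    have hκw : κ i (W.2 i) = 0 := by have := hW.1.2; rwa [← eW, cls_sg] at this
    have hv : Valid (W.2 i + unitVec x) := fun j => by
      have := hW.1.1.valid hWi j
      simp only [Prod.snd_add, Pi.add_apply]
      by_cases hj : j = x
      · subst hj; rw [unitVec_self]; omega
      · rw [unitVec_of_ne hj]; omega
    have hT : gs {g} + sg i (W.2 i + unitVec x) = W + sg i (unitVec x) + gs {g} := by
      rw [sg_add, eW]; abel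
    refine lift_of_le_two (R := gs {g} + sg i (W.2 i + unitVec x))
      ⟨(ok_gs _).add (ok_sg hv), ?_⟩ (fun h0 => hv.ne_zero (by simpa using comp_eq h0 i)) hY
      (fun t ht => ?_) (by grind)
    · rw [map_add, cls_gs, cls_sg, map_add, hκw, Multiset.sum_singleton, zero_add, add_comm, hκ]
    · by_contra hcon
      obtain ⟨t, rfl⟩ : ∃ t', t = t' + 3 := ⟨t - 3, by omega⟩
      obtain ⟨X₁, X₂, Z, hXZ, hX₁, hX₂, hZ, y₁, y₂, y₃⟩ := hfree.exists_three (by simp) ht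
      -- One of three factors does not contain `g`. The other two together have room for the prime
      -- at `x`, and removing it with `g` would split the atom `W`.
      have key : ∀ P Q, P ∈ Blk κ → Q ∈ Blk κ → P + Q = X₁ + X₂ + Z → Q.1 = 0 → Q.2 i ≠ 0 →
          P.2 i ≠ 0 → 2 ≤ (P.2 i).2 x → False := by
        intro P Q hP hQ hPQ hQ0 hQi hPi hPx
        rw [← hXZ] at hPQ
        have hgP : g ∈ P.1 := by
          have := congrArg Prod.fst hPQ
          simp [hQ0] at this
          simp [this]
        obtain ⟨P', hP', hP0, hPP⟩ := exists_sub_unitVec hκ hP hgP hPi hPx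
        rcases hW.2.2 P' hP' Q hQ (by grind) with h0 | h0
        · exact hP0 h0
        · exact hQi (by rw [h0]; rfl)
      have f := congrArg (fun X => X.1.card) hXZ
      simp at f
      have a₁ := hX₁.1.valid y₁
      have a₂ := hX₂.1.valid y₂
      have a₃ := hZ.1.valid y₃
      by_cases hZ0 : Z.1 = 0
      · refine key (X₁ + X₂) Z ((Blk κ).add_mem hX₁ hX₂) hZ rfl hZ0 y₃ (a₁.add a₂).ne_zero ?_
        have := a₁ x
        have := a₂ x
        simp only [Prod.snd_add, Pi.add_apply]; omega
      · have := Multiset.card_pos.2 hZ0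
        refine key (X₂ + Z) X₁ ((Blk κ).add_mem hX₂ hZ) hX₁ (by abel)
          (Multiset.card_eq_zero.1 (by omega)) y₁ (a₂.add a₃).ne_zero ?_
        have := a₂ x
        have := a₃ x
        simp only [Prod.snd_add, Pi.add_apply]; omega

end Critical
end LengthTwo

/-! ### At most one nonzero component: the final contradiction -/

section SingleComponentFinal

variable {G : Type*} [AddCommGroup G] {I : Type*} [Fintype I] [DecidableEq I]
  {E : I → Type*} [∀ i, AddCommGroup (E i)] {J : I → Type*} [∀ i, Fintype (J i)]
  [∀ i, DecidableEq (J i)] [∀ i, Nonempty (J i)]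
  {κ : ∀ i, (E i × (J i → ℤ)) →+ G}

namespace Critical

variable {A : Amb G E J} {k d : ℕ}

theorem two_le_len (h : Critical κ A k d) : 2 ≤ k := by
  have hd := h.two_le
  by_contra hcon
  rcases Nat.eq_zero_or_pos k with h0 | h0
  · subst h0
    have := h.high.eq_zero_of_eq_zero h.low.eq_zero_of_zero
    omega
  · obtain rfl : k = 1 := by omega
    have := h.low.isAtomIn.lenIn_eq_one blk_reduced h.high
    omega

theorem gs_add_rest_free (h : Critical κ A 2 d) {i : I} (hs : SuppIn i A) {x : J i}
    (hη : κ i (unitVec x) ≠ 0)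
    (hneg : ∀ U₁ U₂, A = U₁ + U₂ → IsAtomIn (Blk κ) U₁ → IsAtomIn (Blk κ) U₂ →
      2 ≤ (U₁.2 i).2 x → -κ i (unitVec x) ∉ U₁.1) {U₁ U₂ : Amb G E J} (hA : A = U₁ + U₂)
    (hU₁ : IsAtomIn (Blk κ) U₁) (hU₂ : IsAtomIn (Blk κ) U₂) (hx₁ : 2 ≤ (U₁.2 i).2 x) :
    ZeroSumFree κ (gs {κ i (unitVec x)} + gs U₁.1 : Amb G E J) := by
  obtain ⟨hi, i₁, i₂, c₁, c₂, j, hj⟩ := h.pair_facts hs hA hU₁ hU₂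
  rcases Nat.eq_zero_or_pos U₁.1.card with h0 | h0
  · rw [Multiset.card_eq_zero.1 h0, gs_zero, add_zero]
    exact zeroSumFree_gs_singleton hη
  · obtain ⟨g, hg⟩ := Multiset.card_eq_one.1 (by omega : U₁.1.card = 1)
    rw [hg, ← gs_add]
    refine zeroSumFree_gs_pair hη ?_ ?_
    · rintro rfl
      exact h.zero_notMem (by rw [hA]; simp [hg])
    · intro h0
      apply hneg U₁ U₂ hA hU₁ hU₂ hx₁
      rw [hg, ← eq_neg_of_add_eq_zero_right h0]; simp

/-- Reduction replacing one prime at `x` by its class; `hneg` keeps the altered low atom an atom. -/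
theorem false_of_notMem (h : Critical κ A 2 d) {i : I} (hs : SuppIn i A) {x : J i}
    (hx : (A.2 i).2 x = minVal (A.2 i)) (hη : κ i (unitVec x) ≠ 0)
    (hneg : ∀ U₁ U₂, A = U₁ + U₂ → IsAtomIn (Blk κ) U₁ → IsAtomIn (Blk κ) U₂ →
      2 ≤ (U₁.2 i).2 x → -κ i (unitVec x) ∉ U₁.1) : False := by
  obtain ⟨U₁, U₂, hA, hU₁, hU₂, hx₁⟩ := h.exists_pair hs x
  obtain ⟨hi, i₁, i₂, c₁, c₂, j, hj⟩ := h.pair_facts hs hA hU₁ hU₂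
  have h3 := h.three_le hi x
  have hz := h.zero_notMem
  have hcA := h.card_le
  have eA := rest_add_sg i A
  rw [← sg_sub_add i _ (unitVec x)] at eA
  have ha := valid_sub_unitVec (h.mem.1.valid hi) (x := x) (by omega)
  have hs₁ : SuppIn i U₁ := SuppIn.of_add (by rwa [← hA]) hU₁.1.1 hU₂.1.1
  refine h.reduce (rest i A + sg i (A.2 i - unitVec x) + gs {κ i (unitVec x)}) ?_
    ⟨2, le_rfl, ?_⟩ ?_ ?_
  · refine norm_lt_of i (fun i' hi' => by simp [rest_snd_of_ne hi', sg_snd_of_ne hi']) ?_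
    have := minVal_sub_unitVec_lt hx (by omega)
    simp; omega
  · have hfree := h.gs_add_rest_free hs hη hneg hA hU₁ hU₂ hx₁
    have e₁ := hs₁.eq
    rw [← sg_sub_add i _ (unitVec x)] at e₁
    have hat := hfree.isAtomIn_sg ((ok_gs _).add (ok_gs _)) (by simp)
      (valid_sub_unitVec (hU₁.1.1.valid i₁) hx₁) (j := j) (by
        rw [Prod.snd_sub, Pi.sub_apply, unitVec_of_ne (by rintro rfl; omega)]; omega) (by
        have := hU₁.1.2
        rw [← e₁] at this
        simp only [map_add, cls_gs, cls_sg, map_sub, Multiset.sum_singleton] at this ⊢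
        rw [← this]; abel)
    have := hat.lenIn.add hU₂.lenIn
    convert this using 1
    grind
  · obtain ⟨V, Y, n, hAV, hV, hV2, hY, hn⟩ := h.exists_cover_two hi
    have hVi : V.2 i ≠ 0 := fun h0 => by have := hV2 x; rw [h0] at this; simp at this
    have hV' := rest_sub_unitVec_mem hV hVi (hV2 x) (S := {κ i (unitVec x)}) (by simp)
    obtain ⟨m, hm, hl⟩ := exists_lenIn_ge hV' (fun h0 => by
      simpa using congrArg Prod.fst h0) hY
    refine ⟨m, by omega, ?_⟩
    convert hl using 1
    have e1 := rest_add_sg i V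
    rw [← sg_sub_add i _ (unitVec x)] at e1
    grind
  · intro m hm2 hmd hm
    obtain ⟨W₁, Y, n, rfl, hW₁, hg, hAW, hY⟩ := hm.exists_atom_mem (g := κ i (unitVec x)) (by simp)
    obtain ⟨R, hR, rfl⟩ := exists_eq_add_gs hW₁.1.1 hg
    have hfree := hW₁.zeroSumFree (ok_gs _) (gs_singleton_ne_zero _)
    have hAR : A = R + sg i (unitVec x) + Y := by grind
    have hclR : cls κ R + κ i (unitVec x) = 0 := by simpa using hW₁.1.2
    have hRY : SuppIn i (R + Y) := by
      have e : R + Y = rest i A + sg i (A.2 i - unitVec x) := by grind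
      rw [e, hs.rest]
      exact (suppIn_gs i _).add (suppIn_sg i _)
    have hsR := hRY.of_add hR hY.mem.1
    have hsY := hRY.of_add_right hR hY.mem.1
    have hfst : A.1 = R.1 + Y.1 := by rw [hAR]; simp
    -- If `R` is a pure sequence over `G`, adding the prime alone need not give an element of the
    -- monoid. Hence another atom `W₂`, chosen to contain all remaining group elements, is merged
    -- with it.
    by_cases hRi : R.2 i = 0
    · have eR := hsR.eq
      rw [hRi, sg_zero, add_zero] at eR
      have hR0 : R.1 ≠ 0 := by
        intro h0
        rw [← eR, h0, gs_zero, map_zero, zero_add] at hclR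
        exact hη hclR
      have hRc := Multiset.card_pos.2 hR0
      have hYc : Y.1.card ≤ 1 := by
        rw [hfst, Multiset.card_add] at hcA; omega
      have hYi : Y.2 i ≠ 0 := by
        intro h0
        have := val_eq hAR i x
        simp only [Prod.snd_add, Pi.add_apply, hRi, h0, sg_snd_self, unitVec_self,
          Prod.snd_zero, Pi.zero_apply] at this
        omega
      obtain ⟨W₂, Y₂, n₂, rfl, hW₂, hW₂i, rfl, hY₂, hYf⟩ : ∃ W Y' n', n = n' + 1 ∧
          IsAtomIn (Blk κ) W ∧ W.2 i ≠ 0 ∧ Y = W + Y' ∧ LenIn (Blk κ) Y' n' ∧ Y'.1 = 0 := by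
        rcases Nat.eq_zero_or_pos Y.1.card with h0 | h0
        · obtain ⟨W, Y', n', e1, e2, e3, rfl, e4⟩ := hY.exists_atom_comp hYi
          exact ⟨W, Y', n', e1, e2, e3, rfl, e4, (add_eq_zero.1 (Multiset.card_eq_zero.1 h0)).2⟩
        · obtain ⟨s, hs'⟩ := Multiset.card_eq_one.1 (by omega : Y.1.card = 1)
          obtain ⟨W, Y', n', e1, e2, e3, rfl, e4⟩ := hY.exists_atom_mem (g := s) (by simp [hs'])
          have hc : W.1.card + Y'.1.card = 1 := by
            have := congrArg Multiset.card hs'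
            simpa using this
          have := Multiset.card_pos_iff_exists_mem.2 ⟨s, e3⟩
          refine ⟨W, Y', n', e1, e2, fun h0 => ?_, rfl, e4,
            Multiset.card_eq_zero.1 (by omega)⟩
          have := (hsY.of_add e2.1.1 e4.mem.1).two_le_card e2.1 e2.2.1 h0
            (fun h' => hz (by rw [hfst]; simp [h']))
          omega
      have hsW₂ := hsY.of_add hW₂.1.1 hY₂.mem.1
      have eW₂ := hsW₂.eq
      have hv : Valid (W₂.2 i + unitVec x) := fun j => by
        have := hW₂.1.1.valid hW₂i j
        simp only [Prod.snd_add, Pi.add_apply]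
        by_cases hj : j = x
        · subst hj; rw [unitVec_self]; omega
        · rw [unitVec_of_ne hj]; omega
      have hfst' : A.1 = R.1 + W₂.1 := by rw [hfst, Prod.fst_add, hYf, add_zero]
      obtain ⟨T, hT⟩ : ∃ T : Amb G E J, T = gs A.1 + sg i (W₂.2 i + unitVec x) := ⟨_, rfl⟩
      have hTf : T.1 = A.1 := by rw [hT]; simp
      have hTi : T.2 i = W₂.2 i + unitVec x := by rw [hT]; simp
      have hTW : T = R + W₂ + sg i (unitVec x) := by
        rw [hT, hfst', gs_add, sg_add]
        grind
      have hAT : A = T + Y₂ := by rw [hAR, hTW]; abel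
      have hTs : SuppIn i T := by rw [hT]; exact (suppIn_gs i _).add (suppIn_sg i _)
      have hTm : T ∈ Blk κ := by
        refine ⟨by rw [hT]; exact (ok_gs _).add (ok_sg hv), ?_⟩
        have := h.mem.2
        rwa [hAT, map_add, hY₂.mem.2, add_zero] at this
      have hT0 : T ≠ 0 := fun h0 => hv.ne_zero (by rw [← hTi, h0]; rfl)
      obtain ⟨t, ht⟩ := blk_exists_lenIn_pos hTm hT0
      have hlen := ht.add hY₂
      rw [← hAT] at hlen
      -- Two or three factors lift to m or m + 1. One factor gives length m - 1, which lies in the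
      -- gap unless it is 2; then `T` is an atom of a pair and contains the element excluded by
      -- `hneg`.
      obtain h0 | h0 | h0 | h0 : t = 0 ∨ t = 1 ∨ t = 2 ∨ 3 ≤ t := by omega
      · subst h0
        exfalso
        rcases Nat.lt_or_ge 1 n₂ with h1 | h1
        · exact h.no_gap hlen (by omega) (by omega)
        · obtain rfl : n₂ = 1 := by omega
          have hTa := LenIn.isAtomIn ht
          have hYa := hY₂.isAtomIn
          obtain ⟨-, -, -, c, -⟩ := h.pair_facts hs hAT hTa hYa
          rw [hTf, hfst', Multiset.card_add] at c
          refine hneg T Y₂ hAT hTa hYa ?_ ?_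
          · rw [hTi]
            have := hW₂.1.1.valid hW₂i x
            simp only [Prod.snd_add, Pi.add_apply, unitVec_self]; omega
          · obtain ⟨g, hg⟩ := Multiset.card_eq_one.1 (by omega : R.1.card = 1)
            rw [← eR, hg, cls_gs, Multiset.sum_singleton] at hclR
            rw [hTf, hfst', hg, ← eq_neg_of_add_eq_zero_left hclR]; simp
      · left; subst h0; convert hlen using 1; omega
      · right; subst h0; convert hlen using 1; omega
      · exfalso
        -- With at least four factors and at most two group elements, two factors are pure. The
        -- prime at `x` can be taken from the part other than `Xa`, so `Xa` would split the atom
        -- `W₂`.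
        obtain ⟨Xa, Z, t₁, ht₁, hXa, hXa0, hTX, hZ⟩ := ht.exists_atom_fst_zero (by
          rw [hTf]; omega)
        have hZf : Z.1 = A.1 := by rw [← hTf, hTX]; simp [hXa0]
        obtain ⟨Xb, Z', t₂, ht₂, hXb, hXb0, rfl, hZ'⟩ := hZ.exists_atom_fst_zero (by
          rw [hZf]; omega)
        have hsXa : SuppIn i Xa := SuppIn.of_add (by rwa [← hTX]) hXa.1.1 hZ.mem.1
        have hsZ : SuppIn i (Xb + Z') := SuppIn.of_add_right (by rwa [← hTX]) hXa.1.1 hZ.mem.1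
        have hsXb := hsZ.of_add hXb.1.1 hZ'.mem.1
        have hsZ' := hsZ.of_add_right hXb.1.1 hZ'.mem.1
        have ib := hsXb.comp_ne_zero hXb.2.1 hXb0
        have hZf' : Z'.1 = A.1 := by rw [← hZf]; simp [hXb0]
        have hZi' : Z'.2 i ≠ 0 := by
          intro h0
          have := hsZ'.two_mul_len_le hZ' (by rw [hZf']; exact hz) x
          rw [h0, hZf'] at this
          simp at this
          omega
        have vZ := (hXb.1.1.valid ib).add (hZ'.mem.1.valid hZi')
        have vZx : 2 ≤ (Xb.2 i + Z'.2 i).2 x := by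
          have := hXb.1.1.valid ib x
          have := hZ'.mem.1.valid hZi' x
          simp only [Prod.snd_add, Pi.add_apply]; omega
        have hv' := valid_sub_unitVec vZ vZx
        have eZ := hsZ.eq
        rw [hZf, Prod.snd_add, Pi.add_apply, ← sg_sub_add i _ (unitVec x), hfst', gs_add, eR] at eZ
        have e : Xa + (gs W₂.1 + sg i (Xb.2 i + Z'.2 i - unitVec x)) = W₂ := by
          rw [hTW] at hTX
          grind
        have hQ : gs W₂.1 + sg i (Xb.2 i + Z'.2 i - unitVec x) ∈ Blk κ := by
          refine ⟨(ok_gs _).add (ok_sg hv'), ?_⟩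
          have := hW₂.1.2
          rwa [← e, map_add, hXa.1.2, zero_add] at this
        rcases hW₂.2.2 _ hXa.1 _ hQ e with h0 | h0
        · exact hXa.2.1 h0
        · exact hv'.ne_zero (by simpa using comp_eq h0 i)
    · have hv : Valid (R.2 i + unitVec x) := fun j => by
        have := hR.valid hRi j
        simp only [Prod.snd_add, Pi.add_apply]
        by_cases hj : j = x
        · subst hj; rw [unitVec_self]; omega
        · rw [unitVec_of_ne hj]; omega
      have eT : R + sg i (unitVec x) = rest i R + sg i (R.2 i + unitVec x) := by
        have := rest_add_sg i R
        rw [sg_add]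
        grind
      refine lift_of_le_two (R := R + sg i (unitVec x)) ⟨?_, by rw [map_add, cls_sg, hclR]⟩ ?_ hY
        (fun t ht => hfree.len_le_two hR (unitVec_le_one x) ht) hAR
      · rw [eT]; exact (hR.rest i).add (ok_sg hv)
      · rw [eT]; intro h0
        exact hv.ne_zero (by simpa using comp_eq h0 i)

/-- There is no critical element with at most one nonzero component. -/
theorem false_of_suppIn (h : Critical κ A k d)
    (hord : ∀ g : G, 0 < addOrderOf g ∧ addOrderOf g ≤ d) {i : I} (hs : SuppIn i A) : False := by
  obtain rfl : k = 2 := le_antisymm (h.len_le_two hord hs) h.two_le_len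
  obtain ⟨x, hx⟩ := exists_eq_minVal (h.mem.1.nonneg i)
  exact h.false_of_notMem hs hx (h.class_unitVec_ne_zero hs hx)
    fun U₁ U₂ hA hU₁ hU₂ hx₁ => h.neg_class_notMem hord hs hx hA hU₁ hU₂ hx₁

end Critical
end SingleComponentFinal

/-! ### Elementary 2-groups: excluding d = 2, bounding k, excluding k = 2 -/

section ElementaryTwoGroup

variable {G : Type*} [AddCommGroup G] {I : Type*} [Fintype I] [DecidableEq I]
  {E : I → Type*} [∀ i, AddCommGroup (E i)] {J : I → Type*} [∀ i, Fintype (J i)]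
  [∀ i, DecidableEq (J i)] [∀ i, Nonempty (J i)]
  {κ : ∀ i, (E i × (J i → ℤ)) →+ G}

theorem norm_gs_add_sg (S : Multiset G) (i : I) (x : E i × (J i → ℤ)) :
    norm (gs S + sg i x : Amb G E J) = S.card + 2 * minVal x := by
  unfold norm
  rw [Finset.sum_eq_single i]
  · simp
  · intro i' _ h
    simp [sg_snd_of_ne h, minVal_zero]
  · simp

theorem le_norm_of_ne {A : Amb G E J} {i i' : I} (h : i ≠ i') :
    2 * (minVal (A.2 i) + minVal (A.2 i')) ≤ norm A := by
  have := Finset.sum_le_sum_of_subset (f := fun i => minVal (A.2 i))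
    (Finset.subset_univ ({i, i'} : Finset I))
  rw [Finset.sum_pair h] at this
  unfold norm
  omega

theorem exists_three_le_len {X Y Z : Amb G E J} (hX : X ∈ Blk κ) (hY : Y ∈ Blk κ)
    (hZ : Z ∈ Blk κ) (hX0 : X ≠ 0) (hY0 : Y ≠ 0) (hZ0 : Z ≠ 0) :
    ∃ m, 3 ≤ m ∧ LenIn (Blk κ) (X + (Y + Z)) m := by
  obtain ⟨m₁, h₁⟩ := blk_exists_lenIn_pos hZ hZ0
  obtain ⟨m₂, h₂, h₂'⟩ := exists_lenIn_ge hY hY0 h₁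
  obtain ⟨m₃, h₃, h₃'⟩ := exists_lenIn_ge hX hX0 h₂'
  exact ⟨m₃, by omega, h₃'⟩

/-- The constant valuation `c`. -/
def constVal {E : Type*} (J : Type*) [AddCommGroup E] (c : ℤ) : E × (J → ℤ) := (0, fun _ => c)

@[simp] theorem constVal_snd {E J : Type*} [AddCommGroup E] (c : ℤ) (j : J) :
    (constVal J c : E × (J → ℤ)).2 j = c := rfl

theorem constVal_valid {E J : Type*} [AddCommGroup E] {c : ℤ} (h : 1 ≤ c) :
    Valid (constVal J c : E × (J → ℤ)) := fun _ => h

theorem map_constVal_two (h2 : ∀ g : G, 2 • g = 0) (i : I) : κ i (constVal (J i) 2) = 0 :=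
  (map_eq_of_even h2 (κ i) (x := constVal (J i) 2) (y := 0) rfl fun j => by simp).trans
    (map_zero _)

theorem sg_constVal_two_mem (h2 : ∀ g : G, 2 • g = 0) (i : I) :
    (sg i (constVal (J i) 2) : Amb G E J) ∈ Blk κ :=
  ⟨ok_sg (constVal_valid (by omega)), by rw [cls_sg, map_constVal_two h2]⟩

/-- Replacing the `i`-th component by one with the same class. -/
theorem rest_add_sg_mem {X : Amb G E J} (hX : X ∈ Blk κ) {i : I} {x : E i × (J i → ℤ)}
    (hx : Valid x) (h : κ i x = κ i (X.2 i)) : rest i X + sg i x ∈ Blk κ :=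
  ⟨(hX.1.rest i).add (ok_sg hx), by rw [map_add, cls_sg, h, cls_rest, hX.2]⟩

theorem rest_add_sg_ne_zero {X : Amb G E J} {i : I} {x : E i × (J i → ℤ)} (hx : Valid x) :
    rest i X + sg i x ≠ 0 := fun h0 => hx.ne_zero (by simpa using comp_eq h0 i)

theorem IsAtomIn.rest_add_sg {X : Amb G E J} (hX : IsAtomIn (Blk κ) X) {i : I} (hi : X.2 i ≠ 0)
    {x : E i × (J i → ℤ)} (hx : Valid x) {j : J i} (hj : x.2 j ≤ 1) (h : κ i x = κ i (X.2 i)) :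
    IsAtomIn (Blk κ) (rest i X + sg i x) :=
  (hX.zeroSumFree_rest hi).isAtomIn_sg (hX.1.1.rest i) (by simp) hx hj
    (rest_add_sg_mem hX.1 hx h).2

namespace Critical

variable {A : Amb G E J} {k d : ℕ}

/-- For d = 2 a smaller element only needs a length at most 2 and a length at least 3. The constant
valuation 4 with at most two group elements has norm at most 10, while two components with
valuations at least 3 give `A` norm at least 12. -/
theorem false_of_gap_two (h2 : ∀ g : G, 2 • g = 0) (h : Critical κ A k 2) {i i' : I}
    (hne : i ≠ i') (hi : A.2 i ≠ 0) (hi' : A.2 i' ≠ 0) : False := by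
  obtain ⟨W, C, n, hn, hW, hWi, hA, hC⟩ := h.low.exists_atom_comp hi
  have hl : IsLow κ A k W := ⟨C, n, hA, hC, by omega⟩
  obtain ⟨j₀, hj₀⟩ := h.exists_val_eq_one hW hl hWi
  obtain ⟨j₁, hj₁⟩ := h.exists_val_ne_one hW hl i
  have hjj : j₁ ≠ j₀ := by rintro rfl; exact hj₁ hj₀
  set g := κ i (constVal (J i) 1) with hg
  have hgg : g + g = 0 := by rw [← two_nsmul, h2]
  obtain ⟨S, hS, hsum, hcard, hor⟩ : ∃ S : Multiset G, ZeroSumFree κ (gs S : Amb G E J) ∧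
      S.sum = g ∧ S.card ≤ 1 ∧ (S = 0 ∧ g = 0 ∨ S ≠ 0) := by
    by_cases h0 : g = 0
    · exact ⟨0, by rw [gs_zero]; exact zeroSumFree_gs_zero, by simp [h0], by simp,
        Or.inl ⟨rfl, h0⟩⟩
    · exact ⟨{g}, zeroSumFree_gs_singleton h0, by simp, by simp, Or.inr (by simp)⟩
  have hnorm : norm (gs (S + S) + sg i (constVal (J i) 4) : Amb G E J) < norm A := by
    have h1 : 3 ≤ minVal (A.2 i) := le_minVal (h.three_le hi)
    have h1' : 3 ≤ minVal (A.2 i') := le_minVal (h.three_le hi')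
    have h3 := le_norm_of_ne (A := A) hne
    have h4 : minVal (constVal (J i) 4 : E i × (J i → ℤ)) ≤ 4 := minVal_le (j := j₀) (by simp)
    rw [norm_gs_add_sg, Multiset.card_add]
    omega
  have atom : ∀ x : E i × (J i → ℤ), x.1 = 0 → (∀ j, Even (x.2 j - 1)) → Valid x →
      ∀ j, x.2 j = 1 → IsAtomIn (Blk κ) (gs S + sg i x) := by
    intro x hx1 hx hv j hj
    refine hS.isAtomIn_sg (ok_gs _) (by simp) hv hj.le ?_
    rw [map_add, cls_gs, cls_sg, hsum, map_eq_of_even h2 (κ i) (y := constVal (J i) 1) hx1 hx,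
      ← hg, hgg]
  -- The constant 4 splits as `x + x'` with odd valuations. Each part has a valuation 1 since there
  -- are at least two places, and so gives an atom with `S`.
  let x : E i × (J i → ℤ) := (0, fun j => if j = j₀ then 1 else 3)
  let x' : E i × (J i → ℤ) := (0, fun j => if j = j₀ then 3 else 1)
  have a₁ := atom x rfl (fun j => by simp only [x]; split_ifs <;> decide)
    (fun j => by simp only [x]; split_ifs <;> omega) j₀ (by simp [x])
  have a₂ := atom x' rfl (fun j => by simp only [x']; split_ifs <;> decide)
    (fun j => by simp only [x']; split_ifs <;> omega) j₁ (by simp [x', hjj])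
  have e4 : (constVal (J i) 4 : E i × (J i → ℤ)) = x + x' := by
    refine Prod.ext (by simp [constVal, x, x']) (funext fun j => ?_)
    simp only [constVal_snd, Prod.snd_add, Pi.add_apply, x, x']
    split_ifs <;> rfl
  have hlow : LenIn (Blk κ) (gs (S + S) + sg i (constVal (J i) 4)) 2 := by
    convert a₁.lenIn.add a₂.lenIn using 1
    rw [e4, gs_add, sg_add]; abel
  have hhigh : ∃ m, 3 ≤ m ∧ LenIn (Blk κ) (gs (S + S) + sg i (constVal (J i) 4)) m := by
    have m2 := sg_constVal_two_mem (κ := κ) h2 i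
    have n2 : (sg i (constVal (J i) 2) : Amb G E J) ≠ 0 := sg_ne_zero (constVal_valid (by omega))
    rcases hor with ⟨rfl, hg0⟩ | hS0
    · have m1 : (sg i (constVal (J i) 1) : Amb G E J) ∈ Blk κ :=
        ⟨ok_sg (constVal_valid le_rfl), by rw [cls_sg, ← hg, hg0]⟩
      have n1 : (sg i (constVal (J i) 1) : Amb G E J) ≠ 0 := sg_ne_zero (constVal_valid le_rfl)
      obtain ⟨m, hm, hl⟩ := exists_three_le_len m1 m1 m2 n1 n1 n2
      refine ⟨m, hm, ?_⟩
      convert hl using 1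
      rw [add_zero, gs_zero, zero_add, ← sg_add, ← sg_add]
      congr 1
      exact Prod.ext (by simp [constVal]) (funext fun j => by simp)
    · obtain ⟨m, hm, hl⟩ := exists_three_le_len (κ := κ) (X := gs (S + S))
        ⟨ok_gs _, by rw [cls_gs, Multiset.sum_add, hsum, hgg]⟩ m2 m2
        (fun h0 => hS0 (by simpa using congrArg Prod.fst h0)) n2 n2
      refine ⟨m, hm, ?_⟩
      convert hl using 1
      rw [← sg_add]
      congr 2
      exact Prod.ext (by simp [constVal]) (funext fun j => by simp)
  obtain ⟨m, hm, hl⟩ := hhigh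
  exact h.min _ hl.mem hnorm ⟨2, ⟨2, le_rfl, hlow⟩, ⟨m, by omega, hl⟩, fun m _ => by omega⟩

/-- An atom dividing the constant valuation 2 would be low. A valuation other than 1 must be 2 and
forces the cofactor to vanish, but then no valuation is 1. -/
theorem false_of_sg_two (h2 : ∀ g : G, 2 • g = 0) (h : Critical κ A k d) {i : I}
    {U C : Amb G E J} (hU : IsAtomIn (Blk κ) U) (hl : IsLow κ A k U) (hC : C ∈ Blk κ)
    (hA : A = sg i (constVal (J i) 2) + U + C) : False := by
  obtain ⟨W, Y, hW, hWY, hY⟩ := exists_atom_dvd (sg_constVal_two_mem (κ := κ) h2 i)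
    (sg_ne_zero (constVal_valid (by omega)))
  have hlW : IsLow κ A k W := h.isLow_of hU hl hW ((Blk κ).add_mem hY hC) (by
    rw [hA, hWY]; abel)
  have eW := eq_sg_of_add_eq hW.1.1 hY.1 hWY.symm
  have hWi : W.2 i ≠ 0 := fun h0 => hW.2.1 (by rw [eW, h0, sg_zero])
  have hv := hW.1.1.valid hWi
  obtain ⟨j₀, hj₀⟩ := h.exists_val_eq_one hW hlW hWi
  obtain ⟨j₁, hj₁⟩ := h.exists_val_ne_one hW hlW i
  have e : ∀ j, (2 : ℤ) = (W.2 i).2 j + (Y.2 i).2 j := fun j => by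
    have := val_eq hWY i j
    simpa using this
  have hY0 : Y.2 i = 0 := hY.1.eq_zero (j := j₁) (by
    have := e j₁; have := hv j₁; omega)
  have := e j₀
  rw [hY0, hj₀] at this
  simp at this

/-- Moving the square of the product of all primes out of a divisor. -/
theorem false_of_three_le_val (h2 : ∀ g : G, 2 • g = 0) (h : Critical κ A k d) {i : I}
    {U V C : Amb G E J} (hU : IsAtomIn (Blk κ) U) (hl : IsLow κ A k U) (hV : V ∈ Blk κ)
    (hC : C ∈ Blk κ) (hA : A = U + V + C) (hV3 : ∀ j, 3 ≤ (V.2 i).2 j) : False := by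
  have hv : Valid (V.2 i - constVal (J i) 2) := fun j => by
    have := hV3 j
    simp only [Prod.snd_sub, Pi.sub_apply, constVal_snd]; omega
  have hV' := rest_add_sg_mem hV hv (by rw [map_sub, map_constVal_two h2, sub_zero])
  refine h.false_of_sg_two h2 hU hl ((Blk κ).add_mem hV' hC) (i := i) ?_
  have := rest_add_sg i V
  rw [← sg_sub_add i _ (constVal (J i) 2)] at this
  grind

theorem exists_val_add_le_two (h2 : ∀ g : G, 2 • g = 0) (h : Critical κ A k d) {i : I}
    {U V W C : Amb G E J} (hU : IsAtomIn (Blk κ) U) (hl : IsLow κ A k U) (hV : V ∈ Blk κ)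
    (hW : W ∈ Blk κ) (hC : C ∈ Blk κ) (hA : A = U + (V + W) + C) :
    ∃ j, (V.2 i).2 j + (W.2 i).2 j ≤ 2 := by
  by_contra! hcon
  exact h.false_of_three_le_val h2 hU hl ((Blk κ).add_mem hV hW) hC hA
    fun j => by
      have := hcon j
      simp only [Prod.snd_add, Pi.add_apply]; omega

/-- At some place `V` and `W` together have valuation at most 2, but `A` has at least 3, so `U` must
contribute. -/
theorem comp_ne_zero_of_three (h2 : ∀ g : G, 2 • g = 0) (h : Critical κ A k d) {i : I}
    (hi : A.2 i ≠ 0) {U V W C : Amb G E J} (hU : IsAtomIn (Blk κ) U) (hl : IsLow κ A k U)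
    (hV : V ∈ Blk κ) (hW : W ∈ Blk κ) (hC : C ∈ Blk κ) (hA : A = U + (V + W) + C)
    (hCi : C.2 i = 0) : U.2 i ≠ 0 := by
  intro h0
  obtain ⟨j, hj⟩ := h.exists_val_add_le_two h2 hU hl hV hW hC hA (i := i)
  have := val_eq hA i j
  simp only [Prod.snd_add, Pi.add_apply, h0, hCi, Prod.snd_zero, Pi.zero_apply] at this
  have := h.three_le hi j
  omega

/-- With four low atoms, at most three of them already have total valuation at least 3 everywhere in
component `i`, and one low atom is left over for `false_of_three_le_val`. -/
theorem len_le_three (h2 : ∀ g : G, 2 • g = 0) (h : Critical κ A k d) {i : I}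
    (hi : A.2 i ≠ 0) : k ≤ 3 := by
  by_contra hcon
  have hlow := h.low
  obtain ⟨U₁, C₁, n₁, rfl, hU₁, i₁, hA, hC₁⟩ := hlow.exists_atom_comp hi
  have l₁ : IsLow κ A (n₁ + 1) U₁ := ⟨_, _, hA, hC₁, le_rfl⟩
  have h3 := h.three_le hi
  by_cases hi₂ : C₁.2 i = 0
  · obtain ⟨j, hj⟩ := h.exists_val_eq_one hU₁ l₁ i₁
    have := val_eq hA i j
    simp only [Prod.snd_add, Pi.add_apply, hi₂, Prod.snd_zero, Pi.zero_apply] at this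
    have := h3 j
    omega
  obtain ⟨U₂, C₂, n₂, rfl, hU₂, i₂, rfl, hC₂⟩ := hC₁.exists_atom_comp hi₂
  have key : ∃ V W U C n, U₁ + U₂ + V = W ∧ IsAtomIn (Blk κ) U ∧ V ∈ Blk κ ∧ A = W + U + C ∧
      LenIn (Blk κ) C n ∧ (V.2 i ≠ 0 ∨ V.2 i = 0 ∧ U.2 i = 0 ∧ C.2 i = 0) := by
    by_cases hi₃ : C₂.2 i = 0
    · obtain ⟨n, rfl⟩ : ∃ n, n₂ = n + 1 := ⟨n₂ - 1, by omega⟩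
      obtain ⟨U, C, hU, rfl, hC⟩ := hC₂.exists_atom
      have z := comp_eq_zero_of_add hU.1.1 hC.mem.1 hi₃
      refine ⟨0, _, U, C, n, rfl, hU, zero_mem _, by rw [hA]; abel, hC, Or.inr ⟨rfl, z, ?_⟩⟩
      rw [add_comm] at hi₃
      exact comp_eq_zero_of_add hC.mem.1 hU.1.1 hi₃
    · obtain ⟨V, C₃, n₃, rfl, hV, i₃, rfl, hC₃⟩ := hC₂.exists_atom_comp hi₃
      obtain ⟨n, rfl⟩ : ∃ n, n₃ = n + 1 := ⟨n₃ - 1, by omega⟩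
      obtain ⟨U, C, hU, rfl, hC⟩ := hC₃.exists_atom
      exact ⟨V, _, U, C, n, rfl, hU, hV.1, by rw [hA]; abel, hC, Or.inl i₃⟩
  obtain ⟨V, W, U, C, n, rfl, hU, hV, hA', hC, hor⟩ := key
  have lU : IsLow κ A (n₂ + 1 + 1) U := h.isLow_of hU₁ l₁ hU (C := U₂ + V + C)
    ((Blk κ).add_mem ((Blk κ).add_mem hU₂.1 hV) hC.mem) (by rw [hA']; abel)
  refine h.false_of_three_le_val h2 hU lU (V := U₁ + U₂ + V) (i := i)
    ((Blk κ).add_mem ((Blk κ).add_mem hU₁.1 hU₂.1) hV) hC.mem (by rw [hA']; abel) fun j => ?_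
  rcases hor with hor | ⟨z₁, z₂, z₃⟩
  · have := hU₁.1.1.valid i₁ j
    have := hU₂.1.1.valid i₂ j
    have := hV.1.valid hor j
    simp only [Prod.snd_add, Pi.add_apply]; omega
  · have := h3 j
    rw [hA'] at this
    simp only [Prod.snd_add, Pi.add_apply, z₁, z₂, z₃, Prod.snd_zero, Pi.zero_apply] at this ⊢
    omega

/-- Valuation 3 is excluded, so twos can be moved from `U₂` to the places where `U₁` has valuation
1. The enlarged `U₁` has no valuation 1, hence is not an atom; it has two or three factors, giving a
length 3 or 4 of `A`. -/
theorem len_ne_two (h2 : ∀ g : G, 2 • g = 0) (h : Critical κ A 2 d) (hd : 3 ≤ d) {i : I}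
    (hi : A.2 i ≠ 0) : False := by
  have h3 := h.three_le hi
  have hlow := h.low
  obtain ⟨U₁, U₂, n, hn, hU₁, i₁, hA, hC⟩ := hlow.exists_atom_comp hi
  obtain rfl : n = 1 := by omega
  have hU₂ := hC.isAtomIn
  have l₁ : IsLow κ A 2 U₁ := ⟨U₂, 1, hA, hC, by omega⟩
  have l₂ : IsLow κ A 2 U₂ := ⟨U₁, 1, by rw [hA, add_comm], hU₁.lenIn, by omega⟩
  have e : ∀ j, (A.2 i).2 j = (U₁.2 i).2 j + (U₂.2 i).2 j := val_eq hA i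
  obtain ⟨j₁, hj₁⟩ := h.exists_val_eq_one hU₁ l₁ i₁
  have i₂ : U₂.2 i ≠ 0 := fun h0 => by
    have := e j₁; rw [h0] at this; simp at this
    have := h3 j₁; omega
  obtain ⟨j₂, hj₂⟩ := h.exists_val_eq_one hU₂ l₂ i₂
  by_cases hz : ∃ z, (A.2 i).2 z = 3
  · obtain ⟨z, hz⟩ := hz
    exact h.false_of_val_eq_three h2 hA hU₁ hU₂ i₁ i₂ hz
  push Not at hz
  have h4 : ∀ j, 4 ≤ (A.2 i).2 j := fun j => by have := h3 j; have := hz j; omega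
  let f : E i × (J i → ℤ) := (0, fun j => if (U₁.2 i).2 j = 1 then 2 else 0)
  have hκf : κ i f = 0 := by
    refine (map_eq_of_even h2 (κ i) (x := f) (y := 0) rfl fun j => ?_).trans (map_zero _)
    simp only [f]; split_ifs <;> simp
  have v₁ := hU₁.1.1.valid i₁
  have v₂ := hU₂.1.1.valid i₂
  have hx2 : ∀ j, 2 ≤ (U₁.2 i + f).2 j := fun j => by
    have := v₁ j
    simp only [Prod.snd_add, Pi.add_apply, f]; split_ifs <;> omega
  have hx : Valid (U₁.2 i + f) := fun j => by have := hx2 j; omega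
  have hb : Valid (U₂.2 i - f) := fun j => by
    have := v₂ j; have := h4 j; have := e j
    simp only [Prod.snd_sub, Pi.sub_apply, f]; split_ifs <;> omega
  have hat := hU₂.rest_add_sg i₂ hb (j := j₂) (by
    have := h4 j₂; have := e j₂
    simp only [Prod.snd_sub, Pi.sub_apply, f]; rw [if_neg (by omega)]; omega)
    (by rw [map_sub, hκf, sub_zero])
  have hm := rest_add_sg_mem hU₁.1 hx (by rw [map_add, hκf, add_zero])
  have hA' : A = rest i U₁ + sg i (U₁.2 i + f) + (rest i U₂ + sg i (U₂.2 i - f)) := by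
    have e₁ := rest_add_sg i U₁
    have e₂ := rest_add_sg i U₂
    rw [← sg_sub_add i _ f] at e₂
    rw [sg_add]
    grind
  obtain ⟨t, ht⟩ := blk_exists_lenIn_pos hm (rest_add_sg_ne_zero hx)
  have hlen := ht.add hat.lenIn
  rw [← hA'] at hlen
  have ht3 := (hU₁.zeroSumFree_rest i₁).lenIn_le (by simp) ht j₁
  simp only [Prod.snd_add, Pi.add_apply, f, hj₁, if_true] at ht3
  rcases Nat.eq_zero_or_pos t with h0 | h0
  · subst h0
    obtain ⟨j, hj⟩ := h.exists_val_eq_one (LenIn.isAtomIn ht) ⟨_, 1, hA', hat.lenIn, by omega⟩ (i := i)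
      (by simpa using hx.ne_zero)
    have := hx2 j
    simp only [Prod.snd_add, Pi.add_apply, rest_snd_self, sg_snd_self, Prod.snd_zero,
      Pi.zero_apply] at hj this
    omega
  · exact h.no_gap hlen (by omega) (by omega)

end Critical
end ElementaryTwoGroup

/-! ### Elementary 2-groups: excluding k = 3 with two nonzero components -/

section LengthThree

variable {G : Type*} [AddCommGroup G] {I : Type*} [Fintype I] [DecidableEq I]
  {E : I → Type*} [∀ i, AddCommGroup (E i)] {J : I → Type*} [∀ i, Fintype (J i)]
  [∀ i, DecidableEq (J i)] [∀ i, Nonempty (J i)]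
  {κ : ∀ i, (E i × (J i → ℤ)) →+ G}

namespace Critical

variable {A : Amb G E J} {k d : ℕ}

theorem comp_ne_zero_of_isLow_three (h2 : ∀ g : G, 2 • g = 0) (h : Critical κ A 3 d) {i : I}
    (hi : A.2 i ≠ 0) {W : Amb G E J} (hW : IsAtomIn (Blk κ) W) (hl : IsLow κ A 3 W) :
    W.2 i ≠ 0 := by
  intro h0
  obtain ⟨C, m, hA, hC, hm⟩ := id hl
  obtain rfl | rfl | rfl : m = 0 ∨ m = 1 ∨ m = 2 := by omega
  · rw [hC.eq_zero_of_zero] at hA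
    exact hi (by rw [hA]; simpa using h0)
  · have hCA : C.2 i = A.2 i := by rw [hA]; simp [h0]
    obtain ⟨j, hj⟩ := h.exists_val_eq_one hC.isAtomIn
      ⟨W, 1, by rw [hA, add_comm], hW.lenIn, by omega⟩ (i := i) (by rwa [hCA])
    have := h.three_le hi j
    rw [hCA] at hj
    omega
  · obtain ⟨V, V', hV, rfl, hV'⟩ := hC.exists_atom
    exact h.comp_ne_zero_of_three h2 hi hW hl hV.1 hV'.mem (zero_mem _) (by rw [hA]; abel) rfl h0

theorem isLow_of_three {U₁ U₂ U₃ : Amb G E J} (hA : A = U₁ + (U₂ + U₃))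
    (hU₂ : IsAtomIn (Blk κ) U₂) (hU₃ : IsAtomIn (Blk κ) U₃) : IsLow κ A 3 U₁ :=
  ⟨_, 1 + 1, hA, hU₂.lenIn.add hU₃.lenIn, by omega⟩

/-- Redistributing component `i` between `U₁` and `U₂ + U₃` would merge `U₂` and `U₃` into one low
atom. Its component `i'` has all valuations at least 2, which is impossible. -/
theorem false_of_mixed (h2 : ∀ g : G, 2 • g = 0) (h : Critical κ A 3 d) {i i' : I}
    (hne : i ≠ i') (hi : A.2 i ≠ 0) (hi' : A.2 i' ≠ 0) {U₁ U₂ U₃ : Amb G E J}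
    (hA : A = U₁ + (U₂ + U₃)) (hU₁ : IsAtomIn (Blk κ) U₁) (hU₂ : IsAtomIn (Blk κ) U₂)
    (hU₃ : IsAtomIn (Blk κ) U₃) {x b : E i × (J i → ℤ)} (hx : Valid x) (hb : Valid b)
    (hxb : x + b = A.2 i) (hκ : κ i x = κ i (U₁.2 i)) {j j' : J i} (hj : x.2 j = 1)
    (hj' : b.2 j' = 1) : False := by
  have l₁ := isLow_of_three hA hU₂ hU₃
  have l₂ := isLow_of_three (hA.trans (add_left_comm _ _ _)) hU₁ hU₃
  have l₃ := isLow_of_three (hA.trans (by abel : _ = U₃ + (U₁ + U₂))) hU₁ hU₂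
  have i₁ := h.comp_ne_zero_of_isLow_three h2 hi hU₁ l₁
  have i₂ := h.comp_ne_zero_of_isLow_three h2 hi hU₂ l₂
  have i₃ := h.comp_ne_zero_of_isLow_three h2 hi hU₃ l₃
  have k₂ := h.comp_ne_zero_of_isLow_three h2 hi' hU₂ l₂
  have k₃ := h.comp_ne_zero_of_isLow_three h2 hi' hU₃ l₃
  have hM := (Blk κ).add_mem hU₂.1 hU₃.1
  have hMi : (U₂ + U₃).2 i ≠ 0 := ((hU₂.1.1.valid i₂).add (hU₃.1.1.valid i₃)).ne_zero
  have hMv : ∀ j, 2 ≤ ((U₂ + U₃).2 i').2 j := fun j => by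
    have := hU₂.1.1.valid k₂ j
    have := hU₃.1.1.valid k₃ j
    simp only [Prod.snd_add, Pi.add_apply]; omega
  generalize U₂ + U₃ = M at hA hM hMi hMv
  have hMe := rest_add_sg i M
  -- An atom dividing this rest would be low and avoid component `i`.
  have hfree : ZeroSumFree κ (rest i M) := by
    intro X Y hX hY hXY
    by_contra hX0
    obtain ⟨W, X', hW, rfl, hX'⟩ := exists_atom_dvd hX hX0
    have hY' : X' + Y + sg i (M.2 i) ∈ Blk κ := by
      refine ⟨(hX'.1.add hY).add (ok_sg (hM.1.valid hMi)), ?_⟩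
      have := hM.2
      rwa [← hMe, ← hXY, add_assoc, add_assoc, map_add, hW.1.2, zero_add, ← add_assoc] at this
    have hlW : IsLow κ A 3 W := h.isLow_of hU₁ l₁ hW hY' (by grind)
    have hXi : (W + X').2 i = 0 :=
      comp_eq_zero_of_add hX.1 hY (by rw [hXY]; simp)
    exact h.comp_ne_zero_of_isLow_three h2 hi hW hlW (comp_eq_zero_of_add hW.1.1 hX'.1 hXi)
  have hκb : κ i b = κ i (M.2 i) := by
    have e := congrArg (κ i) hxb
    have e' := congrArg (κ i) (comp_eq hA i)
    simp only [Prod.snd_add, Pi.add_apply, map_add] at e e'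
    rw [e', hκ] at e
    exact add_left_cancel e
  have a₁ := hU₁.rest_add_sg i₁ hx hj.le hκ
  have a₂ := hfree.isAtomIn_sg (hM.1.rest i) (by simp) hb hj'.le (rest_add_sg_mem hM hb hκb).2
  have hA' : A = (rest i M + sg i b) + (rest i U₁ + sg i x) := by
    have := rest_add_sg i A
    rw [← hxb, sg_add, hA, rest_add] at this
    rw [hA, ← this]
    abel
  have hci : (rest i M + sg i b).2 i' = M.2 i' := by
    simp [rest_snd_of_ne hne.symm, sg_snd_of_ne hne.symm]
  obtain ⟨y, hy⟩ := h.exists_val_eq_one a₂ ⟨_, 1, hA', a₁.lenIn, by omega⟩ (i := i') (by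
    rw [hci]; intro h0
    have := hMv (Classical.arbitrary _)
    rw [h0] at this; simp at this)
  rw [hci] at hy
  have := hMv y
  omega

/-- By symmetry, all three low atoms have the same parity at every place. Were the sum odd at `z`,
everything but 1 could be moved to `U₁` at `z` without changing its class, against `false_of_mixed`.
-/
theorem even_val_add (h2 : ∀ g : G, 2 • g = 0) (h : Critical κ A 3 d) {i i' : I}
    (hne : i ≠ i') (hi : A.2 i ≠ 0) (hi' : A.2 i' ≠ 0) {U₁ U₂ U₃ : Amb G E J}
    (hA : A = U₁ + (U₂ + U₃)) (hU₁ : IsAtomIn (Blk κ) U₁) (hU₂ : IsAtomIn (Blk κ) U₂)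
    (hU₃ : IsAtomIn (Blk κ) U₃) (z : J i) : ((U₂.2 i).2 z + (U₃.2 i).2 z) % 2 = 0 := by
  by_contra hodd
  have l₁ := isLow_of_three hA hU₂ hU₃
  have l₂ := isLow_of_three (hA.trans (add_left_comm _ _ _)) hU₁ hU₃
  have l₃ := isLow_of_three (hA.trans (by abel : _ = U₃ + (U₁ + U₂))) hU₁ hU₂
  have v₁ := hU₁.1.1.valid (h.comp_ne_zero_of_isLow_three h2 hi hU₁ l₁)
  have v₂ := hU₂.1.1.valid (h.comp_ne_zero_of_isLow_three h2 hi hU₂ l₂)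
  have v₃ := hU₃.1.1.valid (h.comp_ne_zero_of_isLow_three h2 hi hU₃ l₃)
  have e : ∀ j, (A.2 i).2 j = (U₁.2 i).2 j + ((U₂.2 i).2 j + (U₃.2 i).2 j) := val_eq hA i
  obtain ⟨j₂, hj₂⟩ := h.exists_val_add_le_two h2 hU₃ l₃ hU₁.1 hU₂.1 (zero_mem _) (i := i)
    (by rw [hA]; abel)
  obtain ⟨j₃, hj₃⟩ := h.exists_val_add_le_two h2 hU₂ l₂ hU₁.1 hU₃.1 (zero_mem _) (i := i)
    (by rw [hA]; abel)
  obtain ⟨j, hjz, hj⟩ : ∃ j, j ≠ z ∧ (U₁.2 i).2 j = 1 := by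
    by_cases h₂ : j₂ = z
    · refine ⟨j₃, ?_, by have := v₁ j₃; have := v₃ j₃; omega⟩
      rintro rfl
      subst h₂
      have := v₁ j₂; have := v₂ j₂; have := v₃ j₂
      omega
    · exact ⟨j₂, h₂, by have := v₁ j₂; have := v₂ j₂; omega⟩
  let x : E i × (J i → ℤ) := ((U₁.2 i).1, fun y => if y = z then (A.2 i).2 z - 1 else (U₁.2 i).2 y)
  have h3 := h.three_le hi
  refine h.false_of_mixed h2 hne hi hi' hA hU₁ hU₂ hU₃ (x := x) (b := A.2 i - x) (j := j)
    (j' := z) ?_ ?_ (by abel) (map_eq_of_even h2 _ rfl ?_) (by simp [x, hjz, hj]) (by simp [x])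
  · intro y
    have := v₁ y; have := h3 z
    simp only [x]; split_ifs <;> omega
  · intro y
    have := e y; have := v₂ y; have := v₃ y
    simp only [Prod.snd_sub, Pi.sub_apply, x]; split_ifs with hy
    · subst hy; omega
    · omega
  · intro y
    rw [Int.even_iff]
    have := e z
    simp only [x]; split_ifs with hy
    · subst hy; omega
    · omega

/-- Otherwise twos can be moved from `U₃` to the places where `U₁` and `U₂` are both 1. Then `U₁`
and the enlarged `U₂` have sum at least 3 everywhere, beside a low atom. -/
theorem exists_val_eq_three (h2 : ∀ g : G, 2 • g = 0) (h : Critical κ A 3 d) {i i' : I}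
    (hne : i ≠ i') (hi : A.2 i ≠ 0) (hi' : A.2 i' ≠ 0) {U₁ U₂ U₃ : Amb G E J}
    (hA : A = U₁ + (U₂ + U₃)) (hU₁ : IsAtomIn (Blk κ) U₁) (hU₂ : IsAtomIn (Blk κ) U₂)
    (hU₃ : IsAtomIn (Blk κ) U₃) : ∃ z, (A.2 i).2 z = 3 := by
  by_contra! hcon
  have l₁ := isLow_of_three hA hU₂ hU₃
  have l₂ := isLow_of_three (hA.trans (add_left_comm _ _ _)) hU₁ hU₃
  have l₃ := isLow_of_three (hA.trans (by abel : _ = U₃ + (U₁ + U₂))) hU₁ hU₂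
  have i₂ := h.comp_ne_zero_of_isLow_three h2 hi hU₂ l₂
  have i₃ := h.comp_ne_zero_of_isLow_three h2 hi hU₃ l₃
  have v₁ := hU₁.1.1.valid (h.comp_ne_zero_of_isLow_three h2 hi hU₁ l₁)
  have v₂ := hU₂.1.1.valid i₂
  have v₃ := hU₃.1.1.valid i₃
  have e : ∀ j, (A.2 i).2 j = (U₁.2 i).2 j + ((U₂.2 i).2 j + (U₃.2 i).2 j) := val_eq hA i
  have h4 : ∀ j, 4 ≤ (A.2 i).2 j := fun j => by
    have := h.three_le hi j; have := hcon j; omega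
  have par : ∀ j, ((U₁.2 i).2 j + (U₃.2 i).2 j) % 2 = 0 := fun j =>
    h.even_val_add h2 hne hi hi' (hA.trans (add_left_comm _ _ _)) hU₂ hU₁ hU₃ j
  obtain ⟨j₃, hj₃⟩ := h.exists_val_add_le_two h2 hU₂ l₂ hU₁.1 hU₃.1 (zero_mem _) (i := i)
    (by rw [hA]; abel)
  let f : E i × (J i → ℤ) :=
    (0, fun j => if (U₁.2 i).2 j + (U₂.2 i).2 j = 2 then 2 else 0)
  have hκf : κ i f = 0 := by
    refine (map_eq_of_even h2 (κ i) (x := f) (y := 0) rfl fun j => ?_).trans (map_zero _)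
    simp only [f]; split_ifs <;> simp
  have hv₃ : Valid (U₃.2 i - f) := fun j => by
    have := v₁ j; have := v₂ j; have := v₃ j; have := h4 j; have := e j; have := par j
    simp only [Prod.snd_sub, Pi.sub_apply, f]; split_ifs <;> omega
  have hv₂ : Valid (U₂.2 i + f) := fun j => by
    have := v₂ j
    simp only [Prod.snd_add, Pi.add_apply, f]; split_ifs <;> omega
  -- At `j₃` both `U₁` and `U₃` are 1, so `U₂` is at least 2 and `f` vanishes there.
  have hat := hU₃.rest_add_sg i₃ hv₃ (j := j₃) (by
    have := v₁ j₃; have := v₃ j₃; have := h4 j₃; have := e j₃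
    simp only [Prod.snd_sub, Pi.sub_apply, f]; rw [if_neg (by omega)]; omega)
    (by rw [map_sub, hκf, sub_zero])
  have hm := rest_add_sg_mem hU₂.1 hv₂ (by rw [map_add, hκf, add_zero])
  have hA' : A = U₁ + (rest i U₃ + sg i (U₃.2 i - f)) + (rest i U₂ + sg i (U₂.2 i + f)) := by
    have e₁ := rest_add_sg i U₂
    have e₂ := rest_add_sg i U₃
    rw [← sg_sub_add i _ f] at e₂
    rw [sg_add]
    grind
  refine h.false_of_three_le_val h2 hat (h.isLow_of hU₁ l₁ hat hm hA')
    ((Blk κ).add_mem hU₁.1 hm) (zero_mem _) (i := i) (by rw [hA']; abel) fun j => ?_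
  have := v₁ j; have := v₂ j
  simp only [Prod.snd_add, Pi.add_apply, rest_snd_self, sg_snd_self, Prod.snd_zero,
    Pi.zero_apply, f]
  split_ifs <;> omega

/-- Reduction replacing `c`, the component of `U₁` shrunk to valuations 1 and 2, by its class. A
place `z` of valuation 3 makes the norm drop and limits all factorizations to three atoms at
component `i`. -/
theorem len_ne_three (h2 : ∀ g : G, 2 • g = 0) (h : Critical κ A 3 d) {i i' : I}
    (hne : i ≠ i') (hi : A.2 i ≠ 0) (hi' : A.2 i' ≠ 0) : False := by
  have hlow := h.low
  obtain ⟨U₁, C, hU₁, hA, hC⟩ := hlow.exists_atom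
  obtain ⟨U₂, U₃, hU₂, rfl, hU₃⟩ := hC.exists_atom
  replace hU₃ := hU₃.isAtomIn
  have l₁ := isLow_of_three hA hU₂ hU₃
  have l₂ := isLow_of_three (hA.trans (add_left_comm _ _ _)) hU₁ hU₃
  have l₃ := isLow_of_three (hA.trans (by abel : _ = U₃ + (U₁ + U₂))) hU₁ hU₂
  have i₁ := h.comp_ne_zero_of_isLow_three h2 hi hU₁ l₁
  have i₂ := h.comp_ne_zero_of_isLow_three h2 hi hU₂ l₂
  have i₃ := h.comp_ne_zero_of_isLow_three h2 hi hU₃ l₃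
  have v₁ := hU₁.1.1.valid i₁
  have v₂ := hU₂.1.1.valid i₂
  have v₃ := hU₃.1.1.valid i₃
  have e : ∀ j, (A.2 i).2 j = (U₁.2 i).2 j + ((U₂.2 i).2 j + (U₃.2 i).2 j) := val_eq hA i
  have h3 := h.three_le hi
  have par₃ : ∀ j, ((U₁.2 i).2 j + (U₃.2 i).2 j) % 2 = 0 := fun j =>
    h.even_val_add h2 hne hi hi' (hA.trans (add_left_comm _ _ _)) hU₂ hU₁ hU₃ j
  have par₂ : ∀ j, ((U₁.2 i).2 j + (U₂.2 i).2 j) % 2 = 0 := fun j =>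
    h.even_val_add h2 hne hi hi' (hA.trans (by abel : _ = U₃ + (U₁ + U₂))) hU₃ hU₁ hU₂ j
  obtain ⟨z, hz⟩ := h.exists_val_eq_three h2 hne hi hi' hA hU₁ hU₂ hU₃
  obtain ⟨c, hc⟩ : ∃ c, c = red (U₁.2 i) := ⟨_, rfl⟩
  have hcj : ∀ j, c.2 j = 2 - (U₁.2 i).2 j % 2 := fun j => by rw [hc]; rfl
  have hκc : κ i c = κ i (U₁.2 i) := by rw [hc]; exact map_red h2 _ _
  have hcv : Valid c := fun j => by rw [hcj]; omega
  -- By equal parities, an even place has valuation at least 6 in `A`, and an odd one has `c` equal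
  -- to 1. Hence both shrunken parts can be removed.
  have key : ∀ v : E i × (J i → ℤ), Valid v → (∀ j, v.2 j + 2 ≤ (A.2 i).2 j) →
      Valid (A.2 i - red v - c) := fun v hv hvA j => by
    have := v₁ j; have := v₂ j; have := v₃ j; have := hv j; have := hvA j
    have := par₂ j; have := par₃ j; have := e j
    simp only [Prod.snd_sub, Pi.sub_apply, hcj, red]
    omega
  have hκkey : ∀ v : E i × (J i → ℤ), κ i (A.2 i - red v - c) = κ i (A.2 i) - κ i v - κ i c :=
    fun v => by rw [map_sub, map_sub, map_red h2]
  have hac : Valid (A.2 i - c) := fun j => by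
    have := h3 j
    simp only [Prod.snd_sub, Pi.sub_apply, hcj]; omega
  have hcz : c.2 z = 1 := by
    have := v₁ z; have := v₂ z; have := v₃ z; have := e z
    rw [hcj]; omega
  have eA := rest_add_sg i A
  rw [← sg_sub_add i _ c] at eA
  refine h.reduce (rest i A + sg i (A.2 i - c) + gs {κ i c}) ?_ ⟨3, le_rfl, ?_⟩ ?_ ?_
  · refine norm_lt_of i (fun i' hi' => by simp [rest_snd_of_ne hi', sg_snd_of_ne hi']) ?_
    have h5 : 3 ≤ minVal (A.2 i) := le_minVal h3
    have h6 : minVal (A.2 i - c) ≤ 2 := minVal_le (j := z) (by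
      simp only [Prod.snd_sub, Pi.sub_apply]; omega)
    simp; omega
  · have hv : Valid (U₂.2 i + U₁.2 i - c) := fun j => by
      have := v₁ j; have := v₂ j
      simp only [Prod.snd_sub, Pi.sub_apply, Prod.snd_add, Pi.add_apply, hcj]; omega
    have a₂ := hU₂.rest_add_sg i₂ hv (j := z) (by
      have := v₁ z; have := v₂ z; have := v₃ z; have := e z
      simp only [Prod.snd_sub, Pi.sub_apply, Prod.snd_add, Pi.add_apply]; omega) (by
      rw [map_sub, map_add, hκc, add_sub_cancel_right])
    have a₁ := hU₁.replace i₁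
    rw [← hκc] at a₁
    convert a₁.lenIn.add (a₂.lenIn.add hU₃.lenIn) using 1
    have e₁ := rest_add_sg i U₁
    have e₂ := rest_add_sg i U₂
    have e₃ := sg_sub_add (G := G) i (U₂.2 i + U₁.2 i) c
    rw [sg_add] at e₃
    grind
  · have cover : ∀ V Y n, A = V + Y → V ∈ Blk κ → Y.2 i = 0 → LenIn (Blk κ) Y n →
        ∃ m, n + 1 ≤ m ∧ LenIn (Blk κ) (rest i A + sg i (A.2 i - c) + gs {κ i c}) m := by
      intro V Y n hAV hV hYi hY
      have hVi : V.2 i = A.2 i := by rw [hAV]; simp [hYi]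
      have hV' : rest i V + sg i (A.2 i - c) + gs {κ i c} ∈ Blk κ := by
        refine ⟨((hV.1.rest i).add (ok_sg hac)).add (ok_gs _), ?_⟩
        simp only [map_add, cls_sg, map_sub, cls_gs, Multiset.sum_singleton, cls_rest_of_mem hV,
          hVi]
        abel
      obtain ⟨m, hm, hl⟩ := exists_lenIn_ge hV' (fun h0 => by
        simpa using congrArg Prod.fst h0) hY
      refine ⟨m, hm, ?_⟩
      convert hl using 1
      have e₁ := rest_add_sg i V
      rw [hVi, ← sg_sub_add i _ c] at e₁
      grind
    obtain ⟨V₁, Y₁, n₁, hn₁, hV₁, w₁, hA₁, hY₁⟩ := h.high.exists_atom_comp hi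
    by_cases y₁ : Y₁.2 i = 0
    · obtain ⟨m, hm, hl⟩ := cover V₁ Y₁ n₁ hA₁ hV₁.1 y₁ hY₁
      exact ⟨m, by omega, hl⟩
    obtain ⟨V₂, Y₂, n₂, rfl, hV₂, w₂, rfl, hY₂⟩ := hY₁.exists_atom_comp y₁
    by_cases y₂ : Y₂.2 i = 0
    · obtain ⟨m, hm, hl⟩ := cover (V₁ + V₂) Y₂ n₂ (by rw [hA₁]; abel)
        ((Blk κ).add_mem hV₁.1 hV₂.1) y₂ hY₂
      exact ⟨m, by omega, hl⟩
    obtain ⟨V₃, Y₃, n₃, rfl, hV₃, w₃, rfl, hY₃⟩ := hY₂.exists_atom_comp y₂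
    have x₁ := hV₁.1.1.valid w₁
    have x₂ := hV₂.1.1.valid w₂
    have x₃ := hV₃.1.1.valid w₃
    have eV := fun j => val_eq hA₁ i j
    simp only [Prod.snd_add, Pi.add_apply] at eV
    have hY₃0 := fun j => hY₃.mem.1.nonneg i j
    have y₃ : Y₃.2 i = 0 := hY₃.mem.1.eq_zero (j := z) (by
      have := eV z; have := x₁ z; have := x₂ z; have := x₃ z; omega)
    have hv := key (V₃.2 i) x₃ (fun j => by
      have := eV j; have := x₁ j; have := x₂ j; have := hY₃0 j; omega)
    have hM := (Blk κ).add_mem hV₁.1 hV₂.1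
    have hA₂ : A = V₁ + V₂ + (V₃ + Y₃) := by rw [hA₁]; abel
    generalize V₁ + V₂ = M at hM hA₂
    have hAi : A.2 i = M.2 i + V₃.2 i := by rw [hA₂]; simp [y₃]
    -- Shrinking the third atom by even amounts moves enough valuation to the other two to take out
    -- `c`.
    have hV₃' := rest_add_sg_mem hV₃.1 (red_valid (V₃.2 i)) (map_red h2 _ _)
    have hM' : rest i M + sg i (A.2 i - red (V₃.2 i) - c) + gs {κ i c} ∈ Blk κ := by
      refine ⟨((hM.1.rest i).add (ok_sg hv)).add (ok_gs _), ?_⟩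
      simp only [map_add, cls_sg, hκkey, cls_gs, Multiset.sum_singleton, cls_rest_of_mem hM]
      rw [hAi, map_add]
      abel
    obtain ⟨m₁, hm₁, hl₁⟩ := exists_lenIn_ge hV₃' (rest_add_sg_ne_zero (red_valid _)) hY₃
    obtain ⟨m, hm, hl⟩ := exists_lenIn_ge hM' (fun h0 => by
        simpa using congrArg Prod.fst h0) hl₁
    refine ⟨m, by omega, ?_⟩
    convert hl using 1
    have e₁ := rest_add_sg i M
    have e₂ := rest_add_sg i V₃
    have e₃ : (sg i (A.2 i - red (V₃.2 i) - c) : Amb G E J) + sg i (red (V₃.2 i)) =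
        sg i (A.2 i - c) := by rw [← sg_add]; congr 1; abel
    have e₄ : (sg i (A.2 i - c) : Amb G E J) + sg i c = sg i (M.2 i) + sg i (V₃.2 i) := by
      rw [sg_sub_add, hAi, sg_add]
    grind
  · intro m _ _ hm
    obtain ⟨W₁, Y, n, rfl, hW₁, hg, hAW, hY⟩ := hm.exists_atom_mem (g := κ i c) (by simp)
    obtain ⟨R, hR, rfl⟩ := exists_eq_add_gs hW₁.1.1 hg
    have hfree := hW₁.zeroSumFree (ok_gs _) (gs_singleton_ne_zero _)
    have hAR : A = R + sg i c + Y := by grind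
    have hmem : R + sg i c ∈ Blk κ :=
      ⟨hR.add (ok_sg hcv), by simpa using hW₁.1.2⟩
    refine lift_of_le_two hmem (fun h0 => sg_ne_zero (G := G) (E := E) hcv
      ((ok_sg hcv).eq_zero_of_add hR (by rw [add_comm]; exact h0))) hY (fun t ht => ?_) hAR
    by_contra hcon
    obtain ⟨t, rfl⟩ : ∃ t', t = t' + 3 := ⟨t - 3, by omega⟩
    have eR : R + sg i c = rest i R + sg i (R.2 i + c) := by
      conv_lhs => rw [← rest_add_sg i R]
      rw [sg_add]; abel
    rw [eR] at ht
    have hfr : ZeroSumFree κ (rest i R) := by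
      by_cases hRi : R.2 i = 0
      · rwa [rest_eq_self hRi]
      · rw [← rest_add_sg i R] at hfree
        exact hfree.of_add (ok_sg (hR.valid hRi))
    obtain ⟨X₁, X₂, Z, hXZ, hX₁, hX₂, hZ, y₁, y₂, y₃⟩ := hfr.exists_three (by simp) ht
    rw [← eR] at hXZ
    have x₁ := hX₁.1.valid y₁
    have x₂ := hX₂.1.valid y₂
    have x₃ := hZ.1.valid y₃
    have hY0 := fun j => hY.mem.1.nonneg i j
    have hA₂ : A = X₁ + X₂ + Z + Y := by rw [hAR, hXZ]
    have eV := fun j => val_eq hA₂ i j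
    simp only [Prod.snd_add, Pi.add_apply] at eV
    have hYi : Y.2 i = 0 := hY.mem.1.eq_zero (j := z) (by
      have := eV z; have := x₁ z; have := x₂ z; have := x₃ z; omega)
    have hRi : R.2 i + c = A.2 i := by rw [hAR]; simp [hYi]
    have hv := key (Z.2 i) x₃ (fun j => by
      have := eV j; have := x₁ j; have := x₂ j; have := hY0 j; omega)
    have hZ' := rest_add_sg_mem hZ (red_valid (Z.2 i)) (map_red h2 _ _)
    refine rest_add_sg_ne_zero (red_valid (Z.2 i)) (hfree _
      (rest i (X₁ + X₂) + sg i (A.2 i - red (Z.2 i) - c)) hZ'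
      (((hX₁.1.add hX₂.1).rest i).add (ok_sg hv)) ?_)
    have e₁ := congrArg (rest i) hXZ
    rw [rest_add, rest_sg, add_zero, rest_add] at e₁
    have e₂ : (sg i (A.2 i - red (Z.2 i) - c) : Amb G E J) + sg i (red (Z.2 i)) = sg i (R.2 i) := by
      rw [← sg_add, ← hRi]; congr 1; abel
    have e₃ := rest_add_sg i R
    grind

/-- Over an elementary `2`-group there is no critical element with two nonzero components. -/
theorem false_of_two_comp (h2 : ∀ g : G, 2 • g = 0) (h : Critical κ A k d) {i i' : I}
    (hne : i ≠ i') (hi : A.2 i ≠ 0) (hi' : A.2 i' ≠ 0) : False := by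
  have := h.two_le
  rcases Nat.lt_or_ge d 3 with hd | hd
  · obtain rfl : d = 2 := by omega
    exact h.false_of_gap_two h2 hne hi hi'
  · have h1 := h.len_le_three h2 hi
    have h2' := h.two_le_len
    obtain rfl | rfl : k = 2 ∨ k = 3 := by omega
    · exact h.len_ne_two h2 hd hi
    · exact h.len_ne_three h2 hne hi hi'

end Critical
end LengthThree

/-! ### The model of a reduced seminormal finitely primary monoid -/

section Component

/-- A reduced seminormal finitely primary monoid of rank `s` consists of the identity and the
elements of `E × ℤ ^ s` with positive valuations. -/
theorem exists_model {M : Type u} [CancelCommMonoid M] {s : ℕ} (hred : IsReducedMonoid M)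
    (hsemi : IsSeminormal M) (hprim : IsFinitelyPrimaryOfRank M s) :
    1 ≤ s ∧ ∃ (E : Type u) (_ : AddCommGroup E) (φ : M → E × (Fin s → ℤ)),
      Function.Injective φ ∧ φ 1 = 0 ∧ (∀ a b, φ (a * b) = φ a + φ b) ∧
      ∀ x, (x = 0 ∨ Valid x) ↔ ∃ a, φ a = x := by
  obtain ⟨hs, E, iE, ψ, α, hψ, -, hdvd, hcond⟩ := hprim
  refine ⟨hs, Additive E, inferInstance,
    fun a => (Additive.ofMul (ψ a).1, fun j => (((ψ a).2.toAdd j : ℕ) : ℤ)), ?_, ?_, ?_, ?_⟩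
  · intro a b hab
    apply hψ
    simp only [Prod.mk.injEq] at hab
    refine Prod.ext (Additive.ofMul.injective hab.1) ?_
    apply Multiplicative.toAdd.injective
    funext j
    exact_mod_cast congrFun hab.2 j
  · refine Prod.ext (by simp) (funext fun j => by simp)
  · intro a b
    refine Prod.ext (by simp) (funext fun j => by simp)
  · intro x
    constructor
    · rintro (rfl | hx)
      · exact ⟨1, Prod.ext (by simp) (funext fun j => by simp)⟩
      let ξ : E × Multiplicative (Fin s → ℕ) :=
        (x.1.toMul, Multiplicative.ofAdd fun j => (x.2 j).toNat)
      obtain ⟨a, ha⟩ := hcond ξ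
      obtain ⟨b, hb⟩ := hcond 1
      rw [mul_one] at hb
      -- All valuations of `ξ` are positive, so its powers from `α` on are divisible by the
      -- conductor element. Seminormality, applied to `ξ` written as the fraction `a / b`, then
      -- gives `ξ` itself.
      have hpow : ∀ m ≥ α, ∃ c, ψ c = ξ ^ m := by
        intro m hm
        obtain ⟨c, hc⟩ := hcond (ξ.1 ^ m, Multiplicative.ofAdd fun j => m * (x.2 j).toNat - α)
        refine ⟨c, hc.trans (Prod.ext ?_ ?_)⟩
        · simp [primeProd]
        · apply Multiplicative.toAdd.injective
          funext j
          have h1 : 1 ≤ (x.2 j).toNat := by have := hx j; omega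
          have h2 : α ≤ m * (x.2 j).toNat := hm.trans (Nat.le_mul_of_pos_right m h1)
          simp [primeProd, ξ]
          omega
      have hcancel : ∀ c m, ψ c = ξ ^ m → c * b ^ m = a ^ m := by
        intro c m hc
        apply hψ
        rw [map_mul, map_pow, map_pow, hc, ha, hb, mul_pow, mul_comm]
      obtain ⟨c, hc⟩ := hsemi (Algebra.GrothendieckGroup.of a / Algebra.GrothendieckGroup.of b)
        ⟨α, fun m hm => by
          obtain ⟨c, hc⟩ := hpow m hm
          refine ⟨c, ?_⟩
          rw [div_pow, eq_div_iff_mul_eq', ← map_pow, ← map_pow, ← map_mul,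
            hcancel c m hc]⟩
      rw [eq_div_iff_mul_eq', ← map_mul, mul_comm] at hc
      have hcb := Algebra.GrothendieckGroup.of_injective hc
      have hψc : ψ c = ξ := by
        have := congrArg ψ hcb
        rw [map_mul, ha, hb] at this
        exact mul_left_cancel this
      refine ⟨c, ?_⟩
      refine Prod.ext (congrArg Additive.ofMul (congrArg Prod.fst hψc)) (funext fun j => ?_)
      have := hx j
      simp only [hψc, ξ, toAdd_ofAdd]
      omega
    · rintro ⟨a, rfl⟩
      by_cases h : IsUnit a
      · left
        rw [hred a h]
        exact Prod.ext (by simp) (funext fun j => by simp)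
      · right
        obtain ⟨y, hy⟩ := hdvd a h
        intro j
        simp only [hy, primeProd, Prod.snd_mul, toAdd_mul, toAdd_ofAdd, Pi.add_apply]
        omega

/-- Extending a homomorphism from a monoid to the ambient group of its model. -/
theorem exists_extension {M E J G : Type*} [Finite J] [CancelCommMonoid M] [AddCommGroup E]
    [AddCommGroup G] {φ : M → E × (J → ℤ)} (hφ : Function.Injective φ)
    (fmul : ∀ a b, φ (a * b) = φ a + φ b) (hr : ∀ x, (x = 0 ∨ Valid x) ↔ ∃ a, φ a = x)
    (f : M →* Multiplicative G) :
    ∃ κ : (E × (J → ℤ)) →+ G, ∀ a, κ (φ a) = (f a).toAdd := by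
  -- Adding a large constant makes all valuations positive, so the ambient group is the quotient
  -- group of the monoid.
  have hex : ∀ x : E × (J → ℤ), ∃ a b, x = φ a - φ b := by
    intro x
    obtain ⟨N, hN⟩ : ∃ N : ℕ, ∀ j, 1 ≤ x.2 j + N := by
      cases nonempty_fintype J
      refine ⟨∑ j, (1 - x.2 j).toNat, fun j => ?_⟩
      have := Finset.single_le_sum (f := fun j => (1 - x.2 j).toNat) (fun _ _ => Nat.zero_le _)
        (Finset.mem_univ j)
      beta_reduce at this
      zify at this ⊢
      omega
    obtain ⟨a, ha⟩ := (hr (x + constVal J (N + 1))).1 (Or.inr fun j => by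
      have := hN j
      simp only [Prod.snd_add, Pi.add_apply, constVal_snd]; omega)
    obtain ⟨b, hb⟩ := (hr (constVal J (N + 1))).1 (Or.inr fun j => by
      simp only [constVal_snd]; omega)
    exact ⟨a, b, by rw [ha, hb]; abel⟩
  choose a b hab using hex
  have wd : ∀ a b a' b', φ a - φ b = φ a' - φ b' →
      (f a).toAdd - (f b).toAdd = (f a').toAdd - (f b').toAdd := by
    intro a b a' b' h
    have e : a * b' = a' * b := hφ (by
      rw [fmul, fmul]
      exact sub_eq_sub_iff_add_eq_add.1 h)
    have := congrArg (fun x => (f x).toAdd) e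
    simp only [map_mul, toAdd_mul] at this
    exact sub_eq_sub_iff_add_eq_add.2 this
  have f1 : φ 1 = 0 := by simpa using fmul 1 1
  refine ⟨AddMonoidHom.mk' (fun x => (f (a x)).toAdd - (f (b x)).toAdd) fun x y => ?_, fun c => ?_⟩
  · have := wd (a (x + y)) (b (x + y)) (a x * a y) (b x * b y) (by
      rw [← hab, fmul, fmul]
      conv_lhs => rw [hab x, hab y]
      abel)
    rw [this]
    simp only [map_mul, toAdd_mul]
    abel
  · have := wd (a (φ c)) (b (φ c)) c 1 (by rw [← hab, f1, sub_zero])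
    simpa using this

/-- The submonoid of `E × ℤ ^ J` consisting of zero and the elements with positive valuations. -/
def posVal (E J : Type*) [AddCommGroup E] : AddSubmonoid (E × (J → ℤ)) where
  carrier := {x | x = 0 ∨ Valid x}
  zero_mem' := Or.inl rfl
  add_mem' := by
    rintro x y (rfl | hx) (rfl | hy)
    · exact Or.inl (add_zero _)
    · exact Or.inr (by rwa [zero_add])
    · exact Or.inr (by rwa [add_zero])
    · exact Or.inr (hx.add hy)

variable {E J : Type*} [AddCommGroup E]

theorem posVal_nonneg {x : E × (J → ℤ)} (hx : x ∈ posVal E J) (j : J) : 0 ≤ x.2 j := by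
  rcases hx with rfl | hx
  · simp
  · have := hx j; omega

theorem posVal_reduced [Nonempty J] : ∀ x ∈ posVal E J, ∀ y ∈ posVal E J, x + y = 0 → x = 0 := by
  rintro x (rfl | hx) y hy h
  · rfl
  · exfalso
    have e := congrFun (congrArg Prod.snd h) (Classical.arbitrary J)
    have := hx (Classical.arbitrary J)
    have := posVal_nonneg hy (Classical.arbitrary J)
    simp only [Prod.snd_add, Pi.add_apply, Prod.snd_zero, Pi.zero_apply] at e
    omega

theorem isAtomIn_posVal [Nonempty J] {x : E × (J → ℤ)} (hx : Valid x) {j : J} (hj : x.2 j = 1) :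
    IsAtomIn (posVal E J) x := by
  refine ⟨Or.inr hx, ?_, ?_⟩
  · rintro rfl; simp at hj
  · rintro y (rfl | hy) z (rfl | hz) rfl
    · exact Or.inl rfl
    · exact Or.inl rfl
    · exact Or.inr rfl
    · exfalso
      have := hy j; have := hz j
      simp only [Prod.snd_add, Pi.add_apply] at hj
      omega

theorem lenIn_posVal_le [Fintype J] [Nonempty J] {x : E × (J → ℤ)} {m : ℕ}
    (h : LenIn (posVal E J) x m) : m ≤ minVal x := by
  refine le_minVal fun j => ?_
  let wt : (E × (J → ℤ)) →+ ℤ := (Pi.evalAddMonoidHom (fun _ : J => ℤ) j).comp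
    (AddMonoidHom.snd E (J → ℤ))
  exact h.le_weight wt fun y hy h0 => by
    rcases hy with rfl | hy
    · exact absurd rfl h0
    · exact hy j

/-- The element of constant valuation 1 is an atom and can be split off until the minimal valuation
is 1, when the remainder is an atom. -/
theorem lenIn_posVal_minVal [Fintype J] [Nonempty J] {x : E × (J → ℤ)}
    (hx : x ∈ posVal E J) : LenIn (posVal E J) x (minVal x) := by
  have key : ∀ (n : ℕ) (x : E × (J → ℤ)), (∀ j, (n : ℤ) + 1 ≤ x.2 j) → ∀ j, x.2 j = n + 1 →
      LenIn (posVal E J) x (n + 1) := by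
    intro n
    induction n with
    | zero =>
      intro x hx j hj
      exact (isAtomIn_posVal (fun j => by have := hx j; push_cast at this; omega) (j := j)
        (by push_cast at hj; omega)).lenIn
    | succ n ih =>
      intro x hx j hj
      have h1 : IsAtomIn (posVal E J) (constVal J 1 : E × (J → ℤ)) :=
        isAtomIn_posVal (constVal_valid le_rfl) (j := j) rfl
      have := LenIn.atom_add h1 (ih (x - constVal J 1) (fun j => by
        have := hx j
        simp only [Prod.snd_sub, Pi.sub_apply, constVal_snd]; push_cast at this; omega) j (by
        simp only [Prod.snd_sub, Pi.sub_apply, constVal_snd]; push_cast at hj; omega))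
      rwa [add_sub_cancel] at this
  obtain ⟨j, hj⟩ := exists_eq_minVal (posVal_nonneg hx)
  rcases hx with rfl | hx
  · rw [show minVal (0 : E × (J → ℤ)) = 0 from Nat.le_zero.1 (minVal_le (j := j) (by simp))]
    exact LenIn.zero
  · have := hx j
    obtain ⟨n, hn⟩ : ∃ n, minVal x = n + 1 := ⟨minVal x - 1, by omega⟩
    have hle := minVal_le_val (fun j => by have := hx j; omega : ∀ j, 0 ≤ x.2 j)
    rw [hn] at hj hle ⊢
    exact key n x (fun j => by have := hle j; push_cast at this; omega) j (by push_cast at hj; omega)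

theorem setMax_eq_of_isGreatest {L : Set ℕ} {m : ℕ} (h : IsGreatest L m) : setMax L = m := by
  refine le_antisymm (iSup₂_le fun k hk => ?_) (le_iSup₂_of_le m h.1 le_rfl)
  exact_mod_cast h.2 hk

/-- The largest length of an element is the minimum of its valuations. -/
theorem setMax_lengthSet_eq {M : Type*} [CommMonoid M] [Fintype J] [Nonempty J]
    {φ : M → E × (J → ℤ)} (hφ : Function.Injective φ) (f1 : φ 1 = 0)
    (fmul : ∀ a b, φ (a * b) = φ a + φ b) (hr : ∀ x, (x = 0 ∨ Valid x) ↔ ∃ a, φ a = x) (a : M) :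
    setMax (lengthSet a) = minVal (φ a) := by
  have hL := mem_lengthSet_iff (B := posVal E J) posVal_reduced φ hφ f1 fmul hr a
  refine setMax_eq_of_isGreatest ⟨(hL _).2 (lenIn_posVal_minVal ((hr _).2 ⟨a, rfl⟩)), fun m hm => ?_⟩
  exact lenIn_posVal_le ((hL m).1 hm)

end Component

/-! ### From gaps to distances -/

section Distances

/-- The largest length up to k and the smallest length from k + d - 1 on are adjacent; `2 ≤ d` makes
them distinct. -/
theorem exists_distance {L : Set ℕ} {d : ℕ} (hd : 2 ≤ d)
    (h : ∃ k, (∃ m ≤ k, m ∈ L) ∧ (∃ m, k + d ≤ m + 1 ∧ m ∈ L) ∧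
      ∀ m ∈ L, m ≤ k ∨ k + d ≤ m + 1) : ∃ d' ∈ distanceSet L, d ≤ d' + 1 := by
  classical
  obtain ⟨k, ⟨m₁, hm₁, hL₁⟩, ⟨m₂, hm₂, hL₂⟩, hgap⟩ := h
  have h₁ : Nat.findGreatest (· ∈ L) k ∈ L := Nat.findGreatest_spec (P := (· ∈ L)) hm₁ hL₁
  have h₁k : Nat.findGreatest (· ∈ L) k ≤ k := Nat.findGreatest_le k
  have h₁max : ∀ m ∈ L, m ≤ k → m ≤ Nat.findGreatest (· ∈ L) k := fun m hm hmk =>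
    Nat.le_findGreatest hmk hm
  have hex : ∃ m, k + d ≤ m + 1 ∧ m ∈ L := ⟨m₂, hm₂, hL₂⟩
  obtain ⟨h₂, h₂L⟩ := Nat.find_spec hex
  have h₂min : ∀ m, k + d ≤ m + 1 → m ∈ L → Nat.find hex ≤ m := fun m h h' =>
    Nat.find_min' hex ⟨h, h'⟩
  set a := Nat.findGreatest (· ∈ L) k
  set b := Nat.find hex
  refine ⟨b - a, ⟨by omega, a, h₁, by rwa [show a + (b - a) = b by omega], fun m hm hcon => ?_⟩,
    by omega⟩
  rcases hgap m hm with h | h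
  · have := h₁max m hm h; omega
  · have := h₂min m h hm; omega

theorem exists_setMax_eq {L : Set ℕ} (h : L.Nonempty) (hb : BddAbove L) :
    ∃ d ∈ L, setMax L = d :=
  ⟨sSup L, Nat.sSup_mem h hb, setMax_eq_of_isGreatest ⟨Nat.sSup_mem h hb, fun _ hm =>
    le_csSup hb hm⟩⟩

theorem le_setMax {L : Set ℕ} {m : ℕ} (h : m ∈ L) : (m : ℕ∞) ≤ setMax L :=
  le_iSup₂_of_le m h le_rfl

end Distances

/-! ### Orders of elements and distances of zero-sum sequences -/

section Orders

variable {G : Type*} [AddCommGroup G]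

/-- The zero-sum multisets. -/
def zeroSum (G : Type*) [AddCommGroup G] : AddSubmonoid (Multiset G) where
  carrier := {S | S.sum = 0}
  zero_mem' := Multiset.sum_zero
  add_mem' := fun {S T} hS hT => by
    have hS' : S.sum = 0 := hS
    have hT' : T.sum = 0 := hT
    show (S + T).sum = 0
    rw [Multiset.sum_add, hS', hT', add_zero]

theorem mem_zeroSum {S : Multiset G} : S ∈ zeroSum G ↔ S.sum = 0 := Iff.rfl

theorem mem_lengthSet_zeroSumMonoid (S : zeroSumMonoid G) (m : ℕ) :
    m ∈ lengthSet S ↔ LenIn (zeroSum G) (S : Seq G).toAdd m := by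
  refine mem_lengthSet_iff (B := zeroSum G) ?_ (fun S : zeroSumMonoid G => (S : Seq G).toAdd)
    ?_ rfl (fun _ _ => rfl) ?_ S m
  · intro x _ y _ h
    exact (add_eq_zero.1 h).1
  · intro S T h
    exact Subtype.ext (Multiplicative.toAdd.injective h)
  · intro x
    exact ⟨fun h => ⟨⟨Multiplicative.ofAdd x, h⟩, rfl⟩, fun ⟨a, ha⟩ => ha ▸ a.2⟩

/-- The pairs `(i, j)` such that `g ^ i (-g) ^ j` is a zero-sum sequence. -/
def zeroSumPair (g : G) : AddSubmonoid (ℕ × ℕ) where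
  carrier := {x | x.1 • g = x.2 • g}
  zero_mem' := by simp
  add_mem' := fun {x y} hx hy => by
    have hx' : x.1 • g = x.2 • g := hx
    have hy' : y.1 • g = y.2 • g := hy
    show (x.1 + y.1) • g = (x.2 + y.2) • g
    rw [add_nsmul, add_nsmul, hx', hy']

theorem mem_zeroSumPair {g : G} {x : ℕ × ℕ} : x ∈ zeroSumPair g ↔ x.1 • g = x.2 • g := Iff.rfl

/-- The sequence `g ^ i (-g) ^ j`. -/
def pairSeq (g : G) : (ℕ × ℕ) →+ Multiset G where
  toFun x := x.1 • {g} + x.2 • {-g}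
  map_zero' := by simp
  map_add' x y := by
    simp only [Prod.fst_add, Prod.snd_add, add_nsmul]
    abel

theorem pairSeq_apply (g : G) (x : ℕ × ℕ) : pairSeq g x = x.1 • {g} + x.2 • {-g} := rfl

theorem lenIn_pairSeq {g : G} (hg : g ≠ -g) (x : ℕ × ℕ) (m : ℕ) :
    LenIn (zeroSumPair g) x m ↔ LenIn (zeroSum G) (pairSeq g x) m := by
  classical
  have c₁ : ∀ x, (pairSeq g x).count g = x.1 := fun x => by
    simp [pairSeq_apply, hg]
  have c₂ : ∀ x, (pairSeq g x).count (-g) = x.2 := fun x => by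
    simp [pairSeq_apply, hg.symm]
  refine lenIn_map_iff (pairSeq g) (fun x y h => ?_) (fun x => ?_) (fun x Y _ Y' _ h => ?_) x m
  · exact Prod.ext (by rw [← c₁ x, h, c₁]) (by rw [← c₂ x, h, c₂])
  · rw [mem_zeroSumPair, mem_zeroSum, pairSeq_apply, Multiset.sum_add, Multiset.sum_nsmul,
      Multiset.sum_nsmul, Multiset.sum_singleton, Multiset.sum_singleton, neg_nsmul,
      ← sub_eq_add_neg, sub_eq_zero]
  · refine ⟨(Y.count g, Y.count (-g)), ?_⟩
    ext a
    by_cases h₁ : a = g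
    · rw [h₁, c₁]
    by_cases h₂ : a = -g
    · rw [h₂, c₂]
    have e := congrArg (Multiset.count a) h
    simp only [pairSeq_apply, Multiset.count_add, Multiset.count_nsmul, Multiset.count_singleton,
      h₁, h₂, if_false, mul_zero, add_zero] at e ⊢
    omega

variable {g : G}

theorem eq_of_dvd_pair {g : G} {y : ℕ} (h : y • g = 0) (hy : y ≤ addOrderOf g) :
    y = 0 ∨ y = addOrderOf g := by
  rcases Nat.eq_zero_or_pos y with h0 | h0
  · exact Or.inl h0
  · exact Or.inr (le_antisymm hy (Nat.le_of_dvd h0 (addOrderOf_dvd_of_nsmul_eq_zero h)))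

theorem isAtomIn_order_zero (h : 0 < addOrderOf g) :
    IsAtomIn (zeroSumPair g) (addOrderOf g, 0) := by
  refine ⟨by simp [mem_zeroSumPair, addOrderOf_nsmul_eq_zero], by simp [h.ne'], ?_⟩
  rintro ⟨y₁, y₂⟩ hy ⟨z₁, z₂⟩ hz e
  simp only [Prod.mk_add_mk, Prod.mk.injEq, mem_zeroSumPair, Prod.mk_eq_zero] at e hy hz ⊢
  obtain rfl : y₂ = 0 := by omega
  obtain rfl : z₂ = 0 := by omega
  rw [zero_nsmul] at hy
  rcases eq_of_dvd_pair hy (by omega) with h | h <;> omega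

theorem isAtomIn_zero_order (h : 0 < addOrderOf g) :
    IsAtomIn (zeroSumPair g) (0, addOrderOf g) := by
  refine ⟨by simp [mem_zeroSumPair, addOrderOf_nsmul_eq_zero], by simp [h.ne'], ?_⟩
  rintro ⟨y₁, y₂⟩ hy ⟨z₁, z₂⟩ hz e
  simp only [Prod.mk_add_mk, Prod.mk.injEq, mem_zeroSumPair, Prod.mk_eq_zero] at e hy hz ⊢
  obtain rfl : y₁ = 0 := by omega
  obtain rfl : z₁ = 0 := by omega
  rw [zero_nsmul] at hy
  rcases eq_of_dvd_pair hy.symm (by omega) with h | h <;> omega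

theorem isAtomIn_one_one (h0 : g ≠ 0) : IsAtomIn (zeroSumPair g) (1, 1) := by
  refine ⟨rfl, by simp, ?_⟩
  rintro ⟨y₁, y₂⟩ hy ⟨z₁, z₂⟩ hz e
  simp only [Prod.mk_add_mk, Prod.mk.injEq, mem_zeroSumPair, Prod.mk_eq_zero] at e hy hz ⊢
  obtain rfl | rfl : y₁ = 0 ∨ y₁ = 1 := by omega
  · obtain rfl | rfl : y₂ = 0 ∨ y₂ = 1 := by omega
    · exact Or.inl ⟨rfl, rfl⟩
    · rw [zero_nsmul, one_nsmul] at hy; exact absurd hy.symm h0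
  · obtain rfl | rfl : y₂ = 0 ∨ y₂ = 1 := by omega
    · rw [zero_nsmul, one_nsmul] at hy; exact absurd hy h0
    · exact Or.inr ⟨by omega, by omega⟩

/-- An atom other than `(1, 1)` has a zero coordinate and is therefore a full power of `g` or `-g`;
the cofactor is then the opposite atom. -/
theorem lenIn_order_order {m : ℕ} (h : LenIn (zeroSumPair g) (addOrderOf g, addOrderOf g) m)
    (hN : 0 < addOrderOf g) : m = 2 ∨ m = addOrderOf g := by
  have hred : ∀ x ∈ zeroSumPair g, ∀ y ∈ zeroSumPair g, x + y = 0 → x = 0 :=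
    fun x _ y _ h => (add_eq_zero.1 h).1
  obtain ⟨f, hf, hsum, rfl⟩ := h
  by_cases hall : ∀ w ∈ f, w = (1, 1)
  · right
    rw [Multiset.eq_replicate_of_mem hall, Multiset.sum_replicate] at hsum
    simpa using congrArg Prod.fst hsum
  · left
    push Not at hall
    obtain ⟨⟨i, j⟩, hw, hne⟩ := hall
    have hat := hf _ hw
    obtain ⟨f', rfl⟩ := Multiset.exists_cons_of_mem hw
    have hf' : LenIn (zeroSumPair g) f'.sum f'.card :=
      ⟨f', fun w hw => hf w (Multiset.mem_cons_of_mem hw), rfl, rfl⟩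
    rw [Multiset.sum_cons] at hsum
    rw [Multiset.card_cons]
    have hij : i = 0 ∨ j = 0 := by
      by_contra! hcon
      obtain ⟨i, rfl⟩ : ∃ i', i = i' + 1 := ⟨i - 1, by omega⟩
      obtain ⟨j, rfl⟩ : ∃ j', j = j' + 1 := ⟨j - 1, by omega⟩
      have hm : (i + 1) • g = (j + 1) • g := hat.1
      rw [succ_nsmul, succ_nsmul] at hm
      rcases hat.2.2 (1, 1) rfl (i, j) (add_right_cancel hm) (by
        rw [Prod.mk_add_mk, add_comm 1, add_comm 1]) with h | h
      · simp at h
      · simp only [Prod.mk_eq_zero] at h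
        exact hne (by rw [h.1, h.2])
    obtain ⟨⟨a, b⟩, hab⟩ : ∃ p, f'.sum = p := ⟨_, rfl⟩
    rw [hab] at hsum hf'
    simp only [Prod.mk_add_mk, Prod.mk.injEq] at hsum
    have hm : i • g = j • g := hat.1
    have h0 := hat.2.1
    rcases hij with rfl | rfl
    · rw [zero_nsmul] at hm
      obtain rfl : j = addOrderOf g :=
        (eq_of_dvd_pair hm.symm (by omega)).resolve_left (fun h => h0 (by rw [h]; rfl))
      obtain rfl : b = 0 := by omega
      rw [zero_add] at hsum
      rw [hsum.1] at hf'
      rw [(isAtomIn_order_zero hN).lenIn_eq_one hred hf']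
    · rw [zero_nsmul] at hm
      obtain rfl : i = addOrderOf g :=
        (eq_of_dvd_pair hm (by omega)).resolve_left (fun h => h0 (by rw [h]; rfl))
      obtain rfl : a = 0 := by omega
      rw [zero_add] at hsum
      rw [hsum.2] at hf'
      rw [(isAtomIn_zero_order hN).lenIn_eq_one hred hf']

/-- An element of order `N ≥ 3` yields the distance `N - 2`. -/
theorem order_sub_two_mem (h : 3 ≤ addOrderOf g) :
    addOrderOf g - 2 ∈ monoidDistanceSet (zeroSumMonoid G) := by
  have hN : 0 < addOrderOf g := by omega
  have h0 : g ≠ 0 := by rintro rfl; simp at h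
  have hne : g ≠ -g := fun h1 => by
    have h2 : 2 • g = 0 := by
      rw [two_nsmul]
      conv_lhs => rw [h1]
      exact (congrArg (-g + ·) h1.symm).trans (neg_add_cancel g)
    have := Nat.le_of_dvd two_pos (addOrderOf_dvd_of_nsmul_eq_zero h2)
    omega
  set N := addOrderOf g with hNdef
  have hl₂ : LenIn (zeroSumPair g) (N, N) 2 := by
    have := (isAtomIn_order_zero hN).lenIn.add (isAtomIn_zero_order hN).lenIn
    simpa using this
  have hlN : LenIn (zeroSumPair g) (N, N) N :=
    ⟨Multiset.replicate N (1, 1), fun w hw => by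
      rw [Multiset.eq_of_mem_replicate hw]; exact isAtomIn_one_one h0,
      by rw [Multiset.sum_replicate]; simp, Multiset.card_replicate _ _⟩
  let S : zeroSumMonoid G := ⟨Multiplicative.ofAdd (pairSeq g (N, N)),
    ((lenIn_pairSeq hne _ _).1 hl₂).mem⟩
  have hS : ∀ m, m ∈ lengthSet S ↔ LenIn (zeroSumPair g) (N, N) m := fun m =>
    (mem_lengthSet_zeroSumMonoid S m).trans (lenIn_pairSeq hne _ _).symm
  refine Set.mem_iUnion.2 ⟨S, by omega, 2, (hS 2).2 hl₂, ?_, fun m hm hcon => ?_⟩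
  · rw [show 2 + (N - 2) = N by omega]
    exact (hS N).2 hlN
  · rcases lenIn_order_order ((hS m).1 hm) hN with h | h <;> omega

end Orders

/-! ### Transfer from the block monoid to the model -/

section BlockMonoid

variable {G : Type*} [AddCommGroup G] {n : ℕ}
  {E : Fin n → Type*} [∀ i, AddCommGroup (E i)] {J : Fin n → Type*} [∀ i, Fintype (J i)]
  [∀ i, DecidableEq (J i)] [∀ i, Nonempty (J i)]
  {M : Fin n → Type*} [∀ i, CancelCommMonoid (M i)]

/-- The embedding of a block monoid in the ambient monoid. -/
def toAmb (φ : ∀ i, M i → E i × (J i → ℤ)) (A : Seq G × (∀ i, M i)) : Amb G E J :=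
  (A.1.toAdd, fun i => φ i (A.2 i))

variable {φ : ∀ i, M i → E i × (J i → ℤ)} {ι : (∀ i, M i) →* Multiplicative G}
  {κ : ∀ i, (E i × (J i → ℤ)) →+ G}

theorem cls_toAmb (hκ : ∀ i a, κ i (φ i a) = (ι (Pi.mulSingle i a)).toAdd)
    (A : Seq G × (∀ i, M i)) : cls κ (toAmb φ A) = seqSum A.1 + (ι A.2).toAdd := by
  have : (ι A.2).toAdd = ∑ i, (ι (Pi.mulSingle i (A.2 i))).toAdd := by
    rw [← toAdd_prod, ← map_prod, Finset.univ_prod_mulSingle]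
  rw [this]
  simp only [cls, AddMonoidHom.coe_mk, ZeroHom.coe_mk, toAmb, hκ, seqSum]

theorem mem_blk_iff_toAmb (hr : ∀ i x, (x = 0 ∨ Valid x) ↔ ∃ a, φ i a = x)
    (hκ : ∀ i a, κ i (φ i a) = (ι (Pi.mulSingle i a)).toAdd) (X : Amb G E J) :
    X ∈ Blk κ ↔ ∃ A : blockMonoid ι, toAmb φ (A : Seq G × (∀ i, M i)) = X := by
  constructor
  · rintro ⟨hX, hc⟩
    choose a ha using fun i => (hr i (X.2 i)).1 (hX i)
    have e : toAmb φ (Multiplicative.ofAdd X.1, a) = X := Prod.ext rfl (funext ha)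
    refine ⟨⟨(Multiplicative.ofAdd X.1, a), ?_⟩, e⟩
    have := cls_toAmb (κ := κ) hκ (Multiplicative.ofAdd X.1, a)
    rw [e, hc] at this
    exact this.symm
  · rintro ⟨A, rfl⟩
    exact ⟨fun i => (hr i _).2 ⟨_, rfl⟩, (cls_toAmb hκ _).trans A.2⟩

theorem mem_lengthSet_block (hφ : ∀ i, Function.Injective (φ i))
    (f1 : ∀ i, φ i 1 = 0) (fmul : ∀ i a b, φ i (a * b) = φ i a + φ i b)
    (hr : ∀ i x, (x = 0 ∨ Valid x) ↔ ∃ a, φ i a = x)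
    (hκ : ∀ i a, κ i (φ i a) = (ι (Pi.mulSingle i a)).toAdd) (A : blockMonoid ι) (m : ℕ) :
    m ∈ lengthSet A ↔ LenIn (Blk κ) (toAmb φ (A : Seq G × (∀ i, M i))) m := by
  refine mem_lengthSet_iff (B := Blk κ) blk_reduced
    (fun A : blockMonoid ι => toAmb φ (A : Seq G × (∀ i, M i))) ?_ ?_ ?_
    (mem_blk_iff_toAmb hr hκ) A m
  · intro A B h
    replace h : toAmb φ (A : Seq G × (∀ i, M i)) = toAmb φ (B : Seq G × (∀ i, M i)) := h
    have h₁ : (A : Seq G × (∀ i, M i)).1.toAdd = (B : Seq G × (∀ i, M i)).1.toAdd :=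
      (Prod.ext_iff.1 h).1
    refine Subtype.ext (Prod.ext (Multiplicative.toAdd.injective h₁)
      (funext fun i => hφ i (congrFun (Prod.ext_iff.1 h).2 i)))
  · exact Prod.ext rfl (funext f1)
  · intro A B
    exact Prod.ext rfl (funext fun i => fmul i _ _)

theorem blockNorm_eq (hφ : ∀ i, Function.Injective (φ i))
    (f1 : ∀ i, φ i 1 = 0) (fmul : ∀ i a b, φ i (a * b) = φ i a + φ i b)
    (hr : ∀ i x, (x = 0 ∨ Valid x) ↔ ∃ a, φ i a = x) (A : Seq G × (∀ i, M i)) : blockNorm A = (norm (toAmb φ A) : ℕ∞) := by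
  unfold blockNorm norm
  simp only [setMax_lengthSet_eq (hφ _) (f1 _) (fmul _) (hr _)]
  push_cast
  rfl

theorem bddAbove_lenIn (X : Amb G E J) : BddAbove {m | LenIn (Blk κ) X m} :=
  ⟨(weight X).toNat, fun m hm => by
    have := LenIn.le_weight (B := Blk κ) weight (fun _ hx h => one_le_weight hx.1 h) hm
    omega⟩

end BlockMonoid

end WeaklyKrull

/-! ### The proposition -/

theorem proposition3p2 {G : Type v} [AddCommGroup G] [Finite G] [Nontrivial G]
    {n : ℕ} (hn : 1 ≤ n) (D : Fin n → Type u) [∀ i, CancelCommMonoid (D i)] (s : Fin n → ℕ)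
    (hred : ∀ i, IsReducedMonoid (D i))
    (hsemi : ∀ i, IsSeminormal (D i))
    (hprim : ∀ i, IsFinitelyPrimaryOfRank (D i) (s i))
    (ι : (∀ i, D i) →* Multiplicative G)
    (hcase : {i : Fin n | 1 < s i}.ncard ≤ 1 ∨ ∀ g : G, 2 • g = 0)
    (A : blockMonoid ι)
    (hA : setMax (monoidDistanceSet (zeroSumMonoid G)) + 2 ≤ setMax (distanceSet (lengthSet A))) :
    ∃ A' : blockMonoid ι,
      blockNorm (A' : Seq G × (∀ i, D i)) < blockNorm (A : Seq G × (∀ i, D i)) ∧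
      setMax (distanceSet (lengthSet A)) ≤ setMax (distanceSet (lengthSet A')) + 1 := by
  have hmodel := fun i => exists_model (hred i) (hsemi i) (hprim i)
  have hs : ∀ i, 1 ≤ s i := fun i => (hmodel i).1
  choose E instE φ hφ f1 fmul hr using fun i => (hmodel i).2
  have hne : ∀ i, Nonempty (Fin (s i)) := fun i => ⟨⟨0, hs i⟩⟩
  choose κ hκ' using fun i => exists_extension (hφ i) (fmul i) (hr i)
    (ι.comp (MonoidHom.mulSingle D i))
  have hκ : ∀ i a, κ i (φ i a) = (ι (Pi.mulSingle i a)).toAdd := hκ'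
  have hlen := fun A => mem_lengthSet_block hφ f1 fmul hr hκ A
  have hnorm := fun A => blockNorm_eq (G := G) hφ f1 fmul hr A
  have hdb : ∀ A : blockMonoid ι, BddAbove (distanceSet (lengthSet A)) := fun A => by
    obtain ⟨b, hb⟩ := bddAbove_lenIn (κ := κ) (toAmb φ (A : Seq G × (∀ i, D i)))
    refine ⟨b, ?_⟩
    rintro d ⟨-, k, -, hk, -⟩
    have : k + d ≤ b := hb ((hlen A _).1 hk)
    omega
  have hnonempty : (distanceSet (lengthSet A)).Nonempty := by
    by_contra h0
    rw [Set.not_nonempty_iff_eq_empty.1 h0] at hA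
    simp [setMax] at hA
  obtain ⟨d, ⟨-, k, hk, hkd, hgap⟩, hd⟩ := exists_setMax_eq hnonempty (hdb A)
  rw [hd] at hA ⊢
  have hd2 : 2 ≤ d := by
    have : (2 : ℕ∞) ≤ d := le_trans le_add_self hA
    exact_mod_cast this
  -- Orders above 2 enter Δ(G) diminished by 2, which explains the 2 added in `hA`.
  have hord : ∀ g : G, 0 < addOrderOf g ∧ addOrderOf g ≤ d := by
    intro g
    refine ⟨addOrderOf_pos g, ?_⟩
    rcases Nat.lt_or_ge 2 (addOrderOf g) with h | h
    · have h1 := le_setMax (order_sub_two_mem h)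
      have h2 : ((addOrderOf g - 2 + 2 : ℕ) : ℕ∞) ≤ d := by
        push_cast
        exact le_trans (by gcongr; exact_mod_cast h1) hA
      have h3 : addOrderOf g - 2 + 2 ≤ d := by exact_mod_cast h2
      omega
    · omega
  by_contra! hcon
  -- The negated conclusion is exactly the minimality condition: a gap of size d - 1 below the norm
  -- of `A` would yield a suitable `A'`.
  have hcrit : Critical κ (toAmb φ (A : Seq G × (∀ i, D i))) k d := by
    refine ⟨hd2, (hlen A _).1 hk, (hlen A _).1 hkd, fun m hm => ?_, fun X hX hXn hXg => ?_⟩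
    · have := hgap m ((hlen A m).2 hm)
      omega
    · obtain ⟨A', rfl⟩ := (mem_blk_iff_toAmb hr hκ X).1 hX
      have h1 := hcon A' (by rw [hnorm, hnorm]; exact_mod_cast hXn)
      obtain ⟨d', hd', hdd⟩ := exists_distance (L := lengthSet A') hd2 (by
        obtain ⟨k', ⟨m₁, h₁, l₁⟩, ⟨m₂, h₂, l₂⟩, h₃⟩ := hXg
        exact ⟨k', ⟨m₁, h₁, (hlen A' _).2 l₁⟩, ⟨m₂, h₂, (hlen A' _).2 l₂⟩,
          fun m hm => h₃ m ((hlen A' m).1 hm)⟩)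
      have h2 := le_setMax hd'
      have h3 : (d : ℕ∞) ≤ (d' : ℕ∞) + 1 := by exact_mod_cast hdd
      exact absurd (h3.trans (by gcongr)) h1.not_ge
  generalize toAmb φ (A : Seq G × (∀ i, D i)) = X at hcrit
  by_cases hsupp : ∃ i, SuppIn i X
  · obtain ⟨i, hi⟩ := hsupp
    exact hcrit.false_of_suppIn hord hi
  · obtain ⟨i, hi⟩ : ∃ i, X.2 i ≠ 0 := by
      by_contra! h0
      exact hsupp ⟨⟨0, hn⟩, fun i' _ => h0 i'⟩
    obtain ⟨i', hne', hi'⟩ : ∃ i', i' ≠ i ∧ X.2 i' ≠ 0 := by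
      by_contra! h0
      exact hsupp ⟨i, h0⟩
    rcases hcase with hcase | h2
    · have hrank : ∀ i, X.2 i ≠ 0 → 1 < s i := by
        intro i hi
        obtain ⟨W, C, m, hm, hW, hWi, hX, hC⟩ := hcrit.low.exists_atom_comp hi
        have hl : IsLow κ X k W := ⟨C, m, hX, hC, by omega⟩
        obtain ⟨j₀, hj₀⟩ := hcrit.exists_val_eq_one hW hl hWi
        obtain ⟨j₁, hj₁⟩ := hcrit.exists_val_ne_one hW hl i
        by_contra hle
        have : j₁ = j₀ := Fin.ext (by have := j₁.2; have := j₀.2; omega)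
        exact hj₁ (this ▸ hj₀)
      exact hne' ((Set.ncard_le_one (Set.toFinite _)).1 hcase i' (hrank i' hi') i (hrank i hi))
    · exact hcrit.false_of_two_comp h2 hne'.symm hi hi'
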